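/- Let $m\ge 2$ and $k,q\in\mathbb{C}^\times$ (arbitrary). Let $\epsilon_1,\dots,\epsilon_m$ be the standard basis of $\mathbb{Z}^m$, $T=(\mathbb{C}^\times)^m$, $\mathbb{C}[T]=\bigoplus_{\lambda\in\mathbb{Z}^m}\mathbb{C}t^\lambda$, $\mathbb{C}(T)$ its field of fractions, $\alpha_i=\epsilon_i-\epsilon_{i+1}$ $(1\le i<m)$, $\mathbb{Z}c+R_0=\{rc+\epsilon_i-\epsilon_j : r\in\mathbb{Z},\ i\ne j\}$, and $e_q^{rc+\lambda}=q^rt^\lambda$. *Weyl group.* $W=S_m\ltimes\mathbb{Z}^m$, with translations $\tau(\lambda)$ and $w\epsilon_j=\epsilon_{w(j)}$ for $w\in S_m$, acts on $\mathbb{C}(T)$ by the automorphisms with $w_q(t^\mu)=t^{w\mu}$ for $w\in S_m$ and $\tau(\lambda)_q(t^\mu)=q^{-\langle\lambda,\mu\rangle}t^\mu$. It is generated by $s_i=(i,i+1)$ $(1\le i<m)$ and $\zeta=\sigma\tau(\epsilon_m)$, $\sigma=s_1\cdots s_{m-1}$. Let $\mathbb{C}^{k,q}_{\sigma,\nabla}[T]\subset\mathbb{C}(T)$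 be the ($W$-stable) subalgebra generated by $\mathbb{C}[T]$ and all $(1-e_q^a)^{-1}$, $(k^{-1}-ke_q^a)^{-1}$ with $a\in\mathbb{Z}c+R_0$, and let $\mathbb{C}^{k,q}_{\sigma,\nabla}[T]\#_qW$ be the smash product, in which $wf=(w_qf)w$. *Hecke algebra.* For $\kappa\in\mathbb{C}^\times$ let $H(\kappa)$ be the extended affine Hecke algebra of $\mathrm{GL}_m$: the unital algebra generated by $T_1,\dots,T_{m-1},T_\zeta^{\pm1}$ with the braid relations of type $A_{m-1}$, $(T_i-\kappa)(T_i+\kappa^{-1})=0$, $T_\zeta T_i=T_{i+1}T_\zeta$ $(1\le i<m-1)$, and $T_\zeta^m$ central. Write $T_w$ $(w\in S_m)$ for the usual elements, $Y_i=T_{i-1}^{-1}\cdots T_1^{-1}T_\zeta T_{m-1}\cdots T_i$ (these commute), $Y^\lambda=\prod_iY_i^{\lambda_i}$, and $f(Y)=\sum_\lambda f_\lambda Y^\lambda$ for $f=\sum_\lambda f_\lambda t^\lambda\in\mathbb{C}[T]$. For $I\subseteq\{1,\dots,m-1\}$ let $H_{0,I}(\kappa)$ be the subalgebra generated by the $T_i$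 $(i\in I)$ and $H_I(\kappa)$ the subalgebra generated by the $T_i$ $(i\in I)$ and all $f(Y)$. Let $\epsilon_\pm^\kappa:H(\kappa)\to\mathbb{C}$ be the character $T_i\mapsto\pm\kappa^{\pm1}$, $T_\zeta\mapsto1$. *The maps $\pi$ and $\nabla$.* Put $c_i^\kappa=(\kappa^{-1}-\kappa t^{\alpha_i})/(1-t^{\alpha_i})$. There are algebra homomorphisms $\pi^{k^{-1},q}:H(k^{-1})\to\mathbb{C}^{k,q}_{\sigma,\nabla}[T]\#_qW$ with $T_i\mapsto k^{-1}+c_i^{k^{-1}}(s_i-1)$, $T_\zeta\mapsto\zeta$, and $\nabla^{k,q}:\mathbb{C}^{k,q}_{\sigma,\nabla}[T]\#_qW\to\bigl(\mathbb{C}^{k,q}_{\sigma,\nabla}[T]\#_qW\bigr)\otimes H(k)$ with $f\mapsto f$, $s_i\mapsto(c_i^k)^{-1}s_iT_i+\frac{c_i^k-k}{c_i^k}s_i$, $\zeta\mapsto\zeta T_\zeta$. For a left $\mathbb{C}^{k,q}_{\sigma,\nabla}[T]\#_qW$-module $L$ and a left $H(k)$-module $M$ let $$\Gamma_L^{k,q}(M)_\nabla^W=\{\psi\in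 L\otimes_{\mathbb{C}}M:\ \nabla^{k,q}(w)\psi=\psi\ \text{ for all } w\in W\}$$ be the space of $W$-invariant solutions of the quantum affine KZ equations with values in $M$. *Parabolic data.* Fix a sign $\pm$ and $I\subseteq\{1,\dots,m-1\}$. Let $S_{m,I}=\langle s_i : i\in I\rangle$, let $S_m^I$ be the set of minimal length representatives of $S_m/S_{m,I}$, let $\overline{w_0}\in S_m^I$ be the representative of the coset of the longest element $w_0$, and let $I^*=\{i^* : i\in I\}$ with $\overline{w_0}(\alpha_i)=\alpha_{i^*}$. Let $\gamma\in T_I^{k^{\pm1}}=\{\gamma\in T:\gamma_i/\gamma_{i+1}=k^{\pm2}\ \text{ for all } i\in I\}$, and set $(\overline{w_0}\gamma^{-1})_j=\gamma_{\overline{w_0}^{-1}(j)}^{-1}$. **Theorem.** There is a unique character $\chi=\chi_\gamma^{k,\pm,I}:H_I(k)\to\mathbb{C}$ with $\chi(T_i)=\pm k^{\pm1}$ for $i\in I$ and $\chi(f(Y))=f(\gamma)$ for $f\in\mathbb{C}[T]$. Let $M^{k,\pm,I}(\gamma)=H(k)\otimes_{H_I(k)}\mathbb{C}_\chi$ and $v_w=T_w\otimes1$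 $(w\in S_m^I)$. Then for every left $\mathbb{C}^{k,q}_{\sigma,\nabla}[T]\#_qW$-module $L$ the assignment $$\phi\mapsto\psi_\phi=\sum_{w\in S_m^I}\pi^{k^{-1},q}\bigl(T_{w\overline{w_0}^{-1}}\bigr)\phi\otimes v_w$$ defines a linear bijection $L_\pi^{I^*,\pm}[\overline{w_0}\gamma^{-1}]\to\Gamma_L^{k,q}\bigl(M^{k,\pm,I}(\gamma)\bigr)_\nabla^W$, where $L_\pi^{I^*,\pm}[\overline{w_0}\gamma^{-1}]$ is the space of all $\phi\in L$ with $\pi^{k^{-1},q}(h)\phi=\epsilon_\pm^{k^{-1}}(h)\phi$ for all $h\in H_{0,I^*}(k^{-1})$ and $\pi^{k^{-1},q}(f(Y))\phi=f(\overline{w_0}\gamma^{-1})\phi$ for all $f\in\mathbb{C}[T]$. -/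

import Mathlib

open scoped TensorProduct

namespace AffineKZ

/-! ### The symmetric group `S_m` with `m = n + 1` -/

/-- The simple reflection `s_i`, interchanging the `i`-th and `(i+1)`-st letter. -/
def simpleRefl {n : ℕ} (i : Fin n) : Equiv.Perm (Fin (n + 1)) :=
  Equiv.swap i.castSucc i.succ

/-- The length `l(w) = #(R₀⁺ ∩ w⁻¹ R₀⁻)`; the positive roots `ε_a - ε_b` are the pairs `a < b`. -/
def len {n : ℕ} (w : Equiv.Perm (Fin (n + 1))) : ℕ :=
  (Finset.univ.filter fun p : Fin (n + 1) × Fin (n + 1) => p.1 < p.2 ∧ w p.2 < w p.1).card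

/-- A word in the simple reflections is a reduced expression of `w` if its product is `w` and the
number of its letters is `l(w)`. -/
def IsReducedWord {n : ℕ} (w : Equiv.Perm (Fin (n + 1))) (l : List (Fin n)) : Prop :=
  (l.map simpleRefl).prod = w ∧ l.length = len w

/-- The parabolic subgroup generated by the simple reflections `s_i`, `i ∈ I`. -/
def parabolic {n : ℕ} (I : Set (Fin n)) : Subgroup (Equiv.Perm (Fin (n + 1))) :=
  Subgroup.closure (simpleRefl '' I)

/-- The set of minimal coset representatives `{w | l(w s_i) > l(w) for all i ∈ I}`. -/
def minCosetReps {n : ℕ} (I : Set (Fin n)) : Set (Equiv.Perm (Fin (n + 1))) :=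
  {w | ∀ i ∈ I, len w < len (w * simpleRefl i)}

theorem simpleRefl_mul_self {n : ℕ} (i : Fin n) : simpleRefl i * simpleRefl i = 1 :=
  Equiv.swap_mul_self _ _

theorem simpleRefl_lt_iff {n : ℕ} (i : Fin n) {a b : Fin (n + 1)} (hab : a < b)
    (h : ¬ (a = i.castSucc ∧ b = i.succ)) : simpleRefl i a < simpleRefl i b := by
  unfold simpleRefl
  rw [Equiv.swap_apply_def, Equiv.swap_apply_def]
  simp only [Fin.lt_def, Fin.ext_iff, Fin.val_castSucc, Fin.val_succ] at *
  split_ifs <;> simp_all <;> omega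

/-- Right multiplication by `s_i` at a descent removes exactly one inversion. -/
theorem len_mul_simpleRefl {n : ℕ} (w : Equiv.Perm (Fin (n + 1))) (i : Fin n)
    (h : w i.succ < w i.castSucc) : len (w * simpleRefl i) + 1 = len w := by
  unfold len
  have hmem : ((i.castSucc, i.succ) : Fin (n + 1) × Fin (n + 1)) ∈
      Finset.univ.filter fun p : Fin (n + 1) × Fin (n + 1) => p.1 < p.2 ∧ w p.2 < w p.1 := by
    simp [h]
  rw [← Finset.card_erase_add_one hmem]
  congr 1
  have hs : ∀ a, simpleRefl i (simpleRefl i a) = a := fun a => by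
    rw [← Equiv.Perm.mul_apply, simpleRefl_mul_self]; rfl
  have h1 : simpleRefl i i.castSucc = i.succ := Equiv.swap_apply_left _ _
  have h2 : simpleRefl i i.succ = i.castSucc := Equiv.swap_apply_right _ _
  refine Finset.card_bij' (fun p _ => (simpleRefl i p.1, simpleRefl i p.2))
    (fun p _ => (simpleRefl i p.1, simpleRefl i p.2)) ?_ ?_ ?_ ?_
  · rintro ⟨a, b⟩ hp
    obtain ⟨hp1, hp2⟩ : a < b ∧ w (simpleRefl i b) < w (simpleRefl i a) :=
      (Finset.mem_filter.mp hp).2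
    have hne : ¬ (a = i.castSucc ∧ b = i.succ) := by
      rintro ⟨rfl, rfl⟩
      rw [h1, h2] at hp2
      exact absurd hp2 (not_lt.mpr h.le)
    have hlt := simpleRefl_lt_iff i hp1 hne
    rw [Finset.mem_erase, Finset.mem_filter]
    refine ⟨fun e => ?_, Finset.mem_univ _, hlt, hp2⟩
    obtain ⟨ha, hb⟩ := Prod.mk.inj e
    have ha' : a = i.succ := by rw [← hs a, ha, h1]
    have hb' : b = i.castSucc := by rw [← hs b, hb, h2]
    rw [ha', hb'] at hp1
    exact absurd hp1 (not_lt.mpr (Fin.castSucc_lt_succ).le)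
  · rintro ⟨a, b⟩ hp
    rw [Finset.mem_erase, Finset.mem_filter] at hp
    obtain ⟨hp1, -, hp2, hp3⟩ := hp
    rw [Finset.mem_filter]
    refine ⟨Finset.mem_univ _, simpleRefl_lt_iff i hp2 fun e => hp1 (Prod.ext e.1 e.2), ?_⟩
    rw [Equiv.Perm.mul_apply, Equiv.Perm.mul_apply, hs, hs]
    exact hp3
  · rintro ⟨a, b⟩ _; simp [hs]
  · rintro ⟨a, b⟩ _; simp [hs]

theorem len_mul_simpleRefl' {n : ℕ} (w : Equiv.Perm (Fin (n + 1))) (i : Fin n)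
    (h : w i.castSucc < w i.succ) : len (w * simpleRefl i) = len w + 1 := by
  have := len_mul_simpleRefl (w * simpleRefl i) i (by
    simpa [simpleRefl, Equiv.Perm.mul_apply] using h)
  rw [mul_assoc, simpleRefl_mul_self, mul_one] at this
  exact this.symm

theorem exists_descent {n : ℕ} (w : Equiv.Perm (Fin (n + 1)))
    (h : ∀ i : Fin n, w i.castSucc < w i.succ) : w = 1 := by
  have hm : StrictMono w := Fin.strictMono_iff_lt_succ.mpr h
  have : (hm.orderIsoOfSurjective _ w.surjective) = OrderIso.refl _ := Subsingleton.elim _ _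
  ext a
  have := congrArg (fun e => e a) this
  simpa using congrArg Fin.val this

theorem exists_isReducedWord {n : ℕ} (w : Equiv.Perm (Fin (n + 1))) :
    ∃ l, IsReducedWord w l := by
  induction hk : len w generalizing w with
  | zero =>
    refine ⟨[], ?_, by simp [hk]⟩
    refine (exists_descent w fun i => ?_).symm
    by_contra hlt
    have hne : w i.succ ≠ w i.castSucc := fun e => by simpa [Fin.ext_iff] using w.injective e
    have := len_mul_simpleRefl w i (lt_of_le_of_ne (not_lt.mp hlt) hne)
    omega
  | succ k ih =>
    by_cases hd : ∀ i : Fin n, w i.castSucc < w i.succ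
    · have := exists_descent w hd
      subst this
      exfalso
      have : len (1 : Equiv.Perm (Fin (n + 1))) = 0 := by
        unfold len
        rw [Finset.card_eq_zero, Finset.filter_eq_empty_iff]
        rintro ⟨a, b⟩ _ ⟨h1, h2⟩
        exact absurd h1 (not_lt.mpr h2.le)
      omega
    · push Not at hd
      obtain ⟨i, hi⟩ := hd
      have hne : w i.succ ≠ w i.castSucc := fun e => by simpa [Fin.ext_iff] using w.injective e
      have h1 := len_mul_simpleRefl w i (lt_of_le_of_ne hi hne)
      obtain ⟨l, hl1, hl2⟩ := ih (w * simpleRefl i) (by omega)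
      refine ⟨l ++ [i], ?_, ?_⟩
      · rw [List.map_append, List.prod_append, hl1]
        simp [mul_assoc, simpleRefl_mul_self]
      · simp; omega

theorem exists_minCosetRep {n : ℕ} (I : Set (Fin n)) (w : Equiv.Perm (Fin (n + 1))) :
    ∃ u ∈ minCosetReps I, u⁻¹ * w ∈ parabolic I := by
  classical
  obtain ⟨u, hu, hmin⟩ := Finset.exists_min_image
    (Finset.univ.filter fun u : Equiv.Perm (Fin (n + 1)) => u⁻¹ * w ∈ parabolic I) len
    ⟨w, by simp [one_mem]⟩
  simp only [Finset.mem_filter, Finset.mem_univ, true_and] at hu hmin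
  refine ⟨u, fun i hi => ?_, hu⟩
  have hi' : (u * simpleRefl i)⁻¹ * w ∈ parabolic I := by
    rw [mul_inv_rev, mul_assoc]
    exact mul_mem (inv_mem (Subgroup.subset_closure ⟨i, hi, rfl⟩)) hu
  have hle := hmin _ hi'
  rcases lt_trichotomy (u i.castSucc) (u i.succ) with h | h | h
  · rw [len_mul_simpleRefl' u i h]; exact Nat.lt_succ_self _
  · exact absurd (u.injective h) (Fin.castSucc_lt_succ).ne
  · have := len_mul_simpleRefl u i h; omega

/-- A reduced expression of `w`. -/
noncomputable def reducedWord {n : ℕ} (w : Equiv.Perm (Fin (n + 1))) : List (Fin n) :=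
  (exists_isReducedWord w).choose

/-- The minimal coset representative `w̄` of `w`, i.e. `w = w̄ v` with `w̄` in `minCosetReps I`
and `v` in `parabolic I`. -/
noncomputable def minCosetRep {n : ℕ} (I : Set (Fin n)) (w : Equiv.Perm (Fin (n + 1))) :
    Equiv.Perm (Fin (n + 1)) :=
  (exists_minCosetRep I w).choose

/-- The longest element `w₀` of `S_m`. -/
def longest (n : ℕ) : Equiv.Perm (Fin (n + 1)) := Fin.revPerm

/-- The set `I* = {i* | i ∈ I}` where `w̄₀ (α_i) = α_{i*}`, with `α_i = ε_i - ε_{i+1}`. -/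
def starSet {n : ℕ} (I : Set (Fin n)) : Set (Fin n) :=
  {j | ∃ i ∈ I, minCosetRep I (longest n) i.castSucc = j.castSucc ∧
    minCosetRep I (longest n) i.succ = j.succ}

/-! ### The extended affine Weyl group `W = S_m ⋉ ℤ^m` -/

/-- The action of `S_m` on `ℤ^m` with `w ε_j = ε_{w j}`. -/
def permLattice (n : ℕ) : Equiv.Perm (Fin (n + 1)) →* MulAut (Multiplicative (Fin (n + 1) → ℤ)) where
  toFun w :=
    { toFun := fun v => Multiplicative.ofAdd fun j => Multiplicative.toAdd v (w⁻¹ j)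
      invFun := fun v => Multiplicative.ofAdd fun j => Multiplicative.toAdd v (w j)
      left_inv := fun v => by simp
      right_inv := fun v => by simp
      map_mul' := fun _ _ => rfl }
  map_one' := rfl
  map_mul' _ _ := rfl

/-- The extended affine Weyl group `W = S_m ⋉ ℤ^m`. -/
abbrev ExtWeyl (n : ℕ) : Type :=
  Multiplicative (Fin (n + 1) → ℤ) ⋊[permLattice n] Equiv.Perm (Fin (n + 1))

/-- The translation `τ(v)`, `v ∈ ℤ^m`. -/
def trans {n : ℕ} (v : Fin (n + 1) → ℤ) : ExtWeyl n := SemidirectProduct.inl (Multiplicative.ofAdd v)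

/-- The simple reflection `s_i` as an element of `W`. -/
def wRefl {n : ℕ} (i : Fin n) : ExtWeyl n := SemidirectProduct.inr (simpleRefl i)

/-- The product `σ = s_1 s_2 ⋯ s_{m-1}`. -/
def cyc (n : ℕ) : Equiv.Perm (Fin (n + 1)) := ((List.finRange n).map simpleRefl).prod

theorem cyc_eq (n : ℕ) : cyc n = finRotate (n + 1) := by
  have key : ∀ k ≤ n, ∀ j : Fin (n + 1),
      ((((List.finRange n).take k).map simpleRefl).prod j : ℕ) =
        if (j : ℕ) < k then (j : ℕ) + 1 else if (j : ℕ) = k then 0 else j := by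
    intro k
    induction k with
    | zero => intro _ j; simp
    | succ k ih =>
      intro hk j
      have hl : k < (List.finRange n).length := by simpa using hk
      rw [List.take_succ_eq_append_getElem hl, List.map_append, List.prod_append,
        Equiv.Perm.mul_apply, ih (by omega)]
      have : ((([(List.finRange n)[k]] : List (Fin n)).map simpleRefl).prod j : ℕ) =
          if (j : ℕ) = k then k + 1 else if (j : ℕ) = k + 1 then k else j := by
        simp only [List.map_cons, List.map_nil, List.prod_cons, List.prod_nil, mul_one, simpleRefl,
          List.getElem_finRange, Equiv.swap_apply_def, Fin.ext_iff]
        split_ifs <;> simp_all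
      rw [this]
      split_ifs <;> omega
  ext j
  have := key n le_rfl j
  rw [List.take_of_length_le (by simp)] at this
  rw [cyc, this]
  rcases eq_or_ne j (Fin.last n) with rfl | hj
  · simp
  · have : (j : ℕ) < n := by
      have := j.2
      have : (j : ℕ) ≠ n := fun e => hj (Fin.ext e)
      omega
    rw [if_pos this, coe_finRotate_of_ne_last hj]

/-- The element `ζ = σ τ(ε_m)` of `W`. -/
def zeta (n : ℕ) : ExtWeyl n :=
  SemidirectProduct.inr (cyc n) * trans (Pi.single (Fin.last n) 1)

/-! ### Homomorphisms out of `S_m` and `W` -/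

section Lift

variable {P : Type*} [Group P]

/-- The relations of the simple reflections `s_0, …, s_{n-1}`. -/
structure SymRel (g : ℕ → P) (n : ℕ) : Prop where
  sq : ∀ i, i < n → g i * g i = 1
  braid : ∀ i, i + 1 < n → g i * g (i + 1) * g i = g (i + 1) * g i * g (i + 1)
  comm : ∀ i j, i + 1 < j → j < n → g i * g j = g j * g i

theorem SymRel.mono {g : ℕ → P} {n k : ℕ} (h : SymRel g n) (hk : k ≤ n) : SymRel g k :=
  ⟨fun i hi => h.sq i (by omega), fun i hi => h.braid i (by omega),
    fun i j hi hj => h.comm i j hi (by omega)⟩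

/-- The product `g_{n+1-k} ⋯ g_n`. -/
def tailProd (g : ℕ → P) (n : ℕ) : ℕ → P
  | 0 => 1
  | k + 1 => g (n - k) * tailProd g n k

theorem tailProd_comm {g : ℕ → P} {n : ℕ} (h : SymRel g (n + 1)) (k i : ℕ)
    (hi : i + 1 + k < n + 1) : g i * tailProd g n k = tailProd g n k * g i := by
  induction k with
  | zero => simp [tailProd]
  | succ k ih =>
    rw [tailProd, ← mul_assoc, h.comm i (n - k) (by omega) (by omega), mul_assoc, ih (by omega),
      mul_assoc]

theorem tailProd_shift {g : ℕ → P} {n : ℕ} (h : SymRel g (n + 1)) (k i : ℕ) (hk : k ≤ n + 1)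
    (hi : n + 1 < i + k) (hin : i < n + 1) :
    g i * tailProd g n k = tailProd g n k * g (i - 1) := by
  induction k with
  | zero => omega
  | succ k ih =>
    by_cases hlt : n + 1 < i + k
    · rw [tailProd, ← mul_assoc, ← h.comm (n - k) i (by omega) hin, mul_assoc,
        ih (by omega) hlt, mul_assoc]
    · obtain ⟨k, rfl⟩ : ∃ l, k = l + 1 := ⟨k - 1, by omega⟩
      obtain ⟨j, rfl⟩ : ∃ j, i = j + 1 := ⟨i - 1, by omega⟩
      have h1 : n - (k + 1) = j := by omega
      have h2 : n - k = j + 1 := by omega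
      rw [tailProd, tailProd, h1, h2, Nat.add_sub_cancel]
      calc g (j + 1) * (g j * (g (j + 1) * tailProd g n k))
          = g (j + 1) * g j * g (j + 1) * tailProd g n k := by simp only [mul_assoc]
        _ = g j * (g (j + 1) * (g j * tailProd g n k)) := by
            rw [← h.braid j (by omega)]; simp only [mul_assoc]
        _ = g j * (g (j + 1) * tailProd g n k) * g j := by
            rw [tailProd_comm h k j (by omega)]; simp only [mul_assoc]

theorem exists_tailProd {g : ℕ → P} {n : ℕ} (h : SymRel g (n + 1)) (x : P)
    (hx : x ∈ Subgroup.closure (g '' {i | i < n + 1})) :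
    ∃ k ≤ n + 1, ∃ y ∈ Subgroup.closure (g '' {i | i < n}), x = tailProd g n k * y := by
  have key : ∀ i < n + 1, ∀ x, (∃ k ≤ n + 1, ∃ y ∈ Subgroup.closure (g '' {i | i < n}),
      x = tailProd g n k * y) → ∃ k ≤ n + 1, ∃ y ∈ Subgroup.closure (g '' {i | i < n}),
      g i * x = tailProd g n k * y := by
    rintro i hi _ ⟨k, hk, y, hy, rfl⟩
    rcases lt_trichotomy (i + k) n with h1 | h1 | h1
    · exact ⟨k, hk, g i * y, mul_mem (Subgroup.subset_closure ⟨i, by simp; omega, rfl⟩) hy, by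
        rw [← mul_assoc, tailProd_comm h k i (by omega), mul_assoc]⟩
    · exact ⟨k + 1, by omega, y, hy, by
        rw [tailProd, show n - k = i by omega, mul_assoc]⟩
    · rcases Nat.lt_or_ge (n + 1) (i + k) with h2 | h2
      · exact ⟨k, hk, g (i - 1) * y,
          mul_mem (Subgroup.subset_closure ⟨i - 1, by simp; omega, rfl⟩) hy, by
          rw [← mul_assoc, tailProd_shift h k i hk h2 hi, mul_assoc]⟩
      · obtain ⟨k, rfl⟩ : ∃ l, k = l + 1 := ⟨k - 1, by omega⟩
        exact ⟨k, by omega, y, hy, by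
          rw [tailProd, show n - k = i by omega, ← mul_assoc, ← mul_assoc, h.sq i hi, one_mul]⟩
  induction hx using Subgroup.closure_induction_left with
  | one => exact ⟨0, by omega, 1, one_mem _, by simp [tailProd]⟩
  | mul_left x hx y hy ih =>
    obtain ⟨i, hi, rfl⟩ := hx
    exact key i hi _ ih
  | inv_mul_cancel x hx y hy ih =>
    obtain ⟨i, hi, rfl⟩ := hx
    rw [inv_eq_of_mul_eq_one_left (h.sq i hi)]
    exact key i hi _ ih

theorem stab_last {g : ℕ → P} {n : ℕ} (h : SymRel g (n + 1)) (p : P →* Equiv.Perm ℕ)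
    (hp : ∀ i < n + 1, p (g i) = Equiv.swap i (i + 1)) (x : P)
    (hx : x ∈ Subgroup.closure (g '' {i | i < n + 1})) (hfix : p x (n + 1) = n + 1) :
    x ∈ Subgroup.closure (g '' {i | i < n}) := by
  obtain ⟨k, hk, y, hy, rfl⟩ := exists_tailProd h x hx
  have hyfix : p y (n + 1) = n + 1 := by
    have : y ∈ (MulAction.stabilizer (Equiv.Perm ℕ) (n + 1)).comap p := by
      refine (Subgroup.closure_le _).mpr ?_ hy
      rintro _ ⟨i, hi, rfl⟩
      have hi' : i < n := hi
      simp only [Subgroup.coe_comap, Set.mem_preimage, SetLike.mem_coe,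
        MulAction.mem_stabilizer_iff, Equiv.Perm.smul_def]
      rw [hp i (by omega)]
      exact Equiv.swap_apply_of_ne_of_ne (by omega) (by omega)
    exact this
  have htail : ∀ k ≤ n + 1, p (tailProd g n k) (n + 1) = n + 1 - k := by
    intro k
    induction k with
    | zero => simp [tailProd]
    | succ k ih =>
      intro hk
      rw [tailProd, map_mul, Equiv.Perm.mul_apply, ih (by omega), hp _ (by omega)]
      rw [show n + 1 - k = n - k + 1 by omega, Equiv.swap_apply_right]
      omega
  rw [map_mul, Equiv.Perm.mul_apply, hyfix, htail k hk] at hfix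
  have : k = 0 := by omega
  subst this
  simpa [tailProd] using hy

theorem eq_one_of_map_eq_one {g : ℕ → P} {n : ℕ} (h : SymRel g n) (p : P →* Equiv.Perm ℕ)
    (hp : ∀ i < n, p (g i) = Equiv.swap i (i + 1)) (x : P)
    (hx : x ∈ Subgroup.closure (g '' {i | i < n})) (h1 : p x = 1) : x = 1 := by
  induction n with
  | zero => simpa using hx
  | succ n ih =>
    exact ih (h.mono (Nat.le_succ n)) (fun i hi => hp i (by omega))
      (stab_last h p hp x hx (by rw [h1]; rfl))

/-- Permutations of `{0, …, n}`, viewed as permutations of `ℕ`. -/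
def permNat (n : ℕ) : Equiv.Perm (Fin (n + 1)) →* Equiv.Perm ℕ :=
  Equiv.Perm.extendDomainHom Fin.equivSubtype

theorem permNat_simpleRefl {n : ℕ} (i : Fin n) :
    permNat n (simpleRefl i) = Equiv.swap (i : ℕ) (i + 1) := by
  ext a
  change Equiv.Perm.extendDomain _ _ a = _
  by_cases ha : a < n + 1
  · rw [Equiv.Perm.extendDomain_apply_subtype (p := fun k => k < n + 1) (b := a) _ _ ha]
    simp only [simpleRefl, Equiv.swap_apply_def, Fin.ext_iff, Fin.equivSubtype]
    simp
    split_ifs <;> simp_all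
  · rw [Equiv.Perm.extendDomain_apply_not_subtype (p := fun k => k < n + 1) (b := a) _ _ ha, Equiv.swap_apply_of_ne_of_ne] <;> omega

theorem permNat_last {n : ℕ} (w : Equiv.Perm (Fin (n + 2))) (hw : w (Fin.last _) = Fin.last _) :
    permNat (n + 1) w (n + 1) = n + 1 := by
  change Equiv.Perm.extendDomain _ _ (n + 1) = _
  rw [Equiv.Perm.extendDomain_apply_subtype _ _ (by omega)]
  have : (Fin.equivSubtype.symm ⟨n + 1, by omega⟩ : Fin (n + 2)) = Fin.last _ := rfl
  rw [this, hw]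
  rfl

theorem mem_closure_simpleRefl {n : ℕ} (w : Equiv.Perm (Fin (n + 1))) :
    w ∈ Subgroup.closure (Set.range (simpleRefl (n := n))) := by
  obtain ⟨l, hl, -⟩ := exists_isReducedWord w
  rw [← hl]
  refine list_prod_mem ?_
  intro x hx
  obtain ⟨i, -, rfl⟩ := List.mem_map.mp hx
  exact Subgroup.subset_closure ⟨i, rfl⟩

theorem val_simpleRefl {n : ℕ} (i : Fin n) (a : Fin (n + 1)) :
    (simpleRefl i a : ℕ) =
      if (a : ℕ) = i then (i : ℕ) + 1 else if (a : ℕ) = i + 1 then (i : ℕ) else a := by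
  simp only [simpleRefl, Equiv.swap_apply_def, Fin.ext_iff, Fin.val_castSucc, Fin.val_succ]
  split_ifs <;> simp

theorem symRel_simpleRefl (n : ℕ) :
    SymRel (fun i => if h : i < n then simpleRefl (⟨i, h⟩ : Fin n) else 1) n where
  sq i hi := by simp [hi, simpleRefl_mul_self]
  braid i hi := by
    have hi' : i < n := by omega
    simp only [hi, hi', dif_pos]
    ext a
    simp only [Equiv.Perm.mul_apply, val_simpleRefl]
    split_ifs <;> omega
  comm i j hi hj := by
    have hi' : i < n := by omega
    simp only [hj, hi', dif_pos]
    ext a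
    simp only [Equiv.Perm.mul_apply, val_simpleRefl]
    split_ifs <;> omega

/-- The stabilizer of the last letter is generated by all simple reflections but the last. -/
theorem stabilizer_last {n : ℕ} (w : Equiv.Perm (Fin (n + 2))) (hw : w (Fin.last _) = Fin.last _) :
    w ∈ Subgroup.closure (Set.range fun i : Fin n => simpleRefl i.castSucc) := by
  have := stab_last (symRel_simpleRefl (n + 1)) (permNat (n + 1))
    (fun i hi => by simp only [hi, dif_pos]; exact permNat_simpleRefl _) w ?_ (permNat_last w hw)
  · refine Subgroup.closure_mono ?_ this
    rintro _ ⟨i, hi, rfl⟩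
    have hi' : i < n := hi
    have hi'' : i < n + 1 := by omega
    exact ⟨⟨i, hi'⟩, by simp [hi'']⟩
  · refine Subgroup.closure_mono ?_ (mem_closure_simpleRefl w)
    rintro _ ⟨i, rfl⟩
    exact ⟨i, i.2, dif_pos i.2⟩

variable {G : Type*} [Group G]

/-- The Coxeter presentation of the symmetric group. -/
theorem exists_symLift {n : ℕ} (g : Fin n → G) (hsq : ∀ i, g i * g i = 1)
    (hbr : ∀ i j : Fin n, (i : ℕ) + 1 = j → g i * g j * g i = g j * g i * g j)
    (hcomm : ∀ i j : Fin n, (i : ℕ) + 1 < j → g i * g j = g j * g i) :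
    ∃ F : Equiv.Perm (Fin (n + 1)) →* G, ∀ i, F (simpleRefl i) = g i := by
  let γ : ℕ → Equiv.Perm (Fin (n + 1)) × G := fun i =>
    (if h : i < n then simpleRefl (⟨i, h⟩ : Fin n) else 1, if h : i < n then g ⟨i, h⟩ else 1)
  have S := symRel_simpleRefl n
  have hγ : SymRel γ n :=
    ⟨fun i hi => Prod.ext (S.sq i hi) (by simp [γ, hi, hsq]),
     fun i hi => Prod.ext (S.braid i hi) (by
      have hi' : i < n := by omega
      simp only [γ, Prod.snd_mul, hi, hi', dif_pos]; exact hbr _ _ rfl),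
     fun i j hi hj => Prod.ext (S.comm i j hi hj) (by
      have hi' : i < n := by omega
      simp only [γ, Prod.snd_mul, hj, hi', dif_pos]; exact hcomm _ _ hi)⟩
  set Γ := Subgroup.closure (γ '' {i | i < n}) with hΓ
  have huniq : ∀ w x y, (w, x) ∈ Γ → (w, y) ∈ Γ → x = y := by
    intro w x y hx hy
    have hmem := mul_mem (inv_mem hx) hy
    have := eq_one_of_map_eq_one hγ ((permNat n).comp (MonoidHom.fst _ _))
      (fun i hi => by simp [γ, hi]; exact permNat_simpleRefl _) _ hmem (by simp)
    have := congrArg Prod.snd this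
    simpa [inv_mul_eq_one] using this
  have hgen : ∀ i : Fin n, (simpleRefl i, g i) ∈ Γ := fun i =>
    Subgroup.subset_closure ⟨i, i.2, by simp [γ]⟩
  have hex : ∀ w, ∃ x, (w, x) ∈ Γ := by
    intro w
    have := mem_closure_simpleRefl w
    have h2 : Subgroup.closure (Set.range (simpleRefl (n := n))) ≤
        Γ.map (MonoidHom.fst _ _) := by
      rw [Subgroup.closure_le]
      rintro _ ⟨i, rfl⟩
      exact ⟨_, hgen i, rfl⟩
    obtain ⟨⟨_, x⟩, hx, rfl⟩ := h2 this
    exact ⟨x, hx⟩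
  choose F hF using hex
  exact ⟨{ toFun := F
           map_one' := huniq 1 _ _ (hF 1) (one_mem Γ)
           map_mul' := fun v w => huniq _ _ _ (hF (v * w)) (mul_mem (hF v) (hF w)) },
    fun i => huniq _ _ _ (hF _) (hgen i)⟩

end Lift

section LiftW

variable {G : Type*} [Group G]

theorem latticeHom_ext {n : ℕ} {f g : Multiplicative (Fin (n + 1) → ℤ) →* G}
    (h : ∀ j, f (Multiplicative.ofAdd (Pi.single j 1)) = g (Multiplicative.ofAdd (Pi.single j 1))) :
    f = g := by
  have : f.comp (MulEquiv.funMultiplicative (Fin (n + 1)) ℤ).symm.toMonoidHom =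
      g.comp (MulEquiv.funMultiplicative (Fin (n + 1)) ℤ).symm.toMonoidHom := by
    refine MonoidHom.pi_ext fun j x => ?_
    have hx : (MulEquiv.funMultiplicative (Fin (n + 1)) ℤ).symm (Pi.mulSingle j x) =
        (Multiplicative.ofAdd (Pi.single j (1 : ℤ)) : Multiplicative (Fin (n + 1) → ℤ)) ^
          (Multiplicative.toAdd x) := by
      apply Multiplicative.toAdd.injective
      funext l
      change Multiplicative.toAdd ((Pi.mulSingle j x : Fin (n + 1) → Multiplicative ℤ) l) =
        Multiplicative.toAdd x • (Pi.single j (1 : ℤ) : Fin (n + 1) → ℤ) l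
      by_cases hl : l = j
      · subst hl; simp
      · simp [hl]
    change f ((MulEquiv.funMultiplicative (Fin (n + 1)) ℤ).symm (Pi.mulSingle j x)) =
      g ((MulEquiv.funMultiplicative (Fin (n + 1)) ℤ).symm (Pi.mulSingle j x))
    rw [hx, map_zpow, map_zpow, h]
  refine MonoidHom.ext fun v => ?_
  exact DFunLike.congr_fun this (MulEquiv.funMultiplicative (Fin (n + 1)) ℤ v)

theorem exists_latticeHom {n : ℕ} (Y : Fin (n + 1) → G) (h : ∀ i j, i ≠ j → Commute (Y i) (Y j)) :
    ∃ f : Multiplicative (Fin (n + 1) → ℤ) →* G,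
      ∀ j, f (Multiplicative.ofAdd (Pi.single j 1)) = Y j := by
  refine ⟨(MonoidHom.noncommPiCoprod (fun j => zpowersHom G (Y j)) fun i j hij x y => by
    simpa using (h i j hij).zpow_zpow _ _).comp
      (MulEquiv.funMultiplicative (Fin (n + 1)) ℤ).toMonoidHom, fun j => ?_⟩
  have : (MulEquiv.funMultiplicative (Fin (n + 1)) ℤ)
      (Multiplicative.ofAdd (Pi.single j (1 : ℤ))) =
      Pi.mulSingle j (Multiplicative.ofAdd (1 : ℤ)) := by
    funext l
    by_cases hl : l = j
    · subst hl; simp [MulEquiv.funMultiplicative, MulEquiv.piMultiplicative]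
    · simp [MulEquiv.funMultiplicative, MulEquiv.piMultiplicative, hl]
  rw [MonoidHom.comp_apply]
  erw [this, MonoidHom.noncommPiCoprod_mulSingle]
  simp

theorem conj_simpleRefl {n : ℕ} (u : Equiv.Perm (Fin (n + 1))) (i j : Fin n)
    (h1 : u i.castSucc = j.castSucc) (h2 : u i.succ = j.succ) :
    u * simpleRefl i = simpleRefl j * u := by
  have := Equiv.swap_apply_apply u i.castSucc i.succ
  rw [h1, h2] at this
  rw [simpleRefl, simpleRefl, this]
  simp

theorem cyc_castSucc {n : ℕ} (i : Fin n) : cyc n i.castSucc = i.succ := by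
  rw [cyc_eq, finRotate_apply, Fin.ext_iff]
  simp

theorem cyc_last (n : ℕ) : cyc n (Fin.last n) = 0 := by
  rw [cyc_eq]; simp

theorem cyc_simpleRefl {n : ℕ} (i j : Fin n) (h : (i : ℕ) + 1 = j) :
    cyc n * simpleRefl i = simpleRefl j * cyc n := by
  have : i.succ = j.castSucc := Fin.ext h
  exact conj_simpleRefl _ _ _ (by rw [cyc_castSucc, this]) (by rw [this, cyc_castSucc])

theorem exists_wLift {n : ℕ} (g : Fin n → G) (z : G) (hsq : ∀ i, g i * g i = 1)
    (hbr : ∀ i j : Fin n, (i : ℕ) + 1 = j → g i * g j * g i = g j * g i * g j)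
    (hcomm : ∀ i j : Fin n, (i : ℕ) + 1 < j → g i * g j = g j * g i)
    (hz : ∀ i j : Fin n, (i : ℕ) + 1 = j → z * g i = g j * z)
    (hzn : ∀ i, z ^ (n + 1) * g i = g i * z ^ (n + 1)) :
    ∃ F : ExtWeyl n →* G, (∀ i, F (wRefl i) = g i) ∧ F (zeta n) = z := by
  obtain ⟨ρ, hρ⟩ := exists_symLift g hsq hbr hcomm
  set y : G := (ρ (cyc n))⁻¹ * z with hy
  have hzy : z = ρ (cyc n) * y := by rw [hy]; group
  -- `y` commutes with the stabilizer of the last letter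
  have hstab : ∀ w : Equiv.Perm (Fin (n + 1)), w (Fin.last n) = Fin.last n →
      Commute (ρ w) y := by
    intro w hw
    rcases n with _ | n
    · have : Subsingleton (Fin (0 + 1)) := inferInstanceAs (Subsingleton (Fin 1))
      rw [show w = 1 from Equiv.ext fun _ => Subsingleton.elim _ _, map_one]; exact Commute.one_left _
    · have : w ∈ (Subgroup.centralizer {y}).comap ρ := by
        refine (Subgroup.closure_le _).mpr ?_ (stabilizer_last w hw)
        rintro _ ⟨i, rfl⟩
        simp only [Subgroup.coe_comap, Set.mem_preimage, SetLike.mem_coe,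
          Subgroup.mem_centralizer_singleton_iff, hρ]
        have h1 : g i.succ = ρ (cyc (n + 1)) * g i.castSucc * (ρ (cyc (n + 1)))⁻¹ := by
          rw [← hρ, ← hρ, ← map_mul, cyc_simpleRefl i.castSucc i.succ (by simp), map_mul]; group
        have h2 := hz i.castSucc i.succ (by simp)
        rw [h1] at h2
        rw [hy]
        calc g i.castSucc * ((ρ (cyc (n + 1)))⁻¹ * z)
            = (ρ (cyc (n + 1)))⁻¹ *
              (ρ (cyc (n + 1)) * g i.castSucc * (ρ (cyc (n + 1)))⁻¹ * z) := by group
          _ = (ρ (cyc (n + 1)))⁻¹ * z * g i.castSucc := by rw [← h2]; group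
      exact Subgroup.mem_centralizer_singleton_iff.mp this
  have hconj : ∀ v w : Equiv.Perm (Fin (n + 1)), v (Fin.last n) = w (Fin.last n) →
      ρ v * y * (ρ v)⁻¹ = ρ w * y * (ρ w)⁻¹ := by
    intro v w hvw
    have := hstab (w⁻¹ * v) (by simp [Equiv.Perm.mul_apply, hvw])
    rw [map_mul, map_inv] at this
    calc ρ v * y * (ρ v)⁻¹ = ρ w * (((ρ w)⁻¹ * ρ v) * y) * (ρ v)⁻¹ := by group
      _ = ρ w * y * (ρ w)⁻¹ := by rw [this.eq]; group
  set Y : Fin (n + 1) → G := fun j =>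
    ρ (Equiv.swap j (Fin.last n)) * y * (ρ (Equiv.swap j (Fin.last n)))⁻¹ with hY
  have hYw : ∀ w : Equiv.Perm (Fin (n + 1)), Y (w (Fin.last n)) = ρ w * y * (ρ w)⁻¹ :=
    fun w => hconj _ _ (by simp)
  -- the two basic elements commute
  have hcommY : ∀ i j, i ≠ j → Commute (Y i) (Y j) := by
    intro i j hij
    rcases n with _ | n
    · have : Subsingleton (Fin (0 + 1)) := inferInstanceAs (Subsingleton (Fin 1))
      exact absurd (Subsingleton.elim i j) hij
    · set a : Fin (n + 2) := (Fin.last n).castSucc with ha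
      set s : Equiv.Perm (Fin (n + 2)) := simpleRefl (Fin.last n) with hs
      have hsa : s (Fin.last (n + 1)) = a := Equiv.swap_apply_right _ _
      have hss : ρ s * ρ s = 1 := by rw [← map_mul, hs, simpleRefl_mul_self, map_one]
      have hsinv : (ρ s)⁻¹ = ρ s := inv_eq_of_mul_eq_one_left hss
      have hlast : Fin.last (n + 1) ≠ a := (Fin.castSucc_lt_last _).ne'
      -- `s y s` commutes with `y`
      have hbasic : Commute y (ρ s * y * ρ s) := by
        have hz2 : z * z * ρ s = g 0 * (z * z) := by
          have hk : ∀ k : ℕ, ∀ hk : k < n + 1, z ^ k * g 0 = g ⟨k, hk⟩ * z ^ k := by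
            intro k
            induction k with
            | zero => intro _; simp
            | succ k ih =>
              intro hk
              rw [pow_succ', mul_assoc, ih (by omega), ← mul_assoc,
                hz ⟨k, by omega⟩ ⟨k + 1, hk⟩ rfl, mul_assoc]
          have h1 := hk n (by omega)
          have h2 := hzn 0
          have h3 : g ⟨n, by omega⟩ = ρ s := (hρ _).symm
          rw [h3] at h1
          have h4 : z ^ (n + 1 + 1) = z * z * z ^ n := by rw [pow_succ', pow_succ', mul_assoc]
          rw [h4] at h2
          have h5 : z * z * ρ s * z ^ n = g 0 * (z * z) * z ^ n := by
            rw [mul_assoc (z * z), ← h1, ← mul_assoc, h2]; simp only [mul_assoc]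
          exact mul_right_cancel h5
        have hS : ∀ w : Equiv.Perm (Fin (n + 2)), w (Fin.last _) = Fin.last _ →
            z * ρ w = ρ (cyc _ * w * (cyc _)⁻¹) * z := by
          intro w hw
          rw [hzy, mul_assoc, ← (hstab w hw).eq]
          simp only [map_mul, map_inv]
          group
        have hfix' : (s * (cyc (n + 1))⁻¹) (Fin.last (n + 1)) = Fin.last (n + 1) := by
          have h6 : (cyc (n + 1)) a = Fin.last (n + 1) := by rw [ha, cyc_castSucc]; rfl
          have h7 : (cyc (n + 1))⁻¹ (Fin.last (n + 1)) = a := by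
            rw [← h6]; exact (cyc (n + 1)).symm_apply_apply a
          rw [Equiv.Perm.mul_apply, h7]
          exact Equiv.swap_apply_left _ _
        have hsq' : ρ s * y * (ρ s * y) = ρ (cyc (n + 1) * cyc (n + 1))⁻¹ * (z * z) := by
          have e1 : ρ s * y = ρ (s * (cyc (n + 1))⁻¹) * z := by
            rw [hy, map_mul, map_inv]; group
          have e2 : s * s = 1 := simpleRefl_mul_self _
          have e3 : s * (cyc (n + 1))⁻¹ * (cyc (n + 1) * (s * (cyc (n + 1))⁻¹) *
              (cyc (n + 1))⁻¹) = (cyc (n + 1) * cyc (n + 1))⁻¹ := by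
            calc _ = s * s * ((cyc (n + 1))⁻¹ * (cyc (n + 1))⁻¹) := by group
              _ = _ := by rw [e2]; group
          rw [e1]
          calc _ = ρ (s * (cyc (n + 1))⁻¹) * (z * ρ (s * (cyc (n + 1))⁻¹)) * z := by group
            _ = _ := by
              rw [hS _ hfix', ← mul_assoc, ← map_mul, e3, map_inv]; group
        have hcs : cyc (n + 1) * cyc (n + 1) * s = simpleRefl 0 * (cyc (n + 1) * cyc (n + 1)) := by
          have h6 : (cyc (n + 1)) a = Fin.last (n + 1) := by rw [ha, cyc_castSucc]; rfl
          refine conj_simpleRefl _ _ _ ?_ ?_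
          · rw [Equiv.Perm.mul_apply, h6, cyc_last]; rfl
          · rw [Equiv.Perm.mul_apply]
            have : (Fin.last n).succ = Fin.last (n + 1) := rfl
            rw [this, cyc_last]
            exact cyc_castSucc (0 : Fin (n + 1))
        have hcs' : ρ (cyc (n + 1) * cyc (n + 1))⁻¹ * g 0 =
            ρ s * ρ (cyc (n + 1) * cyc (n + 1))⁻¹ := by
          rw [← hρ, ← map_mul, ← map_mul]
          congr 1
          rw [inv_mul_eq_iff_eq_mul, ← mul_assoc, hcs]
          group
        have hcom : Commute (ρ s) (ρ s * y * (ρ s * y)) := by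
          rw [hsq']
          change _ * _ = _ * _
          rw [mul_assoc, hz2, ← mul_assoc, ← hcs', mul_assoc]
        change y * (ρ s * y * ρ s) = ρ s * y * ρ s * y
        have := hcom.eq
        calc y * (ρ s * y * ρ s) = (ρ s * ρ s) * (y * (ρ s * y) * ρ s) := by
              rw [hss]; group
          _ = ρ s * (ρ s * y * (ρ s * y) * ρ s) := by group
          _ = (ρ s * ρ s) * (ρ s * y * (ρ s * y)) := by rw [← this]; group
          _ = _ := by rw [hss]; group
      set b : Fin (n + 2) := Equiv.swap i (Fin.last _) a with hb
      have hbi : i ≠ b := by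
        intro e
        have : Equiv.swap i (Fin.last (n + 1)) (Fin.last (n + 1)) =
            Equiv.swap i (Fin.last (n + 1)) a := by
          rw [← hb, ← e]; simp
        exact hlast ((Equiv.swap i (Fin.last (n + 1))).injective this)
      set w : Equiv.Perm (Fin (n + 2)) := Equiv.swap j b * Equiv.swap i (Fin.last _) with hw
      have hw1 : w (Fin.last _) = i := by
        simp only [hw, Equiv.Perm.mul_apply, Equiv.swap_apply_right]
        exact Equiv.swap_apply_of_ne_of_ne hij hbi
      have hw2 : (w * s) (Fin.last _) = j := by
        rw [Equiv.Perm.mul_apply, hsa]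
        simp only [hw, Equiv.Perm.mul_apply, ← hb, Equiv.swap_apply_right]
      have hYi := hYw w
      have hYj := hYw (w * s)
      rw [hw1] at hYi
      rw [hw2] at hYj
      have hYj' : Y j = ρ w * (ρ s * y * ρ s) * (ρ w)⁻¹ := by
        rw [hYj, map_mul, mul_inv_rev, hsinv]; group
      rw [hYi, hYj']
      change _ * _ = _ * _
      have := hbasic.eq
      calc _ = ρ w * (y * (ρ s * y * ρ s)) * (ρ w)⁻¹ := by group
        _ = _ := by rw [this]; group
  obtain ⟨f, hf⟩ := exists_latticeHom Y hcommY
  have hcompat : ∀ u, f.comp (permLattice n u).toMonoidHom =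
      (MulAut.conj (ρ u)).toMonoidHom.comp f := by
    intro u
    refine latticeHom_ext fun j => ?_
    have h1 : permLattice n u (Multiplicative.ofAdd (Pi.single j 1)) =
        Multiplicative.ofAdd (Pi.single (u j) 1) := by
      apply Multiplicative.toAdd.injective
      funext l
      change (Pi.single j (1 : ℤ) : Fin (n + 1) → ℤ) (u⁻¹ l) =
        (Pi.single (u j) (1 : ℤ) : Fin (n + 1) → ℤ) l
      by_cases hl : l = u j
      · subst hl; simp
      · rw [Pi.single_eq_of_ne hl, Pi.single_eq_of_ne]
        intro e
        exact hl (by rw [← e]; simp)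
    simp only [MonoidHom.comp_apply, MulEquiv.coe_toMonoidHom, h1, hf, MulAut.conj_apply]
    have h2 := hYw (Equiv.swap j (Fin.last n))
    have h3 := hYw (u * Equiv.swap j (Fin.last n))
    simp only [Equiv.Perm.mul_apply, Equiv.swap_apply_right] at h2 h3
    rw [h2, h3, map_mul]
    group
  refine ⟨SemidirectProduct.lift f ρ hcompat, fun i => ?_, ?_⟩
  · rw [wRefl, SemidirectProduct.lift_inr, hρ]
  · rw [zeta, trans, map_mul, SemidirectProduct.lift_inr, SemidirectProduct.lift_inl, hf, hzy]
    have := hYw 1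
    simp only [Equiv.Perm.coe_one, id_eq, map_one] at this
    rw [this]
    group

end LiftW

/-! ### Rational functions on the torus `T = (ℂ^×)^m` and the algebra of `q`-difference reflection
operators -/

/-- The algebra `ℂ[T]` of Laurent polynomials in `t_1, …, t_m`; the monomial `t^μ` is `e^μ`. -/
abbrev Laurent (n : ℕ) : Type := AddMonoidAlgebra ℂ (Fin (n + 1) → ℤ)

/-- The field `ℂ(T)`. -/
abbrev RatFun (n : ℕ) : Type := FractionRing (Laurent n)

/-- The algebra endomorphism `w_q` of `ℂ[T]`: for `w = τ(v) σ` it maps `e^μ` to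
`q^{-⟨v, σ μ⟩} e^{σ μ}`. -/
noncomputable def actLaurent {n : ℕ} (q : ℂˣ) (w : ExtWeyl n) : Laurent n →ₐ[ℂ] Laurent n :=
  AddMonoidAlgebra.lift ℂ (Laurent n) (Fin (n + 1) → ℤ)
    { toFun := fun μ => AddMonoidAlgebra.single
        (fun j => Multiplicative.toAdd μ (w.right⁻¹ j))
        ((q ^ (-∑ j, Multiplicative.toAdd w.left j * Multiplicative.toAdd μ (w.right⁻¹ j)) : ℂˣ) : ℂ)
      map_one' := by
        rw [AddMonoidAlgebra.one_def]
        simp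
        rfl
      map_mul' := fun μ ν => by
        rw [AddMonoidAlgebra.single_mul_single]
        congr 1
        rw [← Units.val_mul, ← zpow_add]
        simp only [toAdd_mul, Pi.add_apply, mul_add, Finset.sum_add_distrib, neg_add] }

theorem actLaurent_single {n : ℕ} (q : ℂˣ) (w : ExtWeyl n) (μ : Fin (n + 1) → ℤ) (c : ℂ) :
    actLaurent q w (AddMonoidAlgebra.single μ c) = AddMonoidAlgebra.single
      (fun j => μ (w.right⁻¹ j)) (c * ((q ^ (-∑ j, Multiplicative.toAdd w.left j * μ (w.right⁻¹ j)) : ℂˣ) : ℂ)) := by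
  rw [actLaurent, AddMonoidAlgebra.lift_single]
  change c • AddMonoidAlgebra.single _ _ = _
  rw [AddMonoidAlgebra.smul_single]
  rfl

theorem actLaurent_one {n : ℕ} (q : ℂˣ) : actLaurent q (1 : ExtWeyl n) = AlgHom.id ℂ _ := by
  refine AddMonoidAlgebra.algHom_ext (fun μ => ?_) (by ext)
  rw [actLaurent_single]
  simp

theorem actLaurent_mul {n : ℕ} (q : ℂˣ) (v w : ExtWeyl n) :
    actLaurent q (v * w) = (actLaurent q v).comp (actLaurent q w) := by
  refine AddMonoidAlgebra.algHom_ext (fun μ => ?_) (by ext)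
  rw [AlgHom.comp_apply, actLaurent_single, actLaurent_single, actLaurent_single]
  congr 1
  rw [one_mul, one_mul, ← Units.val_mul, ← zpow_add, ← neg_add, SemidirectProduct.mul_left,
    SemidirectProduct.mul_right]
  congr 3
  have h : ∑ j, Multiplicative.toAdd w.left j * μ (w.right⁻¹ j) =
      ∑ j, Multiplicative.toAdd w.left (v.right⁻¹ j) * μ (w.right⁻¹ (v.right⁻¹ j)) :=
    (Equiv.sum_comp v.right⁻¹ fun j => Multiplicative.toAdd w.left j * μ (w.right⁻¹ j)).symm
  rw [h]
  refine Eq.trans ?_ (add_comm _ _)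
  rw [← Finset.sum_add_distrib]
  refine Finset.sum_congr rfl fun j _ => ?_
  rw [toAdd_mul, Pi.add_apply, add_mul, mul_inv_rev]
  rfl

/-- The action of `W` on `ℂ[T]` by algebra automorphisms. -/
noncomputable def autLaurent {n : ℕ} (q : ℂˣ) : ExtWeyl n →* (Laurent n ≃ₐ[ℂ] Laurent n) :=
  (AlgEquiv.algHomUnitsEquiv ℂ (Laurent n)).toMonoidHom.comp (MonoidHom.toHomUnits
    { toFun := actLaurent q
      map_one' := actLaurent_one q
      map_mul' := actLaurent_mul q })

theorem autLaurent_apply {n : ℕ} (q : ℂˣ) (w : ExtWeyl n) (f : Laurent n) :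
    autLaurent q w f = actLaurent q w f := rfl

/-- The action of `W` on `ℂ(T)` by field automorphisms. -/
noncomputable def autRatFun {n : ℕ} (q : ℂˣ) : ExtWeyl n →* (RatFun n ≃+* RatFun n) where
  toFun w := IsFractionRing.ringEquivOfRingEquiv (autLaurent q w).toRingEquiv
  map_one' := by
    rw [map_one]
    exact map_one (IsFractionRing.ringEquivOfRingEquivHom (Laurent n) (RatFun n))
  map_mul' v w := by
    rw [map_mul]
    exact map_mul (IsFractionRing.ringEquivOfRingEquivHom (Laurent n) (RatFun n))
      (autLaurent q v).toRingEquiv (autLaurent q w).toRingEquiv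

theorem autRatFun_algebraMap {n : ℕ} (q : ℂˣ) (w : ExtWeyl n) (f : Laurent n) :
    autRatFun q w (algebraMap _ _ f) = algebraMap _ _ (actLaurent q w f) :=
  IsFractionRing.ringEquivOfRingEquiv_algebraMap _ _

theorem autRatFun_const {n : ℕ} (q : ℂˣ) (w : ExtWeyl n) (c : ℂ) :
    autRatFun q w (algebraMap ℂ _ c) = algebraMap ℂ _ c := by
  rw [IsScalarTower.algebraMap_apply ℂ (Laurent n) (RatFun n), autRatFun_algebraMap,
    AlgHom.commutes]

/-- The function `e_q^a = q^r t_i / t_j` on `T` for the affine root `a = r c + ε_i - ε_j`. -/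
noncomputable def rootFun {n : ℕ} (q : ℂˣ) (r : ℤ) (i j : Fin (n + 1)) : RatFun n :=
  algebraMap (Laurent n) (RatFun n)
    (AddMonoidAlgebra.single (Pi.single i 1 - Pi.single j 1) ((q ^ r : ℂˣ) : ℂ))

/-- The algebra generated by `ℂ[T]` and by `(1 - e_q^a)⁻¹`, `(k⁻¹ - k e_q^a)⁻¹` for all affine
roots `a`. -/
noncomputable def locAlg (n : ℕ) (k q : ℂˣ) : Subalgebra ℂ (RatFun n) :=
  Algebra.adjoin ℂ
    (Set.range (algebraMap (Laurent n) (RatFun n)) ∪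
      ({x | ∃ (r : ℤ) (i j : Fin (n + 1)), i ≠ j ∧ x = (1 - rootFun q r i j)⁻¹} ∪
        {x | ∃ (r : ℤ) (i j : Fin (n + 1)), i ≠ j ∧
          x = (algebraMap ℂ _ ((k⁻¹ : ℂˣ) : ℂ) - algebraMap ℂ _ (k : ℂ) * rootFun q r i j)⁻¹}))

theorem autRatFun_rootFun {n : ℕ} (q : ℂˣ) (w : ExtWeyl n) (r : ℤ) (i j : Fin (n + 1)) :
    autRatFun q w (rootFun q r i j) =
      rootFun q (r - (Multiplicative.toAdd w.left (w.right i) -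
        Multiplicative.toAdd w.left (w.right j))) (w.right i) (w.right j) := by
  have h : ∀ i l : Fin (n + 1), (Pi.single i (1 : ℤ) : Fin (n + 1) → ℤ) (w.right⁻¹ l) =
      (Pi.single (w.right i) (1 : ℤ) : Fin (n + 1) → ℤ) l := by
    intro i l
    by_cases hl : l = w.right i
    · subst hl; simp
    · rw [Pi.single_eq_of_ne hl, Pi.single_eq_of_ne]
      intro e
      exact hl (by rw [← e]; simp)
  rw [rootFun, autRatFun_algebraMap, actLaurent_single, rootFun]
  congr 2
  · funext l
    rw [Pi.sub_apply, Pi.sub_apply, h, h]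
  · rw [← Units.val_mul, ← zpow_add, sub_eq_add_neg]
    congr 4
    simp only [Pi.add_apply, Pi.neg_apply, h, mul_add, mul_neg, Finset.sum_add_distrib]
    simp [Pi.single_apply, sub_eq_add_neg]

theorem autRatFun_mem {n : ℕ} {k q : ℂˣ} (w : ExtWeyl n) {x : RatFun n} (hx : x ∈ locAlg n k q) :
    autRatFun q w x ∈ locAlg n k q := by
  induction hx using Algebra.adjoin_induction with
  | mem x hx =>
    refine Algebra.subset_adjoin ?_
    rcases hx with ⟨f, rfl⟩ | ⟨r, i, j, hij, rfl⟩ | ⟨r, i, j, hij, rfl⟩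
    · rw [autRatFun_algebraMap]
      exact Or.inl ⟨_, rfl⟩
    · rw [map_inv₀, map_sub, map_one, autRatFun_rootFun]
      exact Or.inr (Or.inl ⟨_, _, _, fun e => hij (w.right.injective e), rfl⟩)
    · rw [map_inv₀, map_sub, map_mul, autRatFun_const, autRatFun_const, autRatFun_rootFun]
      exact Or.inr (Or.inr ⟨_, _, _, fun e => hij (w.right.injective e), rfl⟩)
  | algebraMap c => rw [autRatFun_const]; exact Subalgebra.algebraMap_mem _ _
  | add x y _ _ hx hy => rw [map_add]; exact add_mem hx hy
  | mul x y _ _ hx hy => rw [map_mul]; exact mul_mem hx hy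

/-- The algebra `ℂ_{σ,∇}[T]`, i.e. the subalgebra `locAlg n k q` of `ℂ(T)` as a type. -/
def LocAlg (n : ℕ) (k q : ℂˣ) : Type := locAlg n k q

noncomputable instance (n : ℕ) (k q : ℂˣ) : CommRing (LocAlg n k q) :=
  inferInstanceAs (CommRing (locAlg n k q))

noncomputable instance (n : ℕ) (k q : ℂˣ) : Algebra ℂ (LocAlg n k q) :=
  inferInstanceAs (Algebra ℂ (locAlg n k q))

/-- The inclusion of `ℂ_{σ,∇}[T]` in `ℂ(T)`. -/
noncomputable def LocAlg.incl {n : ℕ} {k q : ℂˣ} : LocAlg n k q →ₐ[ℂ] RatFun n := (locAlg n k q).val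

theorem LocAlg.ext {n : ℕ} {k q : ℂˣ} {x y : LocAlg n k q} (h : x.incl = y.incl) : x = y :=
  Subtype.ext h

/-- An element of `ℂ(T)` that lies in the subalgebra `ℂ_{σ,∇}[T]`. -/
def LocAlg.mk {n : ℕ} {k q : ℂˣ} (x : RatFun n) (hx : x ∈ locAlg n k q) : LocAlg n k q :=
  (⟨x, hx⟩ : locAlg n k q)

/-- The action of `W` on `ℂ_{σ,∇}[T]`, restricting the action `w_q` on `ℂ(T)`. -/
noncomputable instance locAction (n : ℕ) (k q : ℂˣ) :
    MulSemiringAction (ExtWeyl n) (LocAlg n k q) where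
  smul w x := LocAlg.mk (autRatFun q w x.incl) (autRatFun_mem w x.2)
  one_smul x := LocAlg.ext (by
    change autRatFun q 1 x.incl = x.incl
    rw [map_one]; rfl)
  mul_smul v w x := LocAlg.ext (by
    change autRatFun q (v * w) x.incl = autRatFun q v (autRatFun q w x.incl)
    rw [map_mul]; rfl)
  smul_zero w := LocAlg.ext (map_zero (autRatFun q w))
  smul_add w x y := LocAlg.ext (map_add (autRatFun q w) _ _)
  smul_one w := LocAlg.ext (map_one (autRatFun q w))
  smul_mul w x y := LocAlg.ext (map_mul (autRatFun q w) _ _)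

theorem LocAlg.incl_smul {n : ℕ} {k q : ℂˣ} (w : ExtWeyl n) (x : LocAlg n k q) :
    (w • x).incl = autRatFun q w x.incl := rfl

instance locCommClass (n : ℕ) (k q : ℂˣ) : SMulCommClass (ExtWeyl n) ℂ (LocAlg n k q) where
  smul_comm w c x := LocAlg.ext (by
    have h : ∀ y : LocAlg n k q, (c • y).incl = algebraMap ℂ _ c * y.incl := fun y => by
      rw [map_smul, Algebra.smul_def]
    rw [LocAlg.incl_smul, h, h, LocAlg.incl_smul, map_mul, autRatFun_const])

/-- The smash product algebra `ℂ_{σ,∇}[T] #_q W` of `q`-difference reflection operators; the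
element `single w f` is `f w`, and `w f = (w_q f) w`. -/
abbrev DiffRefl (n : ℕ) (k q : ℂˣ) : Type := SkewMonoidAlgebra (LocAlg n k q) (ExtWeyl n)

/-! ### The extended affine Hecke algebra of `GL_m` -/

/-- The generators `T_1, …, T_{m-1}, T_ζ, T_ζ⁻¹`. -/
inductive HeckeGen (n : ℕ) : Type
  | T (i : Fin n)
  | Z
  | Zi

/-- The generator `T_i` of the free algebra. -/
noncomputable def freeT {n : ℕ} (i : Fin n) : FreeAlgebra ℂ (HeckeGen n) :=
  FreeAlgebra.ι ℂ (HeckeGen.T i)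

/-- The generator `T_ζ` of the free algebra. -/
noncomputable def freeZ (n : ℕ) : FreeAlgebra ℂ (HeckeGen n) := FreeAlgebra.ι ℂ HeckeGen.Z

/-- The generator `T_ζ⁻¹` of the free algebra. -/
noncomputable def freeZi (n : ℕ) : FreeAlgebra ℂ (HeckeGen n) := FreeAlgebra.ι ℂ HeckeGen.Zi

/-- The defining relations of the extended affine Hecke algebra `H(κ)` of `GL_m`. -/
inductive HeckeRel (n : ℕ) (κ : ℂˣ) :
    FreeAlgebra ℂ (HeckeGen n) → FreeAlgebra ℂ (HeckeGen n) → Prop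
  | quad (i : Fin n) : HeckeRel n κ
      ((freeT i - algebraMap ℂ _ (κ : ℂ)) * (freeT i + algebraMap ℂ _ ((κ⁻¹ : ℂˣ) : ℂ))) 0
  | braid (i j : Fin n) (h : (i : ℕ) + 1 = j) : HeckeRel n κ
      (freeT i * freeT j * freeT i) (freeT j * freeT i * freeT j)
  | comm (i j : Fin n) (h : (i : ℕ) + 1 < j) : HeckeRel n κ
      (freeT i * freeT j) (freeT j * freeT i)
  | inv_right : HeckeRel n κ (freeZ n * freeZi n) 1
  | inv_left : HeckeRel n κ (freeZi n * freeZ n) 1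
  | shift (i j : Fin n) (h : (i : ℕ) + 1 = j) : HeckeRel n κ
      (freeZ n * freeT i) (freeT j * freeZ n)
  | central (i : Fin n) : HeckeRel n κ
      (freeZ n ^ (n + 1) * freeT i) (freeT i * freeZ n ^ (n + 1))

/-- The extended affine Hecke algebra `H(κ)` of `GL_m`. -/
def Hecke (n : ℕ) (κ : ℂˣ) : Type := RingQuot (HeckeRel n κ)

noncomputable instance (n : ℕ) (κ : ℂˣ) : Ring (Hecke n κ) :=
  inferInstanceAs (Ring (RingQuot (HeckeRel n κ)))

noncomputable instance (n : ℕ) (κ : ℂˣ) : Algebra ℂ (Hecke n κ) :=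
  inferInstanceAs (Algebra ℂ (RingQuot (HeckeRel n κ)))

/-- The canonical projection from the free algebra. -/
noncomputable def heckeMk (n : ℕ) (κ : ℂˣ) : FreeAlgebra ℂ (HeckeGen n) →ₐ[ℂ] Hecke n κ :=
  RingQuot.mkAlgHom ℂ (HeckeRel n κ)

theorem heckeMk_rel {n : ℕ} {κ : ℂˣ} {x y : FreeAlgebra ℂ (HeckeGen n)} (h : HeckeRel n κ x y) :
    heckeMk n κ x = heckeMk n κ y := RingQuot.mkAlgHom_rel ℂ h

section Hecke

variable {n : ℕ} {κ : ℂˣ}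

/-- The generator `T_i`. -/
noncomputable def heckeT (κ : ℂˣ) (i : Fin n) : Hecke n κ :=
  heckeMk n κ (freeT i)

/-- The generator `T_ζ`. -/
noncomputable def heckeZ (n : ℕ) (κ : ℂˣ) : Hecke n κ :=
  heckeMk n κ (freeZ n)

/-- The generator `T_ζ⁻¹`. -/
noncomputable def heckeZi (n : ℕ) (κ : ℂˣ) : Hecke n κ :=
  heckeMk n κ (freeZi n)

theorem heckeT_quad (i : Fin n) : (heckeT κ i - algebraMap ℂ _ (κ : ℂ)) *
    (heckeT κ i + algebraMap ℂ _ ((κ⁻¹ : ℂˣ) : ℂ)) = 0 := by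
  have := heckeMk_rel (HeckeRel.quad (κ := κ) i)
  simpa only [map_mul, map_sub, map_add, AlgHom.commutes, map_zero, heckeT] using this

theorem heckeT_braid (i j : Fin n) (h : (i : ℕ) + 1 = j) :
    heckeT κ i * heckeT κ j * heckeT κ i = heckeT κ j * heckeT κ i * heckeT κ j := by
  have := heckeMk_rel (HeckeRel.braid (κ := κ) i j h)
  simpa only [map_mul, heckeT, heckeZ] using this

theorem heckeT_comm (i j : Fin n) (h : (i : ℕ) + 1 < j) :
    heckeT κ i * heckeT κ j = heckeT κ j * heckeT κ i := by
  have := heckeMk_rel (HeckeRel.comm (κ := κ) i j h)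
  simpa only [map_mul, heckeT, heckeZ] using this

theorem heckeZ_mul_heckeZi : heckeZ n κ * heckeZi n κ = 1 := by
  have := heckeMk_rel (HeckeRel.inv_right (n := n) (κ := κ))
  simpa only [map_mul, map_one, heckeZ, heckeZi] using this

theorem heckeZi_mul_heckeZ : heckeZi n κ * heckeZ n κ = 1 := by
  have := heckeMk_rel (HeckeRel.inv_left (n := n) (κ := κ))
  simpa only [map_mul, map_one, heckeZ, heckeZi] using this

theorem heckeZ_mul_heckeT (i j : Fin n) (h : (i : ℕ) + 1 = j) :
    heckeZ n κ * heckeT κ i = heckeT κ j * heckeZ n κ := by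
  have := heckeMk_rel (HeckeRel.shift (κ := κ) i j h)
  simpa only [map_mul, heckeT, heckeZ] using this

theorem heckeZ_pow_mul_heckeT (i : Fin n) :
    heckeZ n κ ^ (n + 1) * heckeT κ i = heckeT κ i * heckeZ n κ ^ (n + 1) := by
  have := heckeMk_rel (HeckeRel.central (κ := κ) i)
  simpa only [map_mul, map_pow, heckeT, heckeZ] using this

theorem heckeT_mul_self (i : Fin n) : heckeT κ i * heckeT κ i =
    ((κ : ℂ) - ((κ⁻¹ : ℂˣ) : ℂ)) • heckeT κ i + 1 := by
  have h := heckeT_quad (κ := κ) i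
  have h2 : (algebraMap ℂ (Hecke n κ) (κ : ℂ)) * algebraMap ℂ _ ((κ⁻¹ : ℂˣ) : ℂ) = 1 := by
    rw [← map_mul, ← Units.val_mul]; simp
  rw [sub_mul, mul_add, mul_add, h2, ← Algebra.commutes ((κ⁻¹ : ℂˣ) : ℂ), ← Algebra.smul_def,
    ← Algebra.smul_def] at h
  rw [sub_smul]
  rw [eq_sub_of_add_eq (sub_eq_zero.mp h)]
  abel

/-- Homomorphisms out of the Hecke algebra. -/
theorem exists_heckeLift {B : Type*} [Ring B] [Algebra ℂ B] (t : Fin n → B) (z z' : B)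
    (quad : ∀ i, t i * t i = ((κ : ℂ) - ((κ⁻¹ : ℂˣ) : ℂ)) • t i + 1)
    (braid : ∀ i j : Fin n, (i : ℕ) + 1 = j → t i * t j * t i = t j * t i * t j)
    (comm : ∀ i j : Fin n, (i : ℕ) + 1 < j → t i * t j = t j * t i)
    (inv_right : z * z' = 1) (inv_left : z' * z = 1)
    (shift : ∀ i j : Fin n, (i : ℕ) + 1 = j → z * t i = t j * z)
    (central : ∀ i, z ^ (n + 1) * t i = t i * z ^ (n + 1)) :
    ∃ F : Hecke n κ →ₐ[ℂ] B, (∀ i, F (heckeT κ i) = t i) ∧ F (heckeZ n κ) = z := by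
  let f : FreeAlgebra ℂ (HeckeGen n) →ₐ[ℂ] B := FreeAlgebra.lift ℂ fun x =>
    match x with
    | HeckeGen.T i => t i
    | HeckeGen.Z => z
    | HeckeGen.Zi => z'
  have hT : ∀ i, f (freeT i) = t i := fun i => FreeAlgebra.lift_ι_apply _ _
  have hZ : f (freeZ n) = z := FreeAlgebra.lift_ι_apply _ _
  have hZi : f (freeZi n) = z' := FreeAlgebra.lift_ι_apply _ _
  have quad' : ∀ i, (t i - algebraMap ℂ B (κ : ℂ)) * (t i + algebraMap ℂ B ((κ⁻¹ : ℂˣ) : ℂ)) = 0 := by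
    intro i
    have h2 : algebraMap ℂ B (κ : ℂ) * algebraMap ℂ B ((κ⁻¹ : ℂˣ) : ℂ) = 1 := by
      rw [← map_mul, ← Units.val_mul]; simp
    rw [sub_mul, mul_add, mul_add, h2, ← Algebra.commutes ((κ⁻¹ : ℂˣ) : ℂ), ← Algebra.smul_def,
      ← Algebra.smul_def, quad, sub_smul]
    abel
  have hf : ∀ ⦃x y⦄, HeckeRel n κ x y → f x = f y := by
    intro x y h
    cases h with
    | quad i => simpa only [map_mul, map_sub, map_add, AlgHom.commutes, map_zero, hT] using quad' i
    | braid i j h => simpa only [map_mul, hT] using braid i j h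
    | comm i j h => simpa only [map_mul, hT] using comm i j h
    | inv_right => simpa only [map_mul, map_one, hZ, hZi] using inv_right
    | inv_left => simpa only [map_mul, map_one, hZ, hZi] using inv_left
    | shift i j h => simpa only [map_mul, hT, hZ] using shift i j h
    | central i => simpa only [map_mul, map_pow, hT, hZ] using central i
  refine ⟨RingQuot.liftAlgHom ℂ ⟨f, hf⟩, fun i => ?_, ?_⟩
  · exact (RingQuot.liftAlgHom_mkAlgHom_apply ℂ f hf (freeT i)).trans (hT i)
  · exact (RingQuot.liftAlgHom_mkAlgHom_apply ℂ f hf (freeZ n)).trans hZ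

/-- `T_i` as a unit, with inverse `T_i - κ + κ⁻¹`. -/
noncomputable def unitT (κ : ℂˣ) (i : Fin n) : (Hecke n κ)ˣ where
  val := heckeT κ i
  inv := heckeT κ i - ((κ : ℂ) - ((κ⁻¹ : ℂˣ) : ℂ)) • 1
  val_inv := by rw [mul_sub, heckeT_mul_self, mul_smul_comm, mul_one]; abel
  inv_val := by rw [sub_mul, heckeT_mul_self, smul_mul_assoc, one_mul]; abel

/-- `T_ζ` as a unit. -/
noncomputable def unitZ (n : ℕ) (κ : ℂˣ) : (Hecke n κ)ˣ where
  val := heckeZ n κ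
  inv := heckeZi n κ
  val_inv := heckeZ_mul_heckeZi
  inv_val := heckeZi_mul_heckeZ

/-- The element `T_w` for `w ∈ S_m`. -/
noncomputable def heckeTw (κ : ℂˣ) (w : Equiv.Perm (Fin (n + 1))) : Hecke n κ :=
  ((reducedWord w).map (heckeT κ)).prod

/-- `Y_j = T_{j-1}⁻¹ ⋯ T_1⁻¹ T_ζ T_{m-1} ⋯ T_j`. -/
noncomputable def unitY (κ : ℂˣ) (j : Fin (n + 1)) : (Hecke n κ)ˣ :=
  (((List.finRange n).filter fun i => i.castSucc < j).reverse.map fun i => (unitT κ i)⁻¹).prod *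
    unitZ n κ * (((List.finRange n).filter fun i => j ≤ i.castSucc).reverse.map (unitT κ)).prod

/-- `Y^μ = Y_1^{μ_1} ⋯ Y_m^{μ_m}`. -/
noncomputable def powY (κ : ℂˣ) (μ : Fin (n + 1) → ℤ) : Hecke n κ :=
  (((List.finRange (n + 1)).map fun j => unitY κ j ^ μ j).prod : (Hecke n κ)ˣ)

/-- `f(Y) ∈ H(κ)` for `f ∈ ℂ[T]`. -/
noncomputable def evalY (κ : ℂˣ) (f : Laurent n) : Hecke n κ :=
  f.coeff.sum fun μ c => c • powY κ μ

/-- The value `f(t)` of `f ∈ ℂ[T]` at the point `t ∈ T`. -/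
noncomputable def evalT (t : Fin (n + 1) → ℂˣ) (f : Laurent n) : ℂ :=
  f.coeff.sum fun μ c => c * ((∏ j, t j ^ μ j : ℂˣ) : ℂ)

/-- The number `± κ^{± 1}` for the sign `s = ± 1`. -/
noncomputable def signPow (s : ℤˣ) (κ : ℂˣ) : ℂ := ((s : ℤ) : ℂ) * ((κ ^ (s : ℤ) : ℂˣ) : ℂ)

theorem signPow_quad (s : ℤˣ) (κ : ℂˣ) :
    signPow s κ * signPow s κ = ((κ : ℂ) - ((κ⁻¹ : ℂˣ) : ℂ)) • signPow s κ + 1 := by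
  have h : (κ : ℂ) * ((κ⁻¹ : ℂˣ) : ℂ) = 1 := by rw [← Units.val_mul]; simp
  rw [smul_eq_mul]
  rcases Int.units_eq_one_or s with rfl | rfl
  · simp only [signPow, Units.val_one, zpow_one, Int.cast_one]
    linear_combination h
  · simp only [signPow, Units.val_neg, Units.val_one, zpow_neg, zpow_one, Int.cast_neg, Int.cast_one]
    linear_combination h

theorem exists_heckeSign (n : ℕ) (s : ℤˣ) (κ : ℂˣ) : ∃ F : Hecke n κ →ₐ[ℂ] ℂ,
    (∀ i, F (heckeT κ i) = signPow s κ) ∧ F (heckeZ n κ) = 1 :=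
  exists_heckeLift (fun _ => signPow s κ) 1 1 (fun _ => signPow_quad s κ) (fun _ _ _ => rfl)
    (fun _ _ _ => rfl) (by simp) (by simp) (fun _ _ _ => by simp) (fun _ => by simp)

/-- The one-dimensional representation `ε_±` of `H(κ)`: `T_i ↦ ± κ^{± 1}`, `T_ζ ↦ 1`. -/
noncomputable def heckeSign (n : ℕ) (s : ℤˣ) (κ : ℂˣ) : Hecke n κ →ₐ[ℂ] ℂ :=
  (exists_heckeSign n s κ).choose

/-- The subalgebra `H_{0,I}` generated by the `T_i`, `i ∈ I`. -/
noncomputable def finParabolic (κ : ℂˣ) (I : Set (Fin n)) : Subalgebra ℂ (Hecke n κ) :=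
  Algebra.adjoin ℂ (heckeT κ '' I)

/-- The parabolic subalgebra `H_I` generated by the `T_i`, `i ∈ I`, and the `f(Y)`,
`f ∈ ℂ[T]`. -/
noncomputable def affParabolic (κ : ℂˣ) (I : Set (Fin n)) : Subalgebra ℂ (Hecke n κ) :=
  Algebra.adjoin ℂ (heckeT κ '' I ∪ Set.range (evalY κ))

theorem heckeT_mem (κ : ℂˣ) {I : Set (Fin n)} {i : Fin n} (hi : i ∈ I) :
    heckeT κ i ∈ affParabolic κ I := Algebra.subset_adjoin (Or.inl ⟨i, hi, rfl⟩)

theorem evalY_mem (κ : ℂˣ) (I : Set (Fin n)) (f : Laurent n) : evalY κ f ∈ affParabolic κ I :=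
  Algebra.subset_adjoin (Or.inr ⟨f, rfl⟩)

end Hecke

/-! ### The Cherednik representation `π^{κ,q}` -/

section Coefficients

variable {n : ℕ}

/-- The coordinate function `t_i`. -/
noncomputable def coordFun (i : Fin (n + 1)) : RatFun n :=
  algebraMap (Laurent n) (RatFun n) (AddMonoidAlgebra.single (Pi.single i 1) 1)

theorem coordFun_ne_zero (i : Fin (n + 1)) : coordFun i ≠ 0 := by
  rw [coordFun, Ne, FaithfulSMul.algebraMap_eq_zero_iff]
  intro h
  have := congrArg (fun f => f.coeff (Pi.single i 1)) h
  simp at this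

theorem coordFun_sub_ne_zero {i j : Fin (n + 1)} (hij : i ≠ j) : coordFun j - coordFun i ≠ 0 := by
  rw [coordFun, coordFun, ← map_sub, Ne, FaithfulSMul.algebraMap_eq_zero_iff]
  intro h
  have := congrArg (fun f => f.coeff (Pi.single i 1)) h
  have hne : (Pi.single i 1 : Fin (n + 1) → ℤ) ≠ Pi.single j 1 := by
    intro e
    have := congrFun e i
    rw [Pi.single_eq_same, Pi.single_eq_of_ne hij] at this
    exact one_ne_zero this
  simp [hne] at this

/-- The constant `κ` in `ℂ(T)`. -/
noncomputable def constFun (n : ℕ) (κ : ℂˣ) : RatFun n := algebraMap ℂ _ (κ : ℂ)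

theorem constFun_ne_zero (κ : ℂˣ) : constFun n κ ≠ 0 := by
  rw [constFun, Ne, FaithfulSMul.algebraMap_eq_zero_iff]
  exact κ.ne_zero

theorem constFun_inv (κ : ℂˣ) : constFun n κ⁻¹ = (constFun n κ)⁻¹ := by
  refine eq_inv_of_mul_eq_one_left ?_
  rw [constFun, constFun, ← map_mul, ← Units.val_mul, inv_mul_cancel, Units.val_one, map_one]

theorem rootFun_zero (q : ℂˣ) (i j : Fin (n + 1)) :
    rootFun q 0 i j = coordFun i / coordFun j := by
  rw [eq_div_iff (coordFun_ne_zero j), rootFun, coordFun, coordFun, ← map_mul,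
    AddMonoidAlgebra.single_mul_single]
  simp

theorem hecke_coeff_ne_zero (κ : ℂˣ) {i j : Fin (n + 1)} (hij : i ≠ j) :
    coordFun j - constFun n κ ^ 2 * coordFun i ≠ 0 := by
  rw [coordFun, coordFun, constFun, ← map_pow, IsScalarTower.algebraMap_apply ℂ (Laurent n)
    (RatFun n), ← map_mul, ← map_sub, Ne, FaithfulSMul.algebraMap_eq_zero_iff, ← Algebra.smul_def]
  intro h
  have := congrArg (fun f => f.coeff (Pi.single j 1)) h
  have hne : (Pi.single i 1 : Fin (n + 1) → ℤ) ≠ Pi.single j 1 := by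
    intro e
    have := congrFun e i
    rw [Pi.single_eq_same, Pi.single_eq_of_ne hij] at this
    exact one_ne_zero this
  simp [hne.symm] at this

/-- The function `c^κ(a) = (κ⁻¹ - κ e_q^a) / (1 - e_q^a)` for the affine root
`a = r c + ε_i - ε_j`. -/
noncomputable def cFun (κ q : ℂˣ) (r : ℤ) (i j : Fin (n + 1)) : RatFun n :=
  (constFun n κ⁻¹ - constFun n κ * rootFun q r i j) / (1 - rootFun q r i j)

theorem rootFun_mem (k q : ℂˣ) (r : ℤ) (i j : Fin (n + 1)) : rootFun q r i j ∈ locAlg n k q :=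
  Algebra.subset_adjoin (Or.inl ⟨_, rfl⟩)

theorem constFun_mem (k q κ : ℂˣ) : constFun n κ ∈ locAlg n k q := Subalgebra.algebraMap_mem _ _

theorem rootFun_self (q : ℂˣ) (r : ℤ) (i : Fin (n + 1)) :
    rootFun q r i i = algebraMap ℂ _ ((q ^ r : ℂˣ) : ℂ) := by
  rw [IsScalarTower.algebraMap_apply ℂ (Laurent n) (RatFun n), rootFun, sub_self]
  rfl

theorem one_sub_rootFun_inv_mem (k q : ℂˣ) (r : ℤ) (i j : Fin (n + 1)) :
    (1 - rootFun q r i j)⁻¹ ∈ locAlg n k q := by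
  by_cases hij : i = j
  · subst hij
    rw [rootFun_self, ← map_one (algebraMap ℂ (RatFun n)), ← map_sub, ← map_inv₀]
    exact Subalgebra.algebraMap_mem _ _
  · exact Algebra.subset_adjoin (Or.inr (Or.inl ⟨r, i, j, hij, rfl⟩))

theorem hecke_sub_rootFun_inv_mem (k q : ℂˣ) (r : ℤ) (i j : Fin (n + 1)) :
    (constFun n k⁻¹ - constFun n k * rootFun q r i j)⁻¹ ∈ locAlg n k q := by
  by_cases hij : i = j
  · subst hij
    rw [rootFun_self, constFun, constFun, ← map_mul, ← map_sub, ← map_inv₀]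
    exact Subalgebra.algebraMap_mem _ _
  · exact Algebra.subset_adjoin (Or.inr (Or.inr ⟨r, i, j, hij, rfl⟩))

theorem cFun_mem (κ k q : ℂˣ) (r : ℤ) (i j : Fin (n + 1)) : cFun κ q r i j ∈ locAlg n k q := by
  rw [cFun, div_eq_mul_inv]
  exact mul_mem (sub_mem (constFun_mem _ _ _) (mul_mem (constFun_mem _ _ _) (rootFun_mem _ _ _ _ _)))
    (one_sub_rootFun_inv_mem _ _ _ _ _)

theorem cFun_inv_mem (k q : ℂˣ) (r : ℤ) (i j : Fin (n + 1)) :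
    (cFun k q r i j)⁻¹ ∈ locAlg n k q := by
  rw [cFun, inv_div, div_eq_mul_inv]
  exact mul_mem (sub_mem (one_mem _) (rootFun_mem _ _ _ _ _)) (hecke_sub_rootFun_inv_mem _ _ _ _ _)

variable (κ k q : ℂˣ)

/-- `c^κ(ε_i - ε_j)` as an element of `ℂ_{σ,∇}[T]`. -/
noncomputable def cLoc (i j : Fin (n + 1)) : LocAlg n k q :=
  LocAlg.mk (cFun κ q 0 i j) (cFun_mem κ k q 0 i j)

/-- `κ - c^κ(ε_i - ε_j)` as an element of `ℂ_{σ,∇}[T]`. -/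
noncomputable def aLoc (i j : Fin (n + 1)) : LocAlg n k q :=
  algebraMap ℂ _ (κ : ℂ) - cLoc κ k q i j

/-- `c^k(ε_i - ε_j)⁻¹` as an element of `ℂ_{σ,∇}[T]`. -/
noncomputable def uLoc (i j : Fin (n + 1)) : LocAlg n k q :=
  LocAlg.mk (cFun k q 0 i j)⁻¹ (cFun_inv_mem k q 0 i j)

/-- `(c^k(ε_i - ε_j) - k) / c^k(ε_i - ε_j)` as an element of `ℂ_{σ,∇}[T]`. -/
noncomputable def vLoc (i j : Fin (n + 1)) : LocAlg n k q :=
  LocAlg.mk ((cFun k q 0 i j - constFun n k) / cFun k q 0 i j)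
    (div_eq_mul_inv (cFun k q 0 i j - constFun n k) (cFun k q 0 i j) ▸
      mul_mem (sub_mem (cFun_mem k k q 0 i j) (constFun_mem k q k)) (cFun_inv_mem k q 0 i j))

variable {κ k q}

theorem autRatFun_rootFun_of (w : ExtWeyl n) (i j : Fin (n + 1))
    (h : Multiplicative.toAdd w.left (w.right i) = Multiplicative.toAdd w.left (w.right j)) :
    autRatFun q w (rootFun q 0 i j) = rootFun q 0 (w.right i) (w.right j) := by
  rw [autRatFun_rootFun, h, sub_self, sub_zero]

theorem autRatFun_cFun_of (w : ExtWeyl n) (i j : Fin (n + 1))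
    (h : Multiplicative.toAdd w.left (w.right i) = Multiplicative.toAdd w.left (w.right j)) :
    autRatFun q w (cFun κ q 0 i j) = cFun κ q 0 (w.right i) (w.right j) := by
  simp only [cFun, map_div₀, map_sub, map_mul, map_one, autRatFun_rootFun_of w i j h, constFun,
    autRatFun_const]

theorem smul_cLoc (w : ExtWeyl n) (i j : Fin (n + 1))
    (h : Multiplicative.toAdd w.left (w.right i) = Multiplicative.toAdd w.left (w.right j)) :
    w • cLoc κ k q i j = cLoc κ k q (w.right i) (w.right j) :=
  LocAlg.ext (autRatFun_cFun_of w i j h)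

theorem smul_aLoc (w : ExtWeyl n) (i j : Fin (n + 1))
    (h : Multiplicative.toAdd w.left (w.right i) = Multiplicative.toAdd w.left (w.right j)) :
    w • aLoc κ k q i j = aLoc κ k q (w.right i) (w.right j) := by
  rw [aLoc, smul_sub, smul_cLoc w i j h, smul_algebraMap, aLoc]

theorem smul_uLoc (w : ExtWeyl n) (i j : Fin (n + 1))
    (h : Multiplicative.toAdd w.left (w.right i) = Multiplicative.toAdd w.left (w.right j)) :
    w • uLoc k q i j = uLoc k q (w.right i) (w.right j) :=
  LocAlg.ext (by
    change autRatFun q w (cFun k q 0 i j)⁻¹ = _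
    rw [map_inv₀, autRatFun_cFun_of w i j h]; rfl)

theorem smul_vLoc (w : ExtWeyl n) (i j : Fin (n + 1))
    (h : Multiplicative.toAdd w.left (w.right i) = Multiplicative.toAdd w.left (w.right j)) :
    w • vLoc k q i j = vLoc k q (w.right i) (w.right j) :=
  LocAlg.ext (by
    change autRatFun q w ((cFun k q 0 i j - constFun n k) / cFun k q 0 i j) = _
    rw [map_div₀, map_sub, autRatFun_cFun_of w i j h, constFun, autRatFun_const]; rfl)

theorem cFun_eq {i j : Fin (n + 1)} :
    cFun κ q 0 i j = (coordFun j - constFun n κ ^ 2 * coordFun i) /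
      (constFun n κ * (coordFun j - coordFun i)) := by
  have hj := coordFun_ne_zero j
  have hκ := constFun_ne_zero (n := n) κ
  rw [cFun, rootFun_zero, constFun_inv]
  field_simp

theorem coe_cLoc (i j : Fin (n + 1)) : (cLoc κ k q i j).incl =
    (coordFun j - constFun n κ ^ 2 * coordFun i) / (constFun n κ * (coordFun j - coordFun i)) :=
  cFun_eq

theorem coe_aLoc {i j : Fin (n + 1)} (hij : i ≠ j) : (aLoc κ k q i j).incl =
    (constFun n κ ^ 2 - 1) * coordFun j / (constFun n κ * (coordFun j - coordFun i)) := by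
  have h1 := coordFun_sub_ne_zero hij
  have hκ := constFun_ne_zero (n := n) κ
  have : (aLoc κ k q i j).incl = constFun n κ - cFun κ q 0 i j := rfl
  rw [this, cFun_eq]
  field_simp
  ring

theorem coe_uLoc (i j : Fin (n + 1)) : (uLoc k q i j).incl =
    (constFun n k * (coordFun j - coordFun i)) / (coordFun j - constFun n k ^ 2 * coordFun i) := by
  have : (uLoc k q i j).incl = (cFun k q 0 i j)⁻¹ := rfl
  rw [this, cFun_eq, inv_div]

theorem coe_vLoc {i j : Fin (n + 1)} (hij : i ≠ j) : (vLoc k q i j).incl =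
    (1 - constFun n k ^ 2) * coordFun j / (coordFun j - constFun n k ^ 2 * coordFun i) := by
  have h1 := coordFun_sub_ne_zero hij
  have h2 := hecke_coeff_ne_zero k hij
  have hκ := constFun_ne_zero (n := n) k
  have : (vLoc k q i j).incl = (cFun k q 0 i j - constFun n k) / cFun k q 0 i j := rfl
  rw [this, cFun_eq]
  field_simp
  ring

section Identities

variable {i j l : Fin (n + 1)}

theorem pi_quad_one (hij : i ≠ j) :
    aLoc κ k q i j * aLoc κ k q i j + cLoc κ k q i j * cLoc κ k q j i =
      algebraMap ℂ _ ((κ : ℂ) - ((κ⁻¹ : ℂˣ) : ℂ)) * aLoc κ k q i j + 1 := by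
  have h1 := coordFun_sub_ne_zero hij
  have h2 := coordFun_sub_ne_zero hij.symm
  have hκ := constFun_ne_zero (n := n) κ
  refine LocAlg.ext ?_
  rw [map_sub]
  change (aLoc κ k q i j).incl * (aLoc κ k q i j).incl + (cLoc κ k q i j).incl * (cLoc κ k q j i).incl =
    (constFun n κ - constFun n κ⁻¹) * (aLoc κ k q i j).incl + 1
  rw [coe_aLoc hij, coe_cLoc, coe_cLoc, constFun_inv]
  field_simp
  ring

theorem pi_quad_refl (hij : i ≠ j) : aLoc κ k q i j + aLoc κ k q j i =
      algebraMap ℂ _ ((κ : ℂ) - ((κ⁻¹ : ℂˣ) : ℂ)) := by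
  have h1 := coordFun_sub_ne_zero hij
  have h2 := coordFun_sub_ne_zero hij.symm
  have hκ := constFun_ne_zero (n := n) κ
  refine LocAlg.ext ?_
  rw [map_sub]
  change (aLoc κ k q i j).incl + (aLoc κ k q j i).incl = (constFun n κ - constFun n κ⁻¹)
  rw [coe_aLoc hij, coe_aLoc hij.symm, constFun_inv]
  field_simp
  ring

theorem pi_braid_one (hij : i ≠ j) (hjl : j ≠ l) (hil : i ≠ l) :
    aLoc κ k q i j * aLoc κ k q j l * aLoc κ k q i j +
      cLoc κ k q i j * aLoc κ k q i l * cLoc κ k q j i =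
    aLoc κ k q j l * aLoc κ k q i j * aLoc κ k q j l +
      cLoc κ k q j l * aLoc κ k q i l * cLoc κ k q l j := by
  have h1 := coordFun_sub_ne_zero hij
  have h2 := coordFun_sub_ne_zero hij.symm
  have h3 := coordFun_sub_ne_zero hjl
  have h4 := coordFun_sub_ne_zero hjl.symm
  have h5 := coordFun_sub_ne_zero hil
  have hκ := constFun_ne_zero (n := n) κ
  refine LocAlg.ext ?_
  change (aLoc κ k q i j).incl * (aLoc κ k q j l).incl * (aLoc κ k q i j).incl +
      (cLoc κ k q i j).incl * (aLoc κ k q i l).incl * (cLoc κ k q j i).incl =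
    (aLoc κ k q j l).incl * (aLoc κ k q i j).incl * (aLoc κ k q j l).incl +
      (cLoc κ k q j l).incl * (aLoc κ k q i l).incl * (cLoc κ k q l j).incl
  rw [coe_aLoc hij, coe_aLoc hjl, coe_aLoc hil, coe_cLoc, coe_cLoc, coe_cLoc, coe_cLoc]
  field_simp
  ring

theorem pi_braid_left (hij : i ≠ j) (hjl : j ≠ l) (hil : i ≠ l) :
    aLoc κ k q i j * aLoc κ k q j l + aLoc κ k q i l * aLoc κ k q j i =
      aLoc κ k q j l * aLoc κ k q i l := by
  have h1 := coordFun_sub_ne_zero hij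
  have h2 := coordFun_sub_ne_zero hij.symm
  have h3 := coordFun_sub_ne_zero hjl
  have h5 := coordFun_sub_ne_zero hil
  have hκ := constFun_ne_zero (n := n) κ
  refine LocAlg.ext ?_
  change (aLoc κ k q i j).incl * (aLoc κ k q j l).incl + (aLoc κ k q i l).incl * (aLoc κ k q j i).incl =
      (aLoc κ k q j l).incl * (aLoc κ k q i l).incl
  rw [coe_aLoc hij, coe_aLoc hij.symm, coe_aLoc hjl, coe_aLoc hil]
  field_simp
  ring

theorem pi_braid_right (hij : i ≠ j) (hjl : j ≠ l) (hil : i ≠ l) :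
    aLoc κ k q j l * aLoc κ k q i j + aLoc κ k q i l * aLoc κ k q l j =
      aLoc κ k q i j * aLoc κ k q i l := by
  have h1 := coordFun_sub_ne_zero hij
  have h3 := coordFun_sub_ne_zero hjl
  have h4 := coordFun_sub_ne_zero hjl.symm
  have h5 := coordFun_sub_ne_zero hil
  have hκ := constFun_ne_zero (n := n) κ
  refine LocAlg.ext ?_
  change (aLoc κ k q j l).incl * (aLoc κ k q i j).incl + (aLoc κ k q i l).incl * (aLoc κ k q l j).incl =
      (aLoc κ k q i j).incl * (aLoc κ k q i l).incl
  rw [coe_aLoc hij, coe_aLoc hjl.symm, coe_aLoc hjl, coe_aLoc hil]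
  field_simp
  ring

theorem nabla_quad_one (hij : i ≠ j) :
    uLoc k q i j * uLoc k q j i + vLoc k q i j * vLoc k q j i = 1 := by
  have h2 := hecke_coeff_ne_zero k hij
  have h3 := hecke_coeff_ne_zero k hij.symm
  refine LocAlg.ext ?_
  change (uLoc k q i j).incl * (uLoc k q j i).incl + (vLoc k q i j).incl * (vLoc k q j i).incl = 1
  rw [coe_uLoc, coe_uLoc, coe_vLoc hij, coe_vLoc hij.symm]
  field_simp
  ring

theorem nabla_quad_T (hij : i ≠ j) :
    uLoc k q i j * uLoc k q j i * algebraMap ℂ _ ((k : ℂ) - ((k⁻¹ : ℂˣ) : ℂ)) +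
      (uLoc k q i j * vLoc k q j i + vLoc k q i j * uLoc k q j i) = 0 := by
  have h2 := hecke_coeff_ne_zero k hij
  have h3 := hecke_coeff_ne_zero k hij.symm
  have hκ := constFun_ne_zero (n := n) k
  refine LocAlg.ext ?_
  rw [map_sub]
  change (uLoc k q i j).incl * (uLoc k q j i).incl * (constFun n k - constFun n k⁻¹) +
    ((uLoc k q i j).incl * (vLoc k q j i).incl + (vLoc k q i j).incl * (uLoc k q j i).incl) = 0
  rw [coe_uLoc, coe_uLoc, coe_vLoc hij, coe_vLoc hij.symm, constFun_inv]
  field_simp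
  ring

theorem nabla_braid_left (hij : i ≠ j) (hjl : j ≠ l) (hil : i ≠ l) :
    uLoc k q i j * vLoc k q i l * uLoc k q j l *
        algebraMap ℂ _ ((k : ℂ) - ((k⁻¹ : ℂˣ) : ℂ)) +
      (uLoc k q i j * vLoc k q i l * vLoc k q j l + vLoc k q i j * vLoc k q i l * uLoc k q j l) =
    vLoc k q j l * uLoc k q i l * vLoc k q i j := by
  have h2 := hecke_coeff_ne_zero k hij
  have h3 := hecke_coeff_ne_zero k hil
  have h4 := hecke_coeff_ne_zero k hjl
  have hκ := constFun_ne_zero (n := n) k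
  refine LocAlg.ext ?_
  rw [map_sub]
  change (uLoc k q i j).incl * (vLoc k q i l).incl * (uLoc k q j l).incl *
        (constFun n k - constFun n k⁻¹) +
      ((uLoc k q i j).incl * (vLoc k q i l).incl * (vLoc k q j l).incl +
        (vLoc k q i j).incl * (vLoc k q i l).incl * (uLoc k q j l).incl) =
    (vLoc k q j l).incl * (uLoc k q i l).incl * (vLoc k q i j).incl
  rw [coe_uLoc, coe_uLoc, coe_uLoc, coe_vLoc hij, coe_vLoc hil, coe_vLoc hjl, constFun_inv]
  field_simp
  ring

end Identities

end Coefficients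

section WeylRelations

variable {n : ℕ}

theorem wRefl_mul_self (i : Fin n) : wRefl i * wRefl i = 1 := by
  rw [wRefl, ← map_mul, simpleRefl_mul_self, map_one]

theorem simpleRefl_braid (i j : Fin n) (h : (i : ℕ) + 1 = j) :
    simpleRefl i * simpleRefl j * simpleRefl i = simpleRefl j * simpleRefl i * simpleRefl j := by
  have hi : (i : ℕ) < n := i.2
  have hi' : (i : ℕ) + 1 < n := by omega
  have hj : j = ⟨(i : ℕ) + 1, hi'⟩ := Fin.ext h.symm
  have := (symRel_simpleRefl n).braid i hi'
  simp only [hi, hi', dif_pos] at this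
  rw [hj]
  exact this

theorem simpleRefl_comm (i j : Fin n) (h : (i : ℕ) + 1 < j) :
    simpleRefl i * simpleRefl j = simpleRefl j * simpleRefl i := by
  have := (symRel_simpleRefl n).comm i j h j.2
  simpa only [i.2, j.2, dif_pos] using this

theorem wRefl_braid (i j : Fin n) (h : (i : ℕ) + 1 = j) :
    wRefl i * wRefl j * wRefl i = wRefl j * wRefl i * wRefl j := by
  simp only [wRefl, ← map_mul, simpleRefl_braid i j h]

theorem wRefl_comm (i j : Fin n) (h : (i : ℕ) + 1 < j) :
    wRefl i * wRefl j = wRefl j * wRefl i := by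
  simp only [wRefl, ← map_mul, simpleRefl_comm i j h]

theorem zeta_right : (zeta n).right = cyc n := by
  simp [zeta, trans]

theorem zeta_left : Multiplicative.toAdd (zeta n).left = Pi.single 0 1 := by
  funext j
  have : Multiplicative.toAdd (zeta n).left j =
      (Pi.single (Fin.last n) (1 : ℤ) : Fin (n + 1) → ℤ) ((cyc n)⁻¹ j) := by
    simp [zeta, trans]
    rfl
  rw [this]
  by_cases hj : j = 0
  · subst hj
    have : (cyc n)⁻¹ 0 = Fin.last n := by rw [Equiv.Perm.inv_eq_iff_eq, cyc_last]
    rw [this]; simp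
  · rw [Pi.single_eq_of_ne hj, Pi.single_eq_of_ne]
    intro e
    rw [Equiv.Perm.inv_eq_iff_eq, cyc_last] at e
    exact hj e

theorem zeta_mul_wRefl (i j : Fin n) (h : (i : ℕ) + 1 = j) :
    zeta n * wRefl i = wRefl j * zeta n := by
  have hij : i.succ = j.castSucc := Fin.ext h
  have e : trans (Pi.single (Fin.last n) 1) * wRefl i =
      wRefl i * trans (Pi.single (Fin.last n) 1) := by
    refine SemidirectProduct.ext ?_ ?_
    · apply Multiplicative.toAdd.injective
      funext l
      simp [trans, wRefl]
      change (Pi.single (Fin.last n) (1 : ℤ) : Fin (n + 1) → ℤ) l =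
        (Pi.single (Fin.last n) (1 : ℤ) : Fin (n + 1) → ℤ) ((simpleRefl i)⁻¹ l)
      have hl : (simpleRefl i)⁻¹ l = Fin.last n ↔ l = Fin.last n := by
        rw [Equiv.Perm.inv_eq_iff_eq, simpleRefl, Equiv.swap_apply_of_ne_of_ne]
        · exact (Fin.castSucc_lt_last _).ne'
        · rw [hij]; exact (Fin.castSucc_lt_last _).ne'
      rw [Pi.single_apply, Pi.single_apply]
      simp only [hl]
    · simp [trans, wRefl]
  rw [zeta, mul_assoc, e, ← mul_assoc, ← mul_assoc, wRefl, wRefl, ← map_mul, ← map_mul,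
    cyc_simpleRefl i j h]

theorem cyc_pow : cyc n ^ (n + 1) = 1 := by
  have key : ∀ k : ℕ, ∀ j, ((cyc n ^ k) j : ℕ) = (j + k) % (n + 1) := by
    intro k
    induction k with
    | zero => intro j; rw [add_zero, Nat.mod_eq_of_lt j.2]; rfl
    | succ k ih =>
      intro j
      rw [pow_succ, Equiv.Perm.mul_apply, ih]
      refine Fin.lastCases ?_ (fun i => ?_) j
      · rw [cyc_last]
        have : ((Fin.last n : Fin (n + 1)) : ℕ) + (k + 1) = k + (n + 1) := by
          rw [Fin.val_last]; omega
        rw [this, Nat.add_mod_right]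
        simp
      · rw [cyc_castSucc, Fin.val_succ, Fin.val_castSucc]
        congr 1
        omega
  ext j
  rw [key, Nat.add_mod_right, Nat.mod_eq_of_lt j.2]
  rfl

theorem zeta_pow : zeta n ^ (n + 1) = trans (fun _ => 1) := by
  have key : ∀ k ≤ n + 1, (zeta n ^ k).right = cyc n ^ k ∧
      ∀ j, Multiplicative.toAdd (zeta n ^ k).left j = if (j : ℕ) < k then 1 else 0 := by
    intro k
    induction k with
    | zero => intro _; exact ⟨by simp, fun j => by simp⟩
    | succ k ih =>
      intro hk
      obtain ⟨h1, h2⟩ := ih (by omega)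
      refine ⟨by rw [pow_succ', SemidirectProduct.mul_right, h1, zeta_right, pow_succ'],
        fun j => ?_⟩
      rw [pow_succ', SemidirectProduct.mul_left, toAdd_mul, Pi.add_apply, zeta_left, zeta_right]
      change _ + Multiplicative.toAdd (zeta n ^ k).left ((cyc n)⁻¹ j) = _
      rw [h2]
      refine Fin.cases ?_ (fun i => ?_) j
      · have : (cyc n)⁻¹ 0 = Fin.last n := by rw [Equiv.Perm.inv_eq_iff_eq, cyc_last]
        rw [this]
        have hk' : ¬ n < k := by omega
        simp [hk']
      · have : (cyc n)⁻¹ i.succ = i.castSucc := by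
          rw [Equiv.Perm.inv_eq_iff_eq, cyc_castSucc]
        rw [this]
        simp
  obtain ⟨h1, h2⟩ := key (n + 1) le_rfl
  refine SemidirectProduct.ext ?_ ?_
  · apply Multiplicative.toAdd.injective
    funext j
    rw [h2, if_pos j.2]
    rfl
  · rw [h1, cyc_pow]; rfl

theorem zeta_pow_mul_wRefl (i : Fin n) :
    zeta n ^ (n + 1) * wRefl i = wRefl i * zeta n ^ (n + 1) := by
  rw [zeta_pow]
  refine SemidirectProduct.ext ?_ ?_
  · apply Multiplicative.toAdd.injective
    funext l
    simp [trans, wRefl]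
    rfl
  · simp [trans, wRefl]

/-- The group `W` is generated by the simple reflections and `ζ`. -/
theorem weyl_induction (K : Subgroup (ExtWeyl n)) (hs : ∀ i, wRefl i ∈ K) (hz : zeta n ∈ K)
    (w : ExtWeyl n) : w ∈ K := by
  have h1 : ∀ u : Equiv.Perm (Fin (n + 1)), SemidirectProduct.inr u ∈ K := by
    intro u
    have : Subgroup.closure (Set.range (simpleRefl (n := n))) ≤
        K.comap (SemidirectProduct.inr (φ := permLattice n)) := by
      rw [Subgroup.closure_le]
      rintro _ ⟨i, rfl⟩
      exact hs i
    exact this (mem_closure_simpleRefl u)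
  have h2 : trans (Pi.single (Fin.last n) 1) ∈ K := by
    have : trans (Pi.single (Fin.last n) 1) = (SemidirectProduct.inr (cyc n))⁻¹ * zeta n := by
      rw [zeta]; group
    rw [this]
    exact mul_mem (inv_mem (h1 _)) hz
  have h3 : ∀ j : Fin (n + 1), trans (Pi.single j 1) ∈ K := by
    intro j
    have : trans (Pi.single j 1) = SemidirectProduct.inr (Equiv.swap j (Fin.last n)) *
        trans (Pi.single (Fin.last n) 1) *
          (SemidirectProduct.inr (Equiv.swap j (Fin.last n)))⁻¹ := by
      rw [trans, trans, ← map_inv, ← SemidirectProduct.inl_aut]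
      congr 1
      apply Multiplicative.toAdd.injective
      funext l
      change (Pi.single j (1 : ℤ) : Fin (n + 1) → ℤ) l =
        (Pi.single (Fin.last n) (1 : ℤ) : Fin (n + 1) → ℤ) ((Equiv.swap j (Fin.last n))⁻¹ l)
      have hl : (Equiv.swap j (Fin.last n))⁻¹ l = Fin.last n ↔ l = j := by
        rw [Equiv.Perm.inv_eq_iff_eq, Equiv.swap_apply_right]
      rw [Pi.single_apply, Pi.single_apply]
      simp only [hl]
    rw [this]
    exact mul_mem (mul_mem (h1 _) h2) (inv_mem (h1 _))
  have h4 : ∀ v : Multiplicative (Fin (n + 1) → ℤ), SemidirectProduct.inl v ∈ K := by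
    intro v
    have : v = ∏ j, (Multiplicative.ofAdd (Pi.single j (1 : ℤ)) :
        Multiplicative (Fin (n + 1) → ℤ)) ^ Multiplicative.toAdd v j := by
      apply Multiplicative.toAdd.injective
      rw [toAdd_prod]
      funext l
      rw [Finset.sum_apply]
      simp only [toAdd_zpow, toAdd_ofAdd, Pi.smul_apply]
      simp [Pi.single_apply]
    have hm : v ∈ K.comap (SemidirectProduct.inl (φ := permLattice n)) := by
      rw [this]
      exact prod_mem fun j _ => zpow_mem (show _ ∈ K.comap SemidirectProduct.inl from h3 j) _
    exact hm
  rw [← SemidirectProduct.inl_left_mul_inr_right w]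
  exact mul_mem (h4 _) (h1 _)

end WeylRelations

section Cherednik

theorem smash_braid {R W : Type*} [CommRing R] [Group W] [MulSemiringAction W R] (s t : W)
    (hs : s * s = 1) (a b c d : R) :
    ((SkewMonoidAlgebra.single 1 a + SkewMonoidAlgebra.single s c) *
      (SkewMonoidAlgebra.single 1 b + SkewMonoidAlgebra.single t d) *
        (SkewMonoidAlgebra.single 1 a + SkewMonoidAlgebra.single s c) : SkewMonoidAlgebra R W) =
    SkewMonoidAlgebra.single 1 (a * b * a + c * s • b * s • c) +
      SkewMonoidAlgebra.single s (a * b * c + c * s • b * s • a) +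
      SkewMonoidAlgebra.single t (a * d * t • a) +
      SkewMonoidAlgebra.single (s * t) (c * s • d * s • t • a) +
      SkewMonoidAlgebra.single (t * s) (a * d * t • c) +
      SkewMonoidAlgebra.single (s * t * s) (c * s • d * s • t • c) := by
  simp only [mul_add, add_mul, SkewMonoidAlgebra.single_mul_single, mul_one, one_mul, one_smul,
    SkewMonoidAlgebra.single_add, hs, mul_smul, mul_assoc]
  abel

theorem smash_braid_eq {R W : Type*} [CommRing R] [Group W] [MulSemiringAction W R] (s t : W)
    (hs : s * s = 1) (ht : t * t = 1) (hst : s * t * s = t * s * t) (a b c d e f a' c' b' d' : R)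
    (h1 : s • b = e) (h2 : s • d = f) (h3 : s • a = a') (h4 : s • c = c')
    (h5 : t • a = e) (h6 : t • c = f) (h7 : t • b = b') (h8 : t • d = d')
    (h9 : s • e = b) (h10 : s • f = d) (h11 : t • e = a) (h12 : t • f = c)
    (e1 : a * b * a + c * e * c' = b * a * b + d * e * d')
    (e2 : a * b + e * a' = b * e) (e3 : b * a + e * b' = a * e) :
    ((SkewMonoidAlgebra.single 1 a + SkewMonoidAlgebra.single s c) *
      (SkewMonoidAlgebra.single 1 b + SkewMonoidAlgebra.single t d) *
        (SkewMonoidAlgebra.single 1 a + SkewMonoidAlgebra.single s c) : SkewMonoidAlgebra R W) =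
    (SkewMonoidAlgebra.single 1 b + SkewMonoidAlgebra.single t d) *
      (SkewMonoidAlgebra.single 1 a + SkewMonoidAlgebra.single s c) *
        (SkewMonoidAlgebra.single 1 b + SkewMonoidAlgebra.single t d) := by
  rw [smash_braid s t hs, smash_braid t s ht, hst]
  simp only [h1, h2, h3, h4, h5, h6, h7, h8, h9, h10, h11, h12]
  rw [e1, show a * b * c + c * e * a' = b * c * e by linear_combination c * e2,
    show b * a * d + d * e * b' = a * d * e by linear_combination d * e3,
    show c * f * b = b * c * f by ring, show a * d * f = d * f * a by ring,
    show c * f * d = d * f * c by ring]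
  abel

variable {n : ℕ} (κ k q : ℂˣ)

/-- The element `κ + c_i^κ (s_i - 1)`. -/
noncomputable def cherednikT (i : Fin n) : DiffRefl n k q :=
  SkewMonoidAlgebra.single 1 (aLoc κ k q i.castSucc i.succ) +
    SkewMonoidAlgebra.single (wRefl i) (cLoc κ k q i.castSucc i.succ)

variable {κ k q}

theorem toAdd_wRefl_left (i : Fin n) (j : Fin (n + 1)) :
    Multiplicative.toAdd (wRefl i).left j = 0 := rfl

theorem wRefl_right (i : Fin n) : (wRefl i).right = simpleRefl i := rfl

theorem smul_aLoc_wRefl (i : Fin n) (a b : Fin (n + 1)) :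
    wRefl i • aLoc κ k q a b = aLoc κ k q (simpleRefl i a) (simpleRefl i b) :=
  smul_aLoc _ _ _ (by rw [toAdd_wRefl_left, toAdd_wRefl_left])

theorem smul_cLoc_wRefl (i : Fin n) (a b : Fin (n + 1)) :
    wRefl i • cLoc κ k q a b = cLoc κ k q (simpleRefl i a) (simpleRefl i b) :=
  smul_cLoc _ _ _ (by rw [toAdd_wRefl_left, toAdd_wRefl_left])

theorem smul_uLoc_wRefl (i : Fin n) (a b : Fin (n + 1)) :
    wRefl i • uLoc k q a b = uLoc k q (simpleRefl i a) (simpleRefl i b) :=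
  smul_uLoc _ _ _ (by rw [toAdd_wRefl_left, toAdd_wRefl_left])

theorem smul_vLoc_wRefl (i : Fin n) (a b : Fin (n + 1)) :
    wRefl i • vLoc k q a b = vLoc k q (simpleRefl i a) (simpleRefl i b) :=
  smul_vLoc _ _ _ (by rw [toAdd_wRefl_left, toAdd_wRefl_left])

theorem simpleRefl_castSucc (i : Fin n) : simpleRefl i i.castSucc = i.succ :=
  Equiv.swap_apply_left _ _

theorem simpleRefl_succ (i : Fin n) : simpleRefl i i.succ = i.castSucc :=
  Equiv.swap_apply_right _ _

theorem simpleRefl_of_ne (i : Fin n) (a : Fin (n + 1)) (h1 : (a : ℕ) ≠ i) (h2 : (a : ℕ) ≠ i + 1) :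
    simpleRefl i a = a :=
  Equiv.swap_apply_of_ne_of_ne (fun e => h1 (by rw [e]; rfl)) (fun e => h2 (by rw [e]; rfl))

theorem toAdd_zeta_eq (i j : Fin n) (h : (i : ℕ) + 1 = j) :
    Multiplicative.toAdd (zeta n).left ((zeta n).right i.castSucc) =
      Multiplicative.toAdd (zeta n).left ((zeta n).right i.succ) := by
  have hij : i.succ = j.castSucc := Fin.ext h
  rw [zeta_right, hij, cyc_castSucc, cyc_castSucc, zeta_left, Pi.single_eq_of_ne (Fin.succ_ne_zero _),
    Pi.single_eq_of_ne (Fin.succ_ne_zero _)]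

theorem zeta_right_castSucc (i j : Fin n) (h : (i : ℕ) + 1 = j) :
    (zeta n).right i.castSucc = j.castSucc := by
  rw [zeta_right, cyc_castSucc]; exact Fin.ext h

theorem zeta_right_succ (i j : Fin n) (h : (i : ℕ) + 1 = j) :
    (zeta n).right i.succ = j.succ := by
  have hij : i.succ = j.castSucc := Fin.ext h
  rw [zeta_right, hij, cyc_castSucc]

theorem zeta_pow_right (i : Fin (n + 1)) : (zeta n ^ (n + 1)).right i = i := by
  rw [zeta_pow]; rfl

theorem toAdd_zeta_pow_eq (i : Fin (n + 1)) :
    Multiplicative.toAdd (zeta n ^ (n + 1)).left i = 1 := by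
  rw [zeta_pow]; rfl

theorem zeta_single_pow (l : ℕ) : (SkewMonoidAlgebra.single (zeta n) 1 : DiffRefl n k q) ^ l =
    SkewMonoidAlgebra.single (zeta n ^ l) 1 := by
  induction l with
  | zero => rw [pow_zero, pow_zero]; rfl
  | succ l ih =>
    rw [pow_succ, ih, SkewMonoidAlgebra.single_mul_single, smul_one, mul_one, pow_succ]

theorem cherednikT_quad (i : Fin n) : cherednikT κ k q i * cherednikT κ k q i =
    ((κ : ℂ) - ((κ⁻¹ : ℂˣ) : ℂ)) • cherednikT κ k q i + 1 := by
  have hne : i.castSucc ≠ i.succ := (Fin.castSucc_lt_succ).ne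
  have e1 := pi_quad_one (κ := κ) (k := k) (q := q) hne
  have e2 := pi_quad_refl (κ := κ) (k := k) (q := q) hne
  have e3 : aLoc κ k q i.castSucc i.succ * cLoc κ k q i.castSucc i.succ +
      cLoc κ k q i.castSucc i.succ * aLoc κ k q i.succ i.castSucc =
        algebraMap ℂ _ ((κ : ℂ) - ((κ⁻¹ : ℂˣ) : ℂ)) * cLoc κ k q i.castSucc i.succ := by
    rw [← e2]; ring
  calc cherednikT κ k q i * cherednikT κ k q i
      = SkewMonoidAlgebra.single 1 (aLoc κ k q i.castSucc i.succ * aLoc κ k q i.castSucc i.succ +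
          cLoc κ k q i.castSucc i.succ * cLoc κ k q i.succ i.castSucc) +
        SkewMonoidAlgebra.single (wRefl i)
          (aLoc κ k q i.castSucc i.succ * cLoc κ k q i.castSucc i.succ +
            cLoc κ k q i.castSucc i.succ * aLoc κ k q i.succ i.castSucc) := by
        simp only [cherednikT, mul_add, add_mul, SkewMonoidAlgebra.single_mul_single, mul_one,
          one_mul, one_smul, wRefl_mul_self, SkewMonoidAlgebra.single_add, smul_aLoc_wRefl,
          smul_cLoc_wRefl, simpleRefl_castSucc, simpleRefl_succ]
        abel
    _ = _ := by
        rw [e1, e3, SkewMonoidAlgebra.single_add, ← Algebra.smul_def, ← Algebra.smul_def,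
          ← SkewMonoidAlgebra.smul_single, ← SkewMonoidAlgebra.smul_single, cherednikT, smul_add,
          SkewMonoidAlgebra.one_def]
        abel

theorem cherednikT_braid (i j : Fin n) (h : (i : ℕ) + 1 = j) :
    cherednikT κ k q i * cherednikT κ k q j * cherednikT κ k q i =
      cherednikT κ k q j * cherednikT κ k q i * cherednikT κ k q j := by
  have hij : i.succ = j.castSucc := Fin.ext h
  have h1 : i.castSucc ≠ j.castSucc := by rw [← hij]; exact (Fin.castSucc_lt_succ).ne
  have h2 : j.castSucc ≠ j.succ := (Fin.castSucc_lt_succ).ne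
  have h3 : i.castSucc ≠ j.succ := by
    rw [Ne, Fin.ext_iff, Fin.val_castSucc, Fin.val_succ]; omega
  have s1 : simpleRefl i i.castSucc = j.castSucc := by rw [simpleRefl_castSucc, hij]
  have s2 : simpleRefl i j.castSucc = i.castSucc := by rw [← hij, simpleRefl_succ]
  have s3 : simpleRefl i j.succ = j.succ :=
    simpleRefl_of_ne _ _ (by rw [Fin.val_succ]; omega) (by rw [Fin.val_succ]; omega)
  have s4 : simpleRefl j i.castSucc = i.castSucc :=
    simpleRefl_of_ne _ _ (by rw [Fin.val_castSucc]; omega) (by rw [Fin.val_castSucc]; omega)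
  have s5 : simpleRefl j j.castSucc = j.succ := simpleRefl_castSucc j
  have s6 : simpleRefl j j.succ = j.castSucc := simpleRefl_succ j
  rw [cherednikT, cherednikT, hij]
  refine smash_braid_eq (wRefl i) (wRefl j) (wRefl_mul_self i) (wRefl_mul_self j)
    (wRefl_braid i j h) _ _ _ _ (aLoc κ k q i.castSucc j.succ) (cLoc κ k q i.castSucc j.succ)
    (aLoc κ k q j.castSucc i.castSucc) (cLoc κ k q j.castSucc i.castSucc)
    (aLoc κ k q j.succ j.castSucc) (cLoc κ k q j.succ j.castSucc)
    ?_ ?_ ?_ ?_ ?_ ?_ ?_ ?_ ?_ ?_ ?_ ?_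
    (pi_braid_one h1 h2 h3) (pi_braid_left h1 h2 h3) (pi_braid_right h1 h2 h3)
  all_goals simp only [smul_aLoc_wRefl, smul_cLoc_wRefl, s1, s2, s3, s4, s5, s6]

theorem cherednikT_comm (i j : Fin n) (h : (i : ℕ) + 1 < j) :
    cherednikT κ k q i * cherednikT κ k q j = cherednikT κ k q j * cherednikT κ k q i := by
  have s1 : simpleRefl i j.castSucc = j.castSucc :=
    simpleRefl_of_ne _ _ (by rw [Fin.val_castSucc]; omega) (by rw [Fin.val_castSucc]; omega)
  have s2 : simpleRefl i j.succ = j.succ :=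
    simpleRefl_of_ne _ _ (by rw [Fin.val_succ]; omega) (by rw [Fin.val_succ]; omega)
  have s3 : simpleRefl j i.castSucc = i.castSucc :=
    simpleRefl_of_ne _ _ (by rw [Fin.val_castSucc]; omega) (by rw [Fin.val_castSucc]; omega)
  have s4 : simpleRefl j i.succ = i.succ :=
    simpleRefl_of_ne _ _ (by rw [Fin.val_succ]; omega) (by rw [Fin.val_succ]; omega)
  simp only [cherednikT, mul_add, add_mul, SkewMonoidAlgebra.single_mul_single, mul_one,
    one_mul, one_smul, smul_aLoc_wRefl, smul_cLoc_wRefl, s1, s2, s3, s4, wRefl_comm i j h]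
  simp only [mul_comm (aLoc κ k q j.castSucc j.succ), mul_comm (cLoc κ k q j.castSucc j.succ)]
  abel

theorem cherednik_shift (i j : Fin n) (h : (i : ℕ) + 1 = j) :
    SkewMonoidAlgebra.single (zeta n) 1 * cherednikT κ k q i =
      cherednikT κ k q j * SkewMonoidAlgebra.single (zeta n) 1 := by
  simp only [cherednikT, mul_add, add_mul, SkewMonoidAlgebra.single_mul_single, mul_one,
    one_mul, smul_one, smul_aLoc _ _ _ (toAdd_zeta_eq i j h),
    smul_cLoc _ _ _ (toAdd_zeta_eq i j h), zeta_right_castSucc i j h, zeta_right_succ i j h,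
    zeta_mul_wRefl i j h]

theorem cherednik_central (i : Fin n) :
    (SkewMonoidAlgebra.single (zeta n) 1) ^ (n + 1) * cherednikT κ k q i =
      cherednikT κ k q i * (SkewMonoidAlgebra.single (zeta n) 1) ^ (n + 1) := by
  have hz : ∀ a b : Fin (n + 1), Multiplicative.toAdd (zeta n ^ (n + 1)).left
      ((zeta n ^ (n + 1)).right a) = Multiplicative.toAdd (zeta n ^ (n + 1)).left
      ((zeta n ^ (n + 1)).right b) := fun a b => by rw [toAdd_zeta_pow_eq, toAdd_zeta_pow_eq]
  rw [zeta_single_pow]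
  simp only [cherednikT, mul_add, add_mul, SkewMonoidAlgebra.single_mul_single, mul_one,
    one_mul, smul_one, smul_aLoc _ _ _ (hz _ _), smul_cLoc _ _ _ (hz _ _),
    zeta_pow_right, zeta_pow_mul_wRefl]

theorem exists_cherednik (n : ℕ) (κ k q : ℂˣ) : ∃ F : Hecke n κ →ₐ[ℂ] DiffRefl n k q,
    (∀ i, F (heckeT κ i) = cherednikT κ k q i) ∧
      F (heckeZ n κ) = SkewMonoidAlgebra.single (zeta n) 1 :=
  exists_heckeLift (cherednikT κ k q) (SkewMonoidAlgebra.single (zeta n) 1)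
    (SkewMonoidAlgebra.single (zeta n)⁻¹ 1) cherednikT_quad cherednikT_braid cherednikT_comm
    (by rw [SkewMonoidAlgebra.single_mul_single, smul_one, mul_one, mul_inv_cancel]; rfl)
    (by rw [SkewMonoidAlgebra.single_mul_single, smul_one, mul_one, inv_mul_cancel]; rfl)
    cherednik_shift cherednik_central

/-- The homomorphism `π^{κ,q}` from `H(κ)` to the algebra of `q`-difference reflection operators:
`T_i ↦ κ + c_i^κ (s_i - 1)` and `T_ζ ↦ ζ`. -/
noncomputable def cherednik (n : ℕ) (κ k q : ℂˣ) : Hecke n κ →ₐ[ℂ] DiffRefl n k q :=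
  (exists_cherednik n κ k q).choose

theorem cherednik_heckeT (i : Fin n) : cherednik n κ k q (heckeT κ i) = cherednikT κ k q i :=
  (exists_cherednik n κ k q).choose_spec.1 i

theorem cherednik_heckeZ :
    cherednik n κ k q (heckeZ n κ) = SkewMonoidAlgebra.single (zeta n) 1 :=
  (exists_cherednik n κ k q).choose_spec.2

end Cherednik

/-! ### The homomorphism `∇^{k,q}` -/

section Nabla

section Abstract

variable {R W H : Type*} [CommRing R] [Algebra ℂ R] [Group W] [MulSemiringAction W R]
  [SMulCommClass W ℂ R] [Ring H] [Algebra ℂ H]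

/-- The element `s u ⊗ T + s v ⊗ 1`, with coefficients `u`, `v` on the left of `s`. -/
noncomputable def nablaRefl (s : W) (T : H) (u v : R) : SkewMonoidAlgebra R W ⊗[ℂ] H :=
  SkewMonoidAlgebra.single s u ⊗ₜ[ℂ] T + SkewMonoidAlgebra.single s v ⊗ₜ[ℂ] 1

theorem single_mul_algebraMap (w : W) (x : R) (c : ℂ) :
    SkewMonoidAlgebra.single w (x * algebraMap ℂ R c) = c • SkewMonoidAlgebra.single w x := by
  rw [mul_comm, ← Algebra.smul_def, SkewMonoidAlgebra.smul_single]

theorem nablaRefl_sq (s : W) (hs : s * s = 1) (T : H) (c : ℂ) (hT : T * T = c • T + 1)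
    (u v u' v' : R) (hu : s • u = u') (hv : s • v = v')
    (e1 : u * u' + v * v' = 1) (e2 : u * u' * algebraMap ℂ R c + (u * v' + v * u') = 0) :
    nablaRefl s T u v * nablaRefl s T u v = 1 := by
  have : nablaRefl s T u v * nablaRefl s T u v =
      SkewMonoidAlgebra.single 1 (u * u' * algebraMap ℂ R c + (u * v' + v * u')) ⊗ₜ[ℂ] T +
        SkewMonoidAlgebra.single 1 (u * u' + v * v') ⊗ₜ[ℂ] 1 := by
    simp only [nablaRefl, mul_add, add_mul, Algebra.TensorProduct.tmul_mul_tmul,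
      SkewMonoidAlgebra.single_mul_single, hs, hu, hv, hT, mul_one, one_mul,
      TensorProduct.tmul_add, SkewMonoidAlgebra.single_add, TensorProduct.add_tmul,
      single_mul_algebraMap, TensorProduct.smul_tmul]
    abel
  rw [this, e1, e2, SkewMonoidAlgebra.single_zero, TensorProduct.zero_tmul, zero_add]
  rfl

theorem nablaRefl_triple (s t : W) (S T : H) (c : ℂ) (hS : S * S = c • S + 1)
    (u v u' v' u₁ v₁ u₂ v₂ : R) (h1 : s • u' = u₁) (h2 : s • v' = v₁)
    (h3 : s • t • u = u₂) (h4 : s • t • v = v₂) :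
    nablaRefl s S u v * nablaRefl t T u' v' * nablaRefl s S u v =
      SkewMonoidAlgebra.single (s * t * s) (u * u₁ * u₂) ⊗ₜ[ℂ] (S * T * S) +
      SkewMonoidAlgebra.single (s * t * s) (u * u₁ * v₂) ⊗ₜ[ℂ] (S * T) +
      SkewMonoidAlgebra.single (s * t * s) (v * u₁ * u₂) ⊗ₜ[ℂ] (T * S) +
      SkewMonoidAlgebra.single (s * t * s)
        (u * v₁ * u₂ * algebraMap ℂ R c + (u * v₁ * v₂ + v * v₁ * u₂)) ⊗ₜ[ℂ] S +
      SkewMonoidAlgebra.single (s * t * s) (v * u₁ * v₂) ⊗ₜ[ℂ] T +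
      SkewMonoidAlgebra.single (s * t * s) (u * v₁ * u₂ + v * v₁ * v₂) ⊗ₜ[ℂ] 1 := by
  simp only [nablaRefl, mul_add, add_mul, Algebra.TensorProduct.tmul_mul_tmul,
    SkewMonoidAlgebra.single_mul_single, h1, h2, h3, h4, hS, mul_smul, mul_one, one_mul,
    TensorProduct.tmul_add, SkewMonoidAlgebra.single_add, TensorProduct.add_tmul,
    single_mul_algebraMap, TensorProduct.smul_tmul]
  abel

theorem nablaRefl_braid (s t : W) (hst : s * t * s = t * s * t) (S T : H)
    (hST : S * T * S = T * S * T) (c : ℂ) (hS : S * S = c • S + 1) (hT : T * T = c • T + 1)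
    (u v u' v' u₁ v₁ : R) (h1 : s • u' = u₁) (h2 : s • v' = v₁) (h3 : t • u = u₁)
    (h4 : t • v = v₁) (h5 : s • u₁ = u') (h6 : s • v₁ = v') (h7 : t • u₁ = u) (h8 : t • v₁ = v)
    (e : u * v₁ * u' * algebraMap ℂ R c + (u * v₁ * v' + v * v₁ * u') = v' * u₁ * v) :
    nablaRefl s S u v * nablaRefl t T u' v' * nablaRefl s S u v =
      nablaRefl t T u' v' * nablaRefl s S u v * nablaRefl t T u' v' := by
  rw [nablaRefl_triple s t S T c hS u v u' v' u₁ v₁ u' v' h1 h2 (by rw [h3, h5]) (by rw [h4, h6]),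
    nablaRefl_triple t s T S c hT u' v' u v u₁ v₁ u v h3 h4 (by rw [h1, h7]) (by rw [h2, h8]),
    hst, hST, e,
    show u' * v₁ * u * algebraMap ℂ R c + (u' * v₁ * v + v' * v₁ * u) = v * u₁ * v' by
      linear_combination e,
    show u' * u₁ * u = u * u₁ * u' by ring, show u' * u₁ * v = v * u₁ * u' by ring,
    show v' * u₁ * u = u * u₁ * v' by ring,
    show u' * v₁ * u + v' * v₁ * v = u * v₁ * u' + v * v₁ * v' by ring]
  abel

theorem nablaRefl_comm (s t : W) (hst : s * t = t * s) (S T : H) (hST : S * T = T * S)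
    (u v u' v' : R) (h1 : s • u' = u') (h2 : s • v' = v') (h3 : t • u = u) (h4 : t • v = v) :
    nablaRefl s S u v * nablaRefl t T u' v' = nablaRefl t T u' v' * nablaRefl s S u v := by
  simp only [nablaRefl, mul_add, add_mul, Algebra.TensorProduct.tmul_mul_tmul,
    SkewMonoidAlgebra.single_mul_single, h1, h2, h3, h4, hST, hst, mul_one, one_mul]
  rw [mul_comm u' u, mul_comm u' v, mul_comm v' u, mul_comm v' v]
  abel

theorem nablaRefl_shift (z s t : W) (hz : z * s = t * z) (Z S T : H) (hZ : Z * S = T * Z)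
    (u v u' v' : R) (h1 : z • u = u') (h2 : z • v = v') :
    SkewMonoidAlgebra.single z 1 ⊗ₜ[ℂ] Z * nablaRefl s S u v =
      nablaRefl t T u' v' * SkewMonoidAlgebra.single z 1 ⊗ₜ[ℂ] Z := by
  simp only [nablaRefl, mul_add, add_mul, Algebra.TensorProduct.tmul_mul_tmul,
    SkewMonoidAlgebra.single_mul_single, h1, h2, hz, hZ, mul_one, one_mul, smul_one]

end Abstract

/-- The algebra `ℂ_{σ,∇}[T] #_q W ⊗ H(k)`. -/
abbrev DiffHecke (n : ℕ) (k q : ℂˣ) : Type := DiffRefl n k q ⊗[ℂ] Hecke n k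

variable {n : ℕ} (k q : ℂˣ)

/-- The element `∇(s_i) = (c_i^k)⁻¹ s_i T_i + ((c_i^k - k) / c_i^k) s_i`. -/
noncomputable def nablaS (i : Fin n) : DiffHecke n k q :=
  nablaRefl (wRefl i) (heckeT k i) (uLoc k q i.castSucc i.succ) (vLoc k q i.castSucc i.succ)

/-- The element `∇(ζ) = ζ T_ζ`. -/
noncomputable def nablaZ (n : ℕ) (k q : ℂˣ) : DiffHecke n k q :=
  SkewMonoidAlgebra.single (zeta n) 1 ⊗ₜ[ℂ] heckeZ n k

/-- The embedding `f ↦ f ⊗ 1` of the coefficients. -/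
noncomputable def coeffHom (n : ℕ) (k q : ℂˣ) : LocAlg n k q →ₐ[ℂ] DiffHecke n k q where
  toFun f := SkewMonoidAlgebra.single 1 f ⊗ₜ[ℂ] 1
  map_one' := rfl
  map_mul' f g := by
    rw [Algebra.TensorProduct.tmul_mul_tmul, SkewMonoidAlgebra.single_mul_single, one_smul,
      one_mul, one_mul]
  map_zero' := by rw [SkewMonoidAlgebra.single_zero, TensorProduct.zero_tmul]
  map_add' f g := by rw [SkewMonoidAlgebra.single_add, TensorProduct.add_tmul]
  commutes' c := by
    rw [Algebra.algebraMap_eq_smul_one, Algebra.algebraMap_eq_smul_one,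
      ← SkewMonoidAlgebra.smul_single, ← TensorProduct.smul_tmul']
    rfl

variable {k q}

theorem nablaS_sq (i : Fin n) : nablaS k q i * nablaS k q i = 1 := by
  have hne : i.castSucc ≠ i.succ := (Fin.castSucc_lt_succ).ne
  refine nablaRefl_sq _ (wRefl_mul_self i) _ _ (heckeT_mul_self i) _ _
    (uLoc k q i.succ i.castSucc) (vLoc k q i.succ i.castSucc) ?_ ?_ (nabla_quad_one hne)
    (nabla_quad_T hne)
  · rw [smul_uLoc_wRefl, simpleRefl_castSucc, simpleRefl_succ]
  · rw [smul_vLoc_wRefl, simpleRefl_castSucc, simpleRefl_succ]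

theorem nablaS_braid (i j : Fin n) (h : (i : ℕ) + 1 = j) :
    nablaS k q i * nablaS k q j * nablaS k q i = nablaS k q j * nablaS k q i * nablaS k q j := by
  have hij : i.succ = j.castSucc := Fin.ext h
  have h1 : i.castSucc ≠ j.castSucc := by rw [← hij]; exact (Fin.castSucc_lt_succ).ne
  have h2 : j.castSucc ≠ j.succ := (Fin.castSucc_lt_succ).ne
  have h3 : i.castSucc ≠ j.succ := by
    rw [Ne, Fin.ext_iff, Fin.val_castSucc, Fin.val_succ]; omega
  have s1 : simpleRefl i i.castSucc = j.castSucc := by rw [simpleRefl_castSucc, hij]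
  have s2 : simpleRefl i j.castSucc = i.castSucc := by rw [← hij, simpleRefl_succ]
  have s3 : simpleRefl i j.succ = j.succ :=
    simpleRefl_of_ne _ _ (by rw [Fin.val_succ]; omega) (by rw [Fin.val_succ]; omega)
  have s4 : simpleRefl j i.castSucc = i.castSucc :=
    simpleRefl_of_ne _ _ (by rw [Fin.val_castSucc]; omega) (by rw [Fin.val_castSucc]; omega)
  have s5 : simpleRefl j j.castSucc = j.succ := simpleRefl_castSucc j
  have s6 : simpleRefl j j.succ = j.castSucc := simpleRefl_succ j
  rw [nablaS, nablaS, hij]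
  refine nablaRefl_braid _ _ (wRefl_braid i j h) _ _ (heckeT_braid i j h) _ (heckeT_mul_self i)
    (heckeT_mul_self j) _ _ _ _ (uLoc k q i.castSucc j.succ) (vLoc k q i.castSucc j.succ)
    ?_ ?_ ?_ ?_ ?_ ?_ ?_ ?_ (nabla_braid_left h1 h2 h3)
  all_goals simp only [smul_uLoc_wRefl, smul_vLoc_wRefl, s1, s2, s3, s4, s5, s6]

theorem nablaS_comm (i j : Fin n) (h : (i : ℕ) + 1 < j) :
    nablaS k q i * nablaS k q j = nablaS k q j * nablaS k q i := by
  have s1 : simpleRefl i j.castSucc = j.castSucc :=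
    simpleRefl_of_ne _ _ (by rw [Fin.val_castSucc]; omega) (by rw [Fin.val_castSucc]; omega)
  have s2 : simpleRefl i j.succ = j.succ :=
    simpleRefl_of_ne _ _ (by rw [Fin.val_succ]; omega) (by rw [Fin.val_succ]; omega)
  have s3 : simpleRefl j i.castSucc = i.castSucc :=
    simpleRefl_of_ne _ _ (by rw [Fin.val_castSucc]; omega) (by rw [Fin.val_castSucc]; omega)
  have s4 : simpleRefl j i.succ = i.succ :=
    simpleRefl_of_ne _ _ (by rw [Fin.val_succ]; omega) (by rw [Fin.val_succ]; omega)
  refine nablaRefl_comm _ _ (wRefl_comm i j h) _ _ (heckeT_comm i j h) _ _ _ _ ?_ ?_ ?_ ?_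
  all_goals simp only [smul_uLoc_wRefl, smul_vLoc_wRefl, s1, s2, s3, s4]

theorem nablaZ_mul_nablaS (i j : Fin n) (h : (i : ℕ) + 1 = j) :
    nablaZ n k q * nablaS k q i = nablaS k q j * nablaZ n k q := by
  refine nablaRefl_shift _ _ _ (zeta_mul_wRefl i j h) _ _ _ (heckeZ_mul_heckeT i j h) _ _ _ _ ?_ ?_
  · rw [smul_uLoc _ _ _ (toAdd_zeta_eq i j h), zeta_right_castSucc i j h, zeta_right_succ i j h]
  · rw [smul_vLoc _ _ _ (toAdd_zeta_eq i j h), zeta_right_castSucc i j h, zeta_right_succ i j h]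

theorem nablaZ_pow_mul_nablaS (i : Fin n) :
    nablaZ n k q ^ (n + 1) * nablaS k q i = nablaS k q i * nablaZ n k q ^ (n + 1) := by
  have hz : ∀ a b : Fin (n + 1), Multiplicative.toAdd (zeta n ^ (n + 1)).left
      ((zeta n ^ (n + 1)).right a) = Multiplicative.toAdd (zeta n ^ (n + 1)).left
      ((zeta n ^ (n + 1)).right b) := fun a b => by rw [toAdd_zeta_pow_eq, toAdd_zeta_pow_eq]
  rw [nablaZ, Algebra.TensorProduct.tmul_pow, zeta_single_pow]
  refine nablaRefl_shift _ _ _ (zeta_pow_mul_wRefl i) _ _ _ (heckeZ_pow_mul_heckeT i) _ _ _ _ ?_ ?_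
  · rw [smul_uLoc _ _ _ (hz _ _), zeta_pow_right, zeta_pow_right]
  · rw [smul_vLoc _ _ _ (hz _ _), zeta_pow_right, zeta_pow_right]

theorem exists_nablaWeyl (n : ℕ) (k q : ℂˣ) : ∃ F : ExtWeyl n →* (DiffHecke n k q)ˣ,
    (∀ i, (F (wRefl i) : DiffHecke n k q) = nablaS k q i) ∧
      (F (zeta n) : DiffHecke n k q) = nablaZ n k q := by
  let g : Fin n → (DiffHecke n k q)ˣ := fun i =>
    ⟨nablaS k q i, nablaS k q i, nablaS_sq i, nablaS_sq i⟩
  let z : (DiffHecke n k q)ˣ :=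
    ⟨nablaZ n k q, SkewMonoidAlgebra.single (zeta n)⁻¹ 1 ⊗ₜ[ℂ] heckeZi n k, by
      rw [nablaZ, Algebra.TensorProduct.tmul_mul_tmul, SkewMonoidAlgebra.single_mul_single,
        smul_one, mul_one, mul_inv_cancel, heckeZ_mul_heckeZi]
      rfl, by
      rw [nablaZ, Algebra.TensorProduct.tmul_mul_tmul, SkewMonoidAlgebra.single_mul_single,
        smul_one, mul_one, inv_mul_cancel, heckeZi_mul_heckeZ]
      rfl⟩
  obtain ⟨F, hF, hz⟩ := exists_wLift g z (fun i => Units.ext (nablaS_sq i))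
    (fun i j h => Units.ext (nablaS_braid i j h)) (fun i j h => Units.ext (nablaS_comm i j h))
    (fun i j h => Units.ext (nablaZ_mul_nablaS i j h))
    (fun i => Units.ext (by
      rw [Units.val_mul, Units.val_mul, Units.val_pow_eq_pow_val]
      exact nablaZ_pow_mul_nablaS i))
  exact ⟨F, fun i => by rw [hF], by rw [hz]⟩

/-- The group homomorphism `w ↦ ∇(w)`, determined by `∇(s_i)` and `∇(ζ)`. -/
noncomputable def nablaWeyl (n : ℕ) (k q : ℂˣ) : ExtWeyl n →* (DiffHecke n k q)ˣ :=
  (exists_nablaWeyl n k q).choose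

theorem nablaWeyl_wRefl (i : Fin n) : (nablaWeyl n k q (wRefl i) : DiffHecke n k q) =
    nablaS k q i := (exists_nablaWeyl n k q).choose_spec.1 i

theorem nablaWeyl_zeta : (nablaWeyl n k q (zeta n) : DiffHecke n k q) = nablaZ n k q :=
  (exists_nablaWeyl n k q).choose_spec.2

theorem nablaWeyl_comm (w : ExtWeyl n) (f : LocAlg n k q) :
    coeffHom n k q (w • f) * nablaWeyl n k q w = nablaWeyl n k q w * coeffHom n k q f := by
  let K : Subgroup (ExtWeyl n) :=
    { carrier := {w | ∀ f, coeffHom n k q (w • f) * nablaWeyl n k q w =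
        nablaWeyl n k q w * coeffHom n k q f}
      mul_mem' := fun {v w} hv hw f => by
        rw [mul_smul, map_mul, Units.val_mul, ← mul_assoc, hv, mul_assoc, hw, mul_assoc]
      one_mem' := fun f => by rw [one_smul, map_one, Units.val_one, one_mul, mul_one]
      inv_mem' := fun {w} hw f => by
        have := hw (w⁻¹ • f)
        rw [smul_inv_smul] at this
        rw [map_inv, Units.eq_inv_mul_iff_mul_eq, ← mul_assoc, ← this, mul_assoc, Units.mul_inv,
          mul_one] }
  refine weyl_induction K (fun i f => ?_) (fun f => ?_) w f
  · rw [nablaWeyl_wRefl, nablaS, nablaRefl]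
    change SkewMonoidAlgebra.single 1 (wRefl i • f) ⊗ₜ[ℂ] 1 * _ =
      _ * SkewMonoidAlgebra.single 1 f ⊗ₜ[ℂ] 1
    simp only [mul_add, add_mul, Algebra.TensorProduct.tmul_mul_tmul,
      SkewMonoidAlgebra.single_mul_single, one_smul, mul_one, one_mul]
    rw [mul_comm (wRefl i • f), mul_comm (wRefl i • f)]
  · rw [nablaWeyl_zeta, nablaZ]
    change SkewMonoidAlgebra.single 1 (zeta n • f) ⊗ₜ[ℂ] 1 * _ =
      _ * SkewMonoidAlgebra.single 1 f ⊗ₜ[ℂ] 1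
    simp only [Algebra.TensorProduct.tmul_mul_tmul,
      SkewMonoidAlgebra.single_mul_single, one_smul, mul_one, one_mul]

/-- The algebra homomorphism `∇^{k,q}` from `ℂ_{σ,∇}[T] #_q W` to `ℂ_{σ,∇}[T] #_q W ⊗ H(k)`: it
maps `f` to `f`, `s_i` to `(c_i^k)⁻¹ s_i T_i + ((c_i^k - k) / c_i^k) s_i` and `ζ` to `ζ T_ζ`. -/
noncomputable def nabla (n : ℕ) (k q : ℂˣ) : DiffRefl n k q →ₐ[ℂ] DiffHecke n k q :=
  SkewMonoidAlgebra.liftNCAlgHom (coeffHom n k q)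
    ((Units.coeHom _).comp (nablaWeyl n k q)) fun {f w} => nablaWeyl_comm w f

theorem nabla_single (w : ExtWeyl n) (f : LocAlg n k q) :
    nabla n k q (SkewMonoidAlgebra.single w f) = coeffHom n k q f * nablaWeyl n k q w :=
  SkewMonoidAlgebra.liftNC_single _ _ _ _

end Nabla

/-! ### Principal series modules and the quantum affine KZ equations -/

section QuantumKZ

variable {n : ℕ}

/-- The set of all `t` in the torus with `t^{α_i} = t_i / t_{i+1} = k^{± 2}` for all `i ∈ I`; the
sign is `s`. -/
def torusSet (s : ℤˣ) (k : ℂˣ) (I : Set (Fin n)) : Set (Fin (n + 1) → ℂˣ) :=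
  {t | ∀ i ∈ I, t i.castSucc / t i.succ = k ^ (2 * (s : ℤ))}

/-- The algebra homomorphism `χ : H_I(k) → ℂ` is the character `χ_γ^{k,±,I}`: it maps `T_i` to
`± k^{± 1}` for `i ∈ I` and `f(Y)` to `f(γ)` for `f ∈ ℂ[T]`. -/
def IsPrincipalChar (s : ℤˣ) (k : ℂˣ) (I : Set (Fin n)) (γ : Fin (n + 1) → ℂˣ)
    (χ : affParabolic k I →ₐ[ℂ] ℂ) : Prop :=
  (∀ (i : Fin n) (hi : i ∈ I), χ ⟨heckeT k i, heckeT_mem k hi⟩ = signPow s k) ∧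
    ∀ f : Laurent n, χ ⟨evalY k f, evalY_mem k I f⟩ = evalT γ f

/-- The module `H(k) ⊗_{H_I(k)} ℂ_χ` induced from the character `χ`, written as the quotient of
`H(k)` by the left ideal generated by the elements `a - χ(a)`, `a ∈ H_I(k)`. -/
abbrev PrincipalModule {k : ℂˣ} {I : Set (Fin n)} (χ : affParabolic k I →ₐ[ℂ] ℂ) : Type :=
  Hecke n k ⧸ Submodule.span (Hecke n k)
    (Set.range fun a : affParabolic k I => (a : Hecke n k) - algebraMap ℂ (Hecke n k) (χ a))

/-- The element `v_w = T_w ⊗ 1` of the induced module. -/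
noncomputable def princVec {k : ℂˣ} {I : Set (Fin n)} (χ : affParabolic k I →ₐ[ℂ] ℂ)
    (w : Equiv.Perm (Fin (n + 1))) : PrincipalModule χ :=
  Submodule.Quotient.mk (heckeTw k w)

variable (n) (k q : ℂˣ) (L : Type*) [AddCommGroup L] [Module ℂ L] [Module (DiffRefl n k q) L]
  [IsScalarTower ℂ (DiffRefl n k q) L]
  (M : Type*) [AddCommGroup M] [Module ℂ M] [Module (Hecke n k) M] [IsScalarTower ℂ (Hecke n k) M]

/-- The action of `ℂ_{σ,∇}[T] #_q W ⊗ H(k)` on `Γ_L(M) = L ⊗ M`. -/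
noncomputable def sectionAction : DiffHecke n k q →ₐ[ℂ] Module.End ℂ (L ⊗[ℂ] M) :=
  (Module.endTensorEndAlgHom (R := ℂ) (A := ℂ) (M := L) (N := M)).comp
    (Algebra.TensorProduct.map (Algebra.lsmul ℂ ℂ L) (Algebra.lsmul ℂ ℂ M))

/-- The space `Γ_L(M)_∇^W` of `W`-invariants in `L ⊗ M`, where `W` acts through `∇^{k,q}`, i.e. the
solutions of the quantum affine KZ equations with values in `M`. -/
noncomputable def qkzSolutions : Submodule ℂ (L ⊗[ℂ] M) where
  carrier := {m | ∀ w : ExtWeyl n,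
    sectionAction n k q L M (nabla n k q (SkewMonoidAlgebra.single w 1)) m = m}
  add_mem' ha hb w := by rw [map_add, ha w, hb w]
  zero_mem' w := map_zero _
  smul_mem' c m hm w := by rw [map_smul, hm w]

variable {n}

/-- The space of all `φ ∈ L` with `π^{κ,q}(h) φ = ε_±^κ(h) φ` for `h ∈ H_{0,J}(κ)` and
`π^{κ,q}(f(Y)) φ = f(t) φ` for `f ∈ ℂ[T]`. -/
noncomputable def weightSpace (s : ℤˣ) (κ : ℂˣ) (J : Set (Fin n)) (t : Fin (n + 1) → ℂˣ) :
    Submodule ℂ L where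
  carrier := {φ | (∀ h ∈ finParabolic κ J, cherednik n κ k q h • φ = heckeSign n s κ h • φ) ∧
    ∀ f : Laurent n, cherednik n κ k q (evalY κ f) • φ = evalT t f • φ}
  add_mem' ha hb :=
    ⟨fun h hh => by rw [smul_add, smul_add, ha.1 h hh, hb.1 h hh],
      fun f => by rw [smul_add, smul_add, ha.2 f, hb.2 f]⟩
  zero_mem' := ⟨fun h _ => by rw [smul_zero, smul_zero], fun f => by rw [smul_zero, smul_zero]⟩
  smul_mem' c φ hφ :=
    have hc : ∀ (x : DiffRefl n k q) (y : L), x • c • y = c • x • y := fun x y => by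
      rw [← smul_one_smul (DiffRefl n k q) c y, ← smul_one_smul (DiffRefl n k q) c (x • y),
        ← mul_smul, ← mul_smul, mul_smul_comm, smul_mul_assoc, mul_one, one_mul]
    ⟨fun h hh => by rw [hc, hφ.1 h hh, smul_comm], fun f => by rw [hc, hφ.2 f, smul_comm]⟩

variable {k L}

/-- `ψ_φ = ∑_w π^{k⁻¹,q}(T_{w w̄₀⁻¹}) φ ⊗ v_w`, the sum over the minimal coset representatives. -/
noncomputable def psi {I : Set (Fin n)} (χ : affParabolic k I →ₐ[ℂ] ℂ) (φ : L) :
    L ⊗[ℂ] PrincipalModule χ :=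
  ∑ w ∈ (Set.toFinite (minCosetReps I)).toFinset,
    (cherednik n k⁻¹ k q (heckeTw k⁻¹ (w * (minCosetRep I (longest n))⁻¹)) • φ) ⊗ₜ[ℂ] princVec χ w

/-- The action of `S_m` on the torus, `(w t)_j = t_{w⁻¹(j)}`. -/
def permTorus (w : Equiv.Perm (Fin (n + 1))) (t : Fin (n + 1) → ℂˣ) : Fin (n + 1) → ℂˣ :=
  fun j => t (w⁻¹ j)

end QuantumKZ

end AffineKZ

namespace AffineKZ

/-! ### Lengths and reduced words -/

section Words

variable {n : ℕ}

/-! The proof replaces coset representatives by labellings. Let `f₀` be a weakly increasing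
labelling of the letters by elements of a totally ordered set, with level sets the blocks of $I$.
Then $w\mapsto f_0\circ w^{-1}$ identifies $S_m^I$ with the $S_m$-orbit of `f₀`, and the principal
series looks like a piece of tensor space. Put $\epsilon=\pm k^{\pm1}$. The vector $V(f)$ of a
labelling is sent by $T_i$ to $V(f\circ s_i)$ if $f(i)<f(i+1)$ and to $\epsilon V(f)$ if the two
labels agree; the quadratic relation dictates the remaining case. The generator $T_\zeta$ rotates
the labels and multiplies by a scalar $x$ attached to the label that goes round. Such a system of
vectors is an `IsLabelFamily`.

On the vector of a weakly increasing labelling, $Y_j$ acts by the scalar `labelWeight`. The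
condition $\gamma_i/\gamma_{i+1}=k^{\pm2}$ on $I$ is what allows $x$ to be chosen so that the weight
of `f₀` is $\gamma$ (`exists_labelWeight_eq`). Conversely, in any module over the Hecke algebra, a
vector with the eigenvalue $\epsilon$ for $T_i$, $i\in I$, and the right eigenvalues for the $Y_j$
is the member at `f₀` of a label family (`exists_labelFamily`). Formal combinations of labellings
carry an explicit representation (`exists_labelRep`); it supplies the character $\chi$ and shows
that the $v_w$ are independent.

Now write $\psi=\sum_f F(f)\otimes V(f)$ over the orbit. The element $1-\nabla(s_i)$ is an
invertible element times $\pi(T_i)^{-1}\otimes1-1\otimes T_i$ (`sectionAction_nablaS_iff`). So the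
qKZ equations say that $\pi(T_i)^{-1}$ on the first factor has the same effect on $\psi$ as $T_i$ on
the second, and that $\zeta\otimes T_\zeta$ fixes $\psi$. Comparing the coefficients of the $V(f)$,
this means that $F$ is a label family over $H(k^{-1})$ for the reversed order of labels, with
$\epsilon$ and $x$ inverted (`isLabelFamily_dual_iff`).

For the reversed order the weakly increasing labelling is $f_0\circ w_0$, its blocks are those of
$I^*$ and its weight is $\overline{w_0}\gamma^{-1}$ (`labelWeight_dual`). On the orbit such an $F$
is therefore the same thing as a vector $\phi=F(f_0\circ w_0)$ of the weight space, and its other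
values are $F(f_0\circ w^{-1})=\pi(T_{w\overline{w_0}^{-1}})\phi$, the coefficients of $\psi_\phi$.
-/

theorem len_inv (w : Equiv.Perm (Fin (n + 1))) : len w⁻¹ = len w := by
  unfold len
  refine Finset.card_bij' (fun p _ => (w⁻¹ p.2, w⁻¹ p.1)) (fun p _ => (w p.2, w p.1))
    ?_ ?_ ?_ ?_
  · rintro ⟨a, b⟩ hp
    simp only [Finset.mem_filter, Finset.mem_univ, true_and] at hp ⊢
    simpa using hp.symm
  · rintro ⟨a, b⟩ hp
    simp only [Finset.mem_filter, Finset.mem_univ, true_and] at hp ⊢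
    simpa using hp.symm
  · rintro ⟨a, b⟩ _; simp
  · rintro ⟨a, b⟩ _; simp

theorem simpleRefl_inv (i : Fin n) : (simpleRefl i)⁻¹ = simpleRefl i :=
  Equiv.swap_inv _ _

theorem simpleRefl_apply_apply (i : Fin n) (a : Fin (n + 1)) :
    simpleRefl i (simpleRefl i a) = a := by
  rw [← Equiv.Perm.mul_apply, simpleRefl_mul_self]; rfl

theorem simpleRefl_mul_cancel (i : Fin n) (w : Equiv.Perm (Fin (n + 1))) :
    simpleRefl i * (simpleRefl i * w) = w := by
  rw [← mul_assoc, simpleRefl_mul_self, one_mul]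

theorem inv_simpleRefl_mul (i : Fin n) (w : Equiv.Perm (Fin (n + 1))) :
    (simpleRefl i * w)⁻¹ = w⁻¹ * simpleRefl i := by
  rw [mul_inv_rev, simpleRefl_inv]

theorem perm_castSucc_lt_or_lt (w : Equiv.Perm (Fin (n + 1))) (i : Fin n) :
    w i.castSucc < w i.succ ∨ w i.succ < w i.castSucc :=
  lt_or_gt_of_ne fun e => (Fin.castSucc_lt_succ).ne (w.injective e)

theorem len_simpleRefl_mul (w : Equiv.Perm (Fin (n + 1))) (i : Fin n)
    (h : w⁻¹ i.succ < w⁻¹ i.castSucc) : len (simpleRefl i * w) + 1 = len w := by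
  rw [← len_inv, inv_simpleRefl_mul, len_mul_simpleRefl _ _ h, len_inv]

theorem len_simpleRefl_mul' (w : Equiv.Perm (Fin (n + 1))) (i : Fin n)
    (h : w⁻¹ i.castSucc < w⁻¹ i.succ) : len (simpleRefl i * w) = len w + 1 := by
  rw [← len_inv, inv_simpleRefl_mul, len_mul_simpleRefl' _ _ h, len_inv]

theorem len_one : len (1 : Equiv.Perm (Fin (n + 1))) = 0 := by
  unfold len
  rw [Finset.card_eq_zero, Finset.filter_eq_empty_iff]
  rintro ⟨a, b⟩ _ ⟨h1, h2⟩
  exact absurd h1 (not_lt.mpr h2.le)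

theorem len_prod_le (l : List (Fin n)) : len (l.map simpleRefl).prod ≤ l.length := by
  induction l with
  | nil => simp [len_one]
  | cons i l ih =>
    rw [List.map_cons, List.prod_cons, List.length_cons]
    rcases perm_castSucc_lt_or_lt ((l.map simpleRefl).prod)⁻¹ i with h | h
    · rw [len_simpleRefl_mul' _ _ h]; omega
    · have := len_simpleRefl_mul _ _ h; omega

/-- A product of $N$ simple reflections has length at most $N$. If $s_i$ raised the length of $w$,
the tail would be a word for $s_iw$ that is too short. -/
theorem IsReducedWord.of_cons {w : Equiv.Perm (Fin (n + 1))} {i : Fin n} {l : List (Fin n)}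
    (h : IsReducedWord w (i :: l)) :
    w⁻¹ i.succ < w⁻¹ i.castSucc ∧ IsReducedWord (simpleRefl i * w) l := by
  obtain ⟨h1, h2⟩ := h
  rw [List.map_cons, List.prod_cons] at h1
  have hl : (l.map simpleRefl).prod = simpleRefl i * w := by
    rw [← h1, simpleRefl_mul_cancel]
  have hle := len_prod_le l
  rw [hl] at hle
  rw [List.length_cons] at h2
  rcases perm_castSucc_lt_or_lt w⁻¹ i with h | h
  · have := len_simpleRefl_mul' _ _ h; omega
  · have := len_simpleRefl_mul _ _ h
    exact ⟨h, hl, by omega⟩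

theorem IsReducedWord.cons {w : Equiv.Perm (Fin (n + 1))} {i : Fin n} {l : List (Fin n)}
    (hi : w⁻¹ i.succ < w⁻¹ i.castSucc) (h : IsReducedWord (simpleRefl i * w) l) :
    IsReducedWord w (i :: l) := by
  refine ⟨?_, ?_⟩
  · rw [List.map_cons, List.prod_cons, h.1, simpleRefl_mul_cancel]
  · rw [List.length_cons, h.2, len_simpleRefl_mul _ _ hi]

/-- Matsumoto's theorem for the symmetric group. -/
theorem IsReducedWord.prod_eq {G : Type*} [Monoid G] (t : Fin n → G)
    (hbr : ∀ i j : Fin n, (i : ℕ) + 1 = j → t i * t j * t i = t j * t i * t j)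
    (hcomm : ∀ i j : Fin n, (i : ℕ) + 1 < j → t i * t j = t j * t i)
    {w : Equiv.Perm (Fin (n + 1))} {l l' : List (Fin n)} (h : IsReducedWord w l)
    (h' : IsReducedWord w l') : (l.map t).prod = (l'.map t).prod := by
  induction hN : len w generalizing w l l' with
  | zero =>
    rw [List.length_eq_zero_iff.mp (h.2.trans hN), List.length_eq_zero_iff.mp (h'.2.trans hN)]
  | succ N ih =>
    have hne : ∀ l, IsReducedWord w l → ∃ i r, l = i :: r := by
      rintro (_ | ⟨i, r⟩) hr
      · have := hr.2; simp [hN] at this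
      · exact ⟨i, r, rfl⟩
    obtain ⟨i, l, rfl⟩ := hne l h
    obtain ⟨j, l', rfl⟩ := hne l' h'
    obtain ⟨hi, hl⟩ := h.of_cons
    obtain ⟨hj, hl'⟩ := h'.of_cons
    have hlen : ∀ i, w⁻¹ i.succ < w⁻¹ i.castSucc → len (simpleRefl i * w) = N := fun i hi => by
      have := len_simpleRefl_mul w i hi; omega
    -- If $i$ and $j$ are both left descents, the longest element of $\langle s_i,s_j\rangle$ splits
    -- off from $w$ on the left. This yields one reduced word of $w$ starting with $i$ and one
    -- starting with $j$ that differ by a single commutation or braid relation; the induction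
    -- hypothesis compares them with the given words.
    have key : ∀ i j : Fin n, i < j → w⁻¹ i.succ < w⁻¹ i.castSucc → w⁻¹ j.succ < w⁻¹ j.castSucc →
        ∃ r r' : List (Fin n), IsReducedWord (simpleRefl i * w) r ∧
          IsReducedWord (simpleRefl j * w) r' ∧
          t i * (r.map t).prod = t j * (r'.map t).prod := by
      intro i j hij hi hj
      rcases Nat.lt_or_ge ((i : ℕ) + 1) j with hlt | hge
      · have s1 : simpleRefl i j.castSucc = j.castSucc :=
          simpleRefl_of_ne _ _ (by rw [Fin.val_castSucc]; omega) (by rw [Fin.val_castSucc]; omega)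
        have s2 : simpleRefl i j.succ = j.succ :=
          simpleRefl_of_ne _ _ (by rw [Fin.val_succ]; omega) (by rw [Fin.val_succ]; omega)
        have s3 : simpleRefl j i.castSucc = i.castSucc :=
          simpleRefl_of_ne _ _ (by rw [Fin.val_castSucc]; omega) (by rw [Fin.val_castSucc]; omega)
        have s4 : simpleRefl j i.succ = i.succ :=
          simpleRefl_of_ne _ _ (by rw [Fin.val_succ]; omega) (by rw [Fin.val_succ]; omega)
        obtain ⟨r, hr⟩ := exists_isReducedWord (simpleRefl j * (simpleRefl i * w))
        refine ⟨j :: r, i :: r, hr.cons ?_, IsReducedWord.cons ?_ ?_, ?_⟩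
        · rwa [inv_simpleRefl_mul, Equiv.Perm.mul_apply, Equiv.Perm.mul_apply, s1, s2]
        · rwa [inv_simpleRefl_mul, Equiv.Perm.mul_apply, Equiv.Perm.mul_apply, s3, s4]
        · rwa [← mul_assoc, simpleRefl_comm i j hlt, mul_assoc]
        · simp only [List.map_cons, List.prod_cons, ← mul_assoc, hcomm i j hlt]
      · have hji : (i : ℕ) + 1 = j := by have : (i : ℕ) < j := hij; omega
        have hs : i.succ = j.castSucc := Fin.ext hji
        have s1 : simpleRefl i j.castSucc = i.castSucc := by rw [← hs, simpleRefl_succ]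
        have s2 : simpleRefl i j.succ = j.succ :=
          simpleRefl_of_ne _ _ (by rw [Fin.val_succ]; omega) (by rw [Fin.val_succ]; omega)
        have s3 : simpleRefl j i.castSucc = i.castSucc :=
          simpleRefl_of_ne _ _ (by rw [Fin.val_castSucc]; omega) (by rw [Fin.val_castSucc]; omega)
        have s4 : simpleRefl j i.succ = j.succ := by rw [hs, simpleRefl_castSucc]
        obtain ⟨r, hr⟩ := exists_isReducedWord
          (simpleRefl i * (simpleRefl j * (simpleRefl i * w)))
        have e : simpleRefl i * (simpleRefl j * (simpleRefl i * w)) =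
            simpleRefl j * (simpleRefl i * (simpleRefl j * w)) := by
          simp only [← mul_assoc, simpleRefl_braid i j hji]
        -- The values of $w^{-1}$ at the three consecutive letters decrease, so each letter split
        -- off below is again a descent.
        have hij' : w⁻¹ j.succ < w⁻¹ i.castSucc := hj.trans (by rwa [← hs])
        refine ⟨j :: i :: r, i :: j :: r, IsReducedWord.cons ?_ (hr.cons ?_),
          IsReducedWord.cons ?_ (IsReducedWord.cons ?_ (e ▸ hr)), ?_⟩
        · rwa [inv_simpleRefl_mul, Equiv.Perm.mul_apply, Equiv.Perm.mul_apply, s1, s2]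
        · simp only [inv_simpleRefl_mul, Equiv.Perm.mul_apply, simpleRefl_castSucc, s3, s4, s2]
          rwa [hs]
        · rwa [inv_simpleRefl_mul, Equiv.Perm.mul_apply, Equiv.Perm.mul_apply, s3, s4]
        · simp only [inv_simpleRefl_mul, Equiv.Perm.mul_apply,
            simpleRefl_succ, s1, s2, s3]
          rwa [← hs]
        · simp only [List.map_cons, List.prod_cons, ← mul_assoc, hbr i j hji]
    rw [List.map_cons, List.prod_cons, List.map_cons, List.prod_cons]
    rcases lt_trichotomy i j with hij | rfl | hij
    · obtain ⟨r, r', hr, hr', e⟩ := key i j hij hi hj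
      rw [ih hl hr (hlen i hi), ih hl' hr' (hlen j hj), e]
    · rw [ih hl hl' (hlen i hi)]
    · obtain ⟨r, r', hr, hr', e⟩ := key j i hij hj hi
      rw [ih hl hr' (hlen i hi), ih hl' hr (hlen j hj), e]

variable {κ : ℂˣ}

theorem reducedWord_spec (w : Equiv.Perm (Fin (n + 1))) : IsReducedWord w (reducedWord w) :=
  (exists_isReducedWord w).choose_spec

theorem heckeTw_eq {w : Equiv.Perm (Fin (n + 1))} {l : List (Fin n)} (h : IsReducedWord w l) :
    heckeTw κ w = (l.map (heckeT κ)).prod :=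
  (reducedWord_spec w).prod_eq _ heckeT_braid heckeT_comm h

theorem heckeTw_one : heckeTw κ (1 : Equiv.Perm (Fin (n + 1))) = 1 :=
  heckeTw_eq (l := []) ⟨rfl, len_one.symm⟩

theorem heckeT_mul_heckeTw (w : Equiv.Perm (Fin (n + 1))) (i : Fin n)
    (h : w⁻¹ i.castSucc < w⁻¹ i.succ) :
    heckeT κ i * heckeTw κ w = heckeTw κ (simpleRefl i * w) := by
  have hr : IsReducedWord (simpleRefl i * w) (i :: reducedWord w) := by
    refine IsReducedWord.cons ?_ (by rw [simpleRefl_mul_cancel]; exact reducedWord_spec w)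
    rwa [inv_simpleRefl_mul, Equiv.Perm.mul_apply, Equiv.Perm.mul_apply, simpleRefl_castSucc,
      simpleRefl_succ]
  rw [heckeTw_eq hr]; rfl

theorem heckeTw_mul_heckeT (w : Equiv.Perm (Fin (n + 1))) (i : Fin n)
    (h : w i.castSucc < w i.succ) :
    heckeTw κ w * heckeT κ i = heckeTw κ (w * simpleRefl i) := by
  have hr : IsReducedWord (w * simpleRefl i) (reducedWord w ++ [i]) := by
    refine ⟨?_, ?_⟩
    · rw [List.map_append, List.prod_append, (reducedWord_spec w).1]; simp
    · rw [List.length_append, (reducedWord_spec w).2, len_mul_simpleRefl' w i h]; rfl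
  rw [heckeTw_eq hr, List.map_append, List.prod_append]
  simp [heckeTw]

end Words

/-! ### Labellings and minimal coset representatives -/

section Labels

variable {n : ℕ} {Λ : Type*}

theorem perm_apply_inv (w : Equiv.Perm (Fin (n + 1))) (a : Fin (n + 1)) : w (w⁻¹ a) = a :=
  w.apply_symm_apply a

theorem perm_inv_apply (w : Equiv.Perm (Fin (n + 1))) (a : Fin (n + 1)) : w⁻¹ (w a) = a :=
  w.symm_apply_apply a

theorem comp_mul_simpleRefl (f : Fin (n + 1) → Λ) (w : Equiv.Perm (Fin (n + 1))) (i : Fin n) :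
    f ∘ ⇑(simpleRefl i * w)⁻¹ = (f ∘ ⇑w⁻¹) ∘ ⇑(simpleRefl i) := by
  rw [inv_simpleRefl_mul]; rfl

theorem comp_simpleRefl_of_eq {f : Fin (n + 1) → Λ} {i : Fin n} (h : f i.castSucc = f i.succ) :
    f ∘ ⇑(simpleRefl i) = f := by
  funext a
  by_cases h1 : a = i.castSucc
  · subst h1; rw [Function.comp_apply, simpleRefl_castSucc, h]
  by_cases h2 : a = i.succ
  · subst h2; rw [Function.comp_apply, simpleRefl_succ, h]
  · rw [Function.comp_apply, simpleRefl, Equiv.swap_apply_of_ne_of_ne h1 h2]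

theorem comp_simpleRefl_comp_simpleRefl (f : Fin (n + 1) → Λ) (i : Fin n) :
    (f ∘ ⇑(simpleRefl i)) ∘ ⇑(simpleRefl i) = f := by
  funext a
  simp only [Function.comp_apply, simpleRefl_apply_apply]

variable [LinearOrder Λ] {I : Set (Fin n)} {f₀ : Fin (n + 1) → Λ}

/-- A weakly increasing labelling of the letters whose level sets are the blocks of `I`. -/
structure IsBlockLabel (I : Set (Fin n)) (f₀ : Fin (n + 1) → Λ) : Prop where
  mono : Monotone f₀
  eq_iff : ∀ i : Fin n, f₀ i.castSucc = f₀ i.succ ↔ i ∈ I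

theorem mem_minCosetReps_iff {w : Equiv.Perm (Fin (n + 1))} :
    w ∈ minCosetReps I ↔ ∀ i ∈ I, w i.castSucc < w i.succ := by
  refine forall₂_congr fun i _ => ?_
  rcases perm_castSucc_lt_or_lt w i with h | h
  · simp [len_mul_simpleRefl' w i h, h]
  · have := len_mul_simpleRefl w i h
    simp only [not_lt_of_gt h, iff_false, not_lt]
    omega

theorem one_mem_minCosetReps : (1 : Equiv.Perm (Fin (n + 1))) ∈ minCosetReps I :=
  mem_minCosetReps_iff.mpr fun _ _ => Fin.castSucc_lt_succ

/-- The reflection $s_i$ reverses the order of the pair $(i,i+1)$ only. So $s_iw$ stops being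
increasing on a block only if $w$ carries two adjacent letters of that block to $i$ and $i+1$. -/
theorem simpleRefl_mul_mem {w : Equiv.Perm (Fin (n + 1))} (hw : w ∈ minCosetReps I) {i : Fin n}
    (h : ∀ j ∈ I, ¬ (w⁻¹ i.castSucc = j.castSucc ∧ w⁻¹ i.succ = j.succ)) :
    simpleRefl i * w ∈ minCosetReps I := by
  rw [mem_minCosetReps_iff] at hw ⊢
  intro j hj
  refine simpleRefl_lt_iff i (hw j hj) fun e => h j hj ?_
  rw [← e.1, ← e.2]
  simp

theorem simpleRefl_mul_mem_of_descent {w : Equiv.Perm (Fin (n + 1))} (hw : w ∈ minCosetReps I)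
    {i : Fin n} (h : w⁻¹ i.succ < w⁻¹ i.castSucc) : simpleRefl i * w ∈ minCosetReps I :=
  simpleRefl_mul_mem hw fun j _ e => by
    rw [e.1, e.2] at h
    exact absurd h (not_lt.mpr (Fin.castSucc_lt_succ).le)

namespace IsBlockLabel

/-- Membership in `minCosetReps I` constrains adjacent letters only. As `f₀` is weakly increasing,
all letters between $a$ and $b$ share their label, and the adjacent inequalities chain together. -/
theorem lt_of_eq (hf : IsBlockLabel I f₀) {w : Equiv.Perm (Fin (n + 1))}
    (hw : w ∈ minCosetReps I) {a b : Fin (n + 1)} (hab : a < b) (h : f₀ a = f₀ b) :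
    w a < w b := by
  rw [mem_minCosetReps_iff] at hw
  induction b using Fin.induction with
  | zero => exact absurd hab (Fin.not_lt_zero a)
  | succ i ih =>
    have hai : a ≤ i.castSucc := Fin.le_castSucc_iff.mpr hab
    have h1 := hf.mono hai
    have h2 := hf.mono (Fin.castSucc_lt_succ (i := i)).le
    have h3 : f₀ i.castSucc = f₀ i.succ := le_antisymm h2 (h ▸ h1)
    have h4 := hw i ((hf.eq_iff i).mp h3)
    rcases hai.eq_or_lt with rfl | hlt
    · exact h4
    · exact (ih hlt (h.trans h3.symm)).trans h4

/-- Different labels decide the order since `f₀` is monotone, and within a block $w$ is increasing.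
Hence the inversions of $w^{-1}$ can be read off from the labelling $f_0\circ w^{-1}$. -/
theorem inv_lt_inv_iff (hf : IsBlockLabel I f₀) {w : Equiv.Perm (Fin (n + 1))}
    (hw : w ∈ minCosetReps I) {a b : Fin (n + 1)} (hab : a < b) :
    w⁻¹ a < w⁻¹ b ↔ f₀ (w⁻¹ a) ≤ f₀ (w⁻¹ b) := by
  refine ⟨fun h => hf.mono h.le, fun h => ?_⟩
  by_contra hlt
  have hlt' : w⁻¹ b < w⁻¹ a :=
    lt_of_le_of_ne (not_lt.mp hlt) fun e => hab.ne' (w⁻¹.injective e)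
  have := hf.lt_of_eq hw hlt' (le_antisymm (hf.mono hlt'.le) h)
  simp only [perm_apply_inv] at this
  exact absurd this (not_lt.mpr hab.le)

/-- By `inv_lt_inv_iff`, $v^{-1}$ and $w^{-1}$ put every pair of letters in the same order. So
$w^{-1}v$ is increasing, that is, the identity. -/
theorem inj (hf : IsBlockLabel I f₀) {v w : Equiv.Perm (Fin (n + 1))} (hv : v ∈ minCosetReps I)
    (hw : w ∈ minCosetReps I) (h : f₀ ∘ ⇑v⁻¹ = f₀ ∘ ⇑w⁻¹) : v = w := by
  have h' : ∀ a, f₀ (v⁻¹ a) = f₀ (w⁻¹ a) := congrFun h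
  have hone : w⁻¹ * v = 1 := by
    refine exists_descent _ fun i => ?_
    simp only [Equiv.Perm.mul_apply]
    have hlt : i.castSucc < i.succ := Fin.castSucc_lt_succ
    rcases perm_castSucc_lt_or_lt v i with hi | hi
    · rw [hf.inv_lt_inv_iff hw hi, ← h', ← h']
      simpa using hf.mono hlt.le
    · have hne : f₀ (v⁻¹ (v i.succ)) ≠ f₀ (v⁻¹ (v i.castSucc)) := fun e => by
        have := (hf.inv_lt_inv_iff hv hi).mpr e.le
        simp only [perm_inv_apply] at this
        exact absurd this (not_lt.mpr hlt.le)
      have hle : f₀ (v⁻¹ (v i.castSucc)) ≤ f₀ (v⁻¹ (v i.succ)) := by simpa using hf.mono hlt.le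
      have := (hf.inv_lt_inv_iff hw hi).not.mpr (by
        rw [← h', ← h', not_le]; exact lt_of_le_of_ne hle hne.symm)
      exact lt_of_le_of_ne (not_lt.mp this) fun e => hi.ne' (w⁻¹.injective e)
  exact (inv_mul_eq_one.mp hone).symm

/-- A letter strictly between $w^{-1}(i)$ and $w^{-1}(i+1)$ would have the same label, and $w$ would
send it strictly between $i$ and $i+1$. With `simpleRefl_mul_mem` this gives the dichotomy used
throughout: either $s_iw$ is again minimal, or $s_iw=ws_j$ with $j\in I$. -/
theorem consecutive (hf : IsBlockLabel I f₀) {w : Equiv.Perm (Fin (n + 1))}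
    (hw : w ∈ minCosetReps I) {i : Fin n} (h : f₀ (w⁻¹ i.castSucc) = f₀ (w⁻¹ i.succ)) :
    ∃ j ∈ I, w j.castSucc = i.castSucc ∧ w j.succ = i.succ := by
  have hlt : w⁻¹ i.castSucc < w⁻¹ i.succ :=
    (hf.inv_lt_inv_iff hw Fin.castSucc_lt_succ).mpr h.le
  obtain ⟨j, hj⟩ := Fin.exists_castSucc_eq.mpr (ne_of_lt (lt_of_lt_of_le hlt (Fin.le_last _)))
  have hjs : j.succ = w⁻¹ i.succ := by
    by_contra hne
    have h1 : j.succ < w⁻¹ i.succ :=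
      lt_of_le_of_ne (Fin.castSucc_lt_iff_succ_le.mp (hj ▸ hlt)) hne
    have h2 : w⁻¹ i.castSucc < j.succ := hj ▸ Fin.castSucc_lt_succ
    have e1 : f₀ (w⁻¹ i.castSucc) = f₀ j.succ :=
      le_antisymm (hf.mono h2.le) (h ▸ hf.mono h1.le)
    have l1 := hf.lt_of_eq hw h2 e1
    have l2 := hf.lt_of_eq hw h1 (e1.symm.trans h)
    simp only [perm_apply_inv] at l1 l2
    rw [Fin.lt_def] at l1 l2
    simp only [Fin.val_castSucc, Fin.val_succ] at l1 l2
    omega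
  refine ⟨j, (hf.eq_iff j).mp (by rw [hj, hjs, h]), by rw [hj]; simp, by rw [hjs]; simp⟩

theorem comp_parabolic (hf : IsBlockLabel I f₀) {p : Equiv.Perm (Fin (n + 1))}
    (hp : p ∈ parabolic I) : f₀ ∘ ⇑p = f₀ := by
  induction hp using Subgroup.closure_induction with
  | mem p hp =>
    obtain ⟨i, hi, rfl⟩ := hp
    exact comp_simpleRefl_of_eq ((hf.eq_iff i).mpr hi)
  | one => rfl
  | mul x y _ _ hx hy => rw [Equiv.Perm.coe_mul, ← Function.comp_assoc, hx, hy]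
  | inv x _ hx =>
    funext a
    have := congrFun hx (x⁻¹ a)
    simpa using this.symm

/-- The parabolic subgroup preserves `f₀`, so all elements of a coset give the same labelling. The
representative itself never has to be computed. -/
theorem minCosetRep_comp (hf : IsBlockLabel I f₀) (σ : Equiv.Perm (Fin (n + 1))) :
    f₀ ∘ ⇑(minCosetRep I σ)⁻¹ = f₀ ∘ ⇑σ⁻¹ := by
  have h := hf.comp_parabolic (exists_minCosetRep I σ).choose_spec.2
  change f₀ ∘ ⇑((minCosetRep I σ)⁻¹ * σ) = f₀ at h
  funext a
  have := congrFun h (σ⁻¹ a)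
  simpa using this

theorem simpleRefl_mul_mem_of_lt (hf : IsBlockLabel I f₀) {w : Equiv.Perm (Fin (n + 1))}
    (hw : w ∈ minCosetReps I) {i : Fin n} (h : f₀ (w⁻¹ i.castSucc) < f₀ (w⁻¹ i.succ)) :
    simpleRefl i * w ∈ minCosetReps I :=
  simpleRefl_mul_mem hw fun j hj e => by
    rw [e.1, e.2, (hf.eq_iff j).mpr hj] at h
    exact lt_irrefl _ h

theorem inv_lt_of_lt (hf : IsBlockLabel I f₀) {w : Equiv.Perm (Fin (n + 1))} {i : Fin n}
    (h : f₀ (w⁻¹ i.castSucc) < f₀ (w⁻¹ i.succ)) : w⁻¹ i.castSucc < w⁻¹ i.succ := by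
  by_contra hlt
  exact absurd h (not_lt.mpr (hf.mono (not_lt.mp hlt)))

theorem lt_of_inv_lt (hf : IsBlockLabel I f₀) {w : Equiv.Perm (Fin (n + 1))}
    (hw : w ∈ minCosetReps I) {i : Fin n} (h : w⁻¹ i.succ < w⁻¹ i.castSucc) :
    f₀ (w⁻¹ i.succ) < f₀ (w⁻¹ i.castSucc) := by
  by_contra hlt
  have := (hf.inv_lt_inv_iff hw (Fin.castSucc_lt_succ (i := i))).mpr (not_lt.mp hlt)
  exact absurd h (not_lt.mpr this.le)

end IsBlockLabel

theorem minCosetRep_mem (σ : Equiv.Perm (Fin (n + 1))) : minCosetRep I σ ∈ minCosetReps I :=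
  (exists_minCosetRep I σ).choose_spec.1

/-- The number of letters `i ∉ I` to the left of a given letter. -/
noncomputable def blockLabel (I : Set (Fin n)) (j : Fin (n + 1)) : ℕ :=
  {i : Fin n | i ∉ I ∧ i.castSucc < j}.ncard

/-- Passing from $i$ to $i+1$ can add only the letter $i$ to the count, and adds it exactly when
$i\notin I$. -/
theorem isBlockLabel_blockLabel (I : Set (Fin n)) : IsBlockLabel I (blockLabel I) where
  mono a b hab := Set.ncard_le_ncard (fun i hi => ⟨hi.1, hi.2.trans_le hab⟩) (Set.toFinite _)
  eq_iff i := by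
    constructor
    · intro h
      by_contra hi
      have : blockLabel I i.castSucc < blockLabel I i.succ :=
        Set.ncard_lt_ncard ⟨fun j hj => ⟨hj.1, hj.2.trans Fin.castSucc_lt_succ⟩, fun hsub =>
          lt_irrefl _ (hsub (a := i) ⟨hi, Fin.castSucc_lt_succ⟩).2⟩ (Set.toFinite _)
      omega
    · intro hi
      unfold blockLabel
      congr 1
      ext j
      refine and_congr_right fun hj => ⟨fun h => h.trans Fin.castSucc_lt_succ, fun h => ?_⟩
      refine lt_of_le_of_ne (Fin.le_castSucc_iff.mpr h) fun e => hj ?_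
      rwa [Fin.castSucc_injective _ e]

/-- Reversing the order of the letters and of the labels. -/
theorem IsBlockLabel.dual (hf : IsBlockLabel I f₀) :
    IsBlockLabel (Λ := Λᵒᵈ) (starSet I) (OrderDual.toDual ∘ f₀ ∘ ⇑(longest n)) where
  mono a b hab := hf.mono (Fin.rev_le_rev.mpr hab)
  eq_iff i := by
    have hu := minCosetRep_mem (I := I) (longest n)
    -- Since $w_0$ is an involution, $f_0\circ w_0=f_0\circ\overline{w_0}^{-1}$. Equal labels at $i$
    -- and $i+1$ then come from a pair $j,j+1$ with $j\in I$ which $\overline{w_0}$ carries to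
    -- $i,i+1$, as in the definition of $I^*$.
    have hc : ∀ a, f₀ (longest n a) = f₀ ((minCosetRep I (longest n))⁻¹ a) := fun a =>
      (congrFun (hf.minCosetRep_comp (longest n)) a).symm
    simp only [Function.comp_apply, hc, EmbeddingLike.apply_eq_iff_eq]
    constructor
    · intro h
      obtain ⟨j, hj, h1, h2⟩ := hf.consecutive hu h
      exact ⟨j, hj, h1, h2⟩
    · rintro ⟨j, hj, h1, h2⟩
      rw [← h1, ← h2]
      simpa using (hf.eq_iff j).mpr hj

end Labels

/-! ### The elements `Y_j` as products -/

section Words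

variable {n : ℕ} {κ : ℂˣ}

/-- The letters `i` with `i < j`, in increasing order. -/
def lowerWord (j : Fin (n + 1)) : List (Fin n) := (List.finRange n).filter fun i => i.castSucc < j

/-- The letters `i` with `j ≤ i`, in increasing order. -/
def upperWord (j : Fin (n + 1)) : List (Fin n) := (List.finRange n).filter fun i => j ≤ i.castSucc

theorem lowerWord_zero : lowerWord (0 : Fin (n + 1)) = [] := by simp [lowerWord]

theorem upperWord_last : upperWord (Fin.last n) = [] := by
  simp [upperWord]

theorem upperWord_zero : upperWord (0 : Fin (n + 1)) = List.finRange n := by simp [upperWord]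

theorem lowerWord_succ (i : Fin n) : lowerWord i.succ = lowerWord i.castSucc ++ [i] := by
  have h := List.pairwise_lt_finRange n
  -- Strictly increasing lists with the same members coincide.
  refine List.Pairwise.eq_of_mem_iff (r := (· < ·)) (h.filter _) ?_ fun a => ?_
  · refine List.pairwise_append.mpr ⟨h.filter _, List.pairwise_singleton _ _, fun a ha b hb => ?_⟩
    rw [List.mem_singleton] at hb
    subst hb
    simpa using (List.mem_filter.mp ha).2
  · simp [lowerWord, Fin.castSucc_lt_succ_iff, le_iff_lt_or_eq]

theorem upperWord_castSucc (i : Fin n) : upperWord i.castSucc = i :: upperWord i.succ := by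
  have h := List.pairwise_lt_finRange n
  refine List.Pairwise.eq_of_mem_iff (r := (· < ·)) (h.filter _) ?_ fun a => ?_
  · refine List.pairwise_cons.mpr ⟨fun a ha => ?_, h.filter _⟩
    simpa [Fin.succ_le_castSucc_iff] using (List.mem_filter.mp ha).2
  · simp only [upperWord, List.mem_filter, List.mem_cons, List.mem_finRange, true_and,
      decide_eq_true_eq, Fin.le_def, Fin.ext_iff, Fin.val_castSucc, Fin.val_succ]
    omega

/-- The product `T_{j-1}⁻¹ ⋯ T_1⁻¹`. -/
noncomputable def lowerT (κ : ℂˣ) (j : Fin (n + 1)) : (Hecke n κ)ˣ :=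
  ((lowerWord j).reverse.map fun i => (unitT κ i)⁻¹).prod

/-- The product `T_{m-1} ⋯ T_j`. -/
noncomputable def upperT (κ : ℂˣ) (j : Fin (n + 1)) : (Hecke n κ)ˣ :=
  ((upperWord j).reverse.map (unitT κ)).prod

theorem unitY_eq (j : Fin (n + 1)) : unitY κ j = lowerT κ j * unitZ n κ * upperT κ j := rfl

theorem lowerT_zero : lowerT κ (0 : Fin (n + 1)) = 1 := by rw [lowerT, lowerWord_zero]; rfl

theorem upperT_last : upperT κ (Fin.last n) = 1 := by rw [upperT, upperWord_last]; rfl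

theorem lowerT_succ (i : Fin n) : lowerT κ i.succ = (unitT κ i)⁻¹ * lowerT κ i.castSucc := by
  rw [lowerT, lowerWord_succ, List.reverse_append]
  simp [lowerT]

theorem upperT_castSucc (i : Fin n) : upperT κ i.castSucc = upperT κ i.succ * unitT κ i := by
  rw [upperT, upperWord_castSucc]
  simp [upperT]

/-- The cycle `s_j ⋯ s_{m-1}`. -/
def upperCyc (j : Fin (n + 1)) : Equiv.Perm (Fin (n + 1)) :=
  ((upperWord j).map simpleRefl).prod

/-- The cycle `s_{j-1} ⋯ s_1`. -/
def lowerCyc (j : Fin (n + 1)) : Equiv.Perm (Fin (n + 1)) :=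
  ((lowerWord j).reverse.map simpleRefl).prod

theorem upperCyc_last : upperCyc (Fin.last n) = 1 := by rw [upperCyc, upperWord_last]; rfl

theorem lowerCyc_zero : lowerCyc (0 : Fin (n + 1)) = 1 := by rw [lowerCyc, lowerWord_zero]; rfl

theorem upperCyc_castSucc (i : Fin n) : upperCyc i.castSucc = simpleRefl i * upperCyc i.succ := by
  rw [upperCyc, upperWord_castSucc]; rfl

theorem lowerCyc_succ (i : Fin n) : lowerCyc i.succ = simpleRefl i * lowerCyc i.castSucc := by
  rw [lowerCyc, lowerWord_succ, List.reverse_append]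
  simp [lowerCyc]

theorem lowerCyc_inv_mul_upperCyc (j : Fin (n + 1)) : (lowerCyc j)⁻¹ * upperCyc j = cyc n := by
  induction j using Fin.induction with
  | zero => rw [lowerCyc_zero, upperCyc, upperWord_zero]; simp [cyc]
  | succ i ih =>
    rw [← ih, lowerCyc_succ, upperCyc_castSucc, mul_inv_rev, simpleRefl_inv, mul_assoc]

/-- Once $T_{m-1}\cdots T_j$ has brought the label of $j$ to the last place, the rotation by
$T_\zeta$ produces precisely the arrangement that $T_{j-1}^{-1}\cdots T_1^{-1}$ undoes. -/
theorem upperCyc_mul_cyc_inv (j : Fin (n + 1)) : upperCyc j * (cyc n)⁻¹ = lowerCyc j := by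
  rw [← lowerCyc_inv_mul_upperCyc j]; group

theorem upperCyc_apply_last (j : Fin (n + 1)) : upperCyc j (Fin.last n) = j := by
  induction j using Fin.reverseInduction with
  | last => rw [upperCyc_last]; rfl
  | cast i ih => rw [upperCyc_castSucc, Equiv.Perm.mul_apply, ih, simpleRefl_succ]

end Words

/-! ### Families indexed by labellings -/

section Families

variable {n : ℕ} {κ : ℂˣ} {Λ : Type*} [LinearOrder Λ] {V : Type*} [AddCommGroup V] [Module ℂ V]

/-- A family of vectors, indexed by the labellings of the letters, on which `T_i` acts by
interchanging the labels of `i` and `i + 1` if these are in increasing order, and as `ε` if they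
are equal. -/
structure IsFinLabelFamily (ρ : Hecke n κ →ₐ[ℂ] Module.End ℂ V) (ε : ℂˣ)
    (F : (Fin (n + 1) → Λ) → V) : Prop where
  lt : ∀ f i, f i.castSucc < f i.succ → ρ (heckeT κ i) (F f) = F (f ∘ ⇑(simpleRefl i))
  eq : ∀ f i, f i.castSucc = f i.succ → ρ (heckeT κ i) (F f) = (ε : ℂ) • F f

/-- A family of vectors, indexed by the labellings of the letters, on which `T_i` and `T_ζ` act
by permuting the labels, up to scalars. -/
structure IsLabelFamily (ρ : Hecke n κ →ₐ[ℂ] Module.End ℂ V) (ε : ℂˣ) (x : Λ → ℂˣ)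
    (F : (Fin (n + 1) → Λ) → V) : Prop extends IsFinLabelFamily ρ ε F where
  zeta : ∀ f, ρ (heckeZ n κ) (F f) = (x (f (Fin.last n)) : ℂ) • F (f ∘ ⇑(cyc n)⁻¹)

/-- The product of `ε` over all `l > j` with the same label as `j`. -/
def upperProd (ε : ℂˣ) (f : Fin (n + 1) → Λ) (j : Fin (n + 1)) : ℂˣ :=
  ∏ l, if j < l ∧ f j = f l then ε else 1

/-- The product of `ε` over all `l < j` with the same label as `j`. -/
def lowerProd (ε : ℂˣ) (f : Fin (n + 1) → Λ) (j : Fin (n + 1)) : ℂˣ :=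
  ∏ l, if l < j ∧ f l = f j then ε else 1

/-- Interchanging $i$ and $i+1$ moves the label of $i$ past a single letter. That letter contributes
the first factor; the letters beyond it are unaffected. -/
theorem upperProd_castSucc (ε : ℂˣ) (f : Fin (n + 1) → Λ) (i : Fin n) :
    upperProd ε f i.castSucc =
      (if f i.castSucc = f i.succ then ε else 1) * upperProd ε (f ∘ ⇑(simpleRefl i)) i.succ := by
  have h : ∀ l, (if i.castSucc < l ∧ f i.castSucc = f l then ε else 1) =
      (if l = i.succ then (if f i.castSucc = f i.succ then ε else 1) else 1) *
      (if i.succ < l ∧ (f ∘ ⇑(simpleRefl i)) i.succ = (f ∘ ⇑(simpleRefl i)) l then ε else 1) := by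
    intro l
    rw [Function.comp_apply, Function.comp_apply, simpleRefl_succ]
    rcases eq_or_ne l i.succ with rfl | hne
    · simp
    · rw [if_neg hne, one_mul]
      have hiff : i.castSucc < l ↔ i.succ < l := by
        rw [Fin.castSucc_lt_iff_succ_le]
        exact ⟨fun h => lt_of_le_of_ne h hne.symm, le_of_lt⟩
      by_cases hl : i.succ < l
      · have hs : simpleRefl i l = l :=
          Equiv.swap_apply_of_ne_of_ne (hiff.mpr hl).ne' hne
        rw [hs]
        simp only [hiff]
      · simp [hl, hiff]
  rw [upperProd, Finset.prod_congr rfl fun l _ => h l, Finset.prod_mul_distrib]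
  simp [upperProd]

theorem lowerProd_succ (ε : ℂˣ) (f : Fin (n + 1) → Λ) (i : Fin n) :
    lowerProd ε f i.succ =
      (if f i.castSucc = f i.succ then ε else 1) * lowerProd ε (f ∘ ⇑(simpleRefl i)) i.castSucc := by
  have h : ∀ l, (if l < i.succ ∧ f l = f i.succ then ε else 1) =
      (if l = i.castSucc then (if f i.castSucc = f i.succ then ε else 1) else 1) *
      (if l < i.castSucc ∧ (f ∘ ⇑(simpleRefl i)) l = (f ∘ ⇑(simpleRefl i)) i.castSucc
        then ε else 1) := by
    intro l
    rw [Function.comp_apply, Function.comp_apply, simpleRefl_castSucc]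
    rcases eq_or_ne l i.castSucc with rfl | hne
    · simp
    · rw [if_neg hne, one_mul]
      have hiff : l < i.succ ↔ l < i.castSucc := by
        rw [← Fin.le_castSucc_iff]
        exact ⟨fun h => lt_of_le_of_ne h hne, le_of_lt⟩
      by_cases hl : l < i.castSucc
      · have hs : simpleRefl i l = l :=
          Equiv.swap_apply_of_ne_of_ne hne (hiff.mpr hl).ne
        rw [hs]
        simp only [hiff]
      · simp [hl, hiff]
  rw [lowerProd, Finset.prod_congr rfl fun l _ => h l, Finset.prod_mul_distrib]
  simp [lowerProd]

theorem upperProd_last (ε : ℂˣ) (f : Fin (n + 1) → Λ) : upperProd ε f (Fin.last n) = 1 :=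
  Finset.prod_eq_one fun l _ => if_neg fun h => absurd h.1 (not_lt.mpr (Fin.le_last l))

theorem lowerProd_zero (ε : ℂˣ) (f : Fin (n + 1) → Λ) : lowerProd ε f 0 = 1 :=
  Finset.prod_eq_one fun l _ => if_neg fun h => absurd h.1 (Fin.not_lt_zero l)

/-- The eigenvalue of `Y_j` on the member of a family of vectors that belongs to a weakly
increasing labelling. -/
def labelWeight (ε : ℂˣ) (x : Λ → ℂˣ) (f : Fin (n + 1) → Λ) (j : Fin (n + 1)) : ℂˣ :=
  upperProd ε f j * x (f j) * (lowerProd ε f j)⁻¹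

theorem unit_smul_inv (a : ℂˣ) (v : V) : (a : ℂ) • ((a⁻¹ : ℂˣ) : ℂ) • v = v := by
  rw [smul_smul, ← Units.val_mul, mul_inv_cancel, Units.val_one, one_smul]

theorem unit_inv_smul (a : ℂˣ) (v : V) : ((a⁻¹ : ℂˣ) : ℂ) • (a : ℂ) • v = v := by
  rw [smul_smul, ← Units.val_mul, inv_mul_cancel, Units.val_one, one_smul]

theorem map_inv_apply_of_eq (ρ : Hecke n κ →ₐ[ℂ] Module.End ℂ V) (u : (Hecke n κ)ˣ) {v w : V}
    {a : ℂˣ} (h : ρ u v = (a : ℂ) • w) :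
    ρ ((u⁻¹ : (Hecke n κ)ˣ) : Hecke n κ) w = ((a⁻¹ : ℂˣ) : ℂ) • v := by
  have h1 : ρ ((u⁻¹ : (Hecke n κ)ˣ) : Hecke n κ) (ρ u v) = v := by
    rw [← Module.End.mul_apply, ← map_mul, Units.inv_mul, map_one]; rfl
  rw [h, map_smul] at h1
  rw [← h1, unit_inv_smul]

namespace IsLabelFamily

variable {ρ : Hecke n κ →ₐ[ℂ] Module.End ℂ V} {ε : ℂˣ} {x : Λ → ℂˣ} {F : (Fin (n + 1) → Λ) → V}

theorem le (hF : IsLabelFamily ρ ε x F) (f : Fin (n + 1) → Λ) (i : Fin n)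
    (h : f i.castSucc ≤ f i.succ) : ρ (unitT κ i : Hecke n κ) (F f) =
      ((if f i.castSucc = f i.succ then ε else 1 : ℂˣ) : ℂ) • F (f ∘ ⇑(simpleRefl i)) := by
  change ρ (heckeT κ i) (F f) = _
  rcases h.eq_or_lt with he | hlt
  · rw [if_pos he, hF.eq f i he, comp_simpleRefl_of_eq he]
  · rw [if_neg hlt.ne, hF.lt f i hlt, Units.val_one, one_smul]

/-- The label of $j$ travels to the last place past labels none of which is smaller. Each equal
label on the way costs a factor $\epsilon$, each larger one nothing. -/
theorem upperT_apply (hF : IsLabelFamily ρ ε x F) (j : Fin (n + 1)) (f : Fin (n + 1) → Λ)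
    (h : ∀ l, j < l → f j ≤ f l) :
    ρ (upperT κ j : Hecke n κ) (F f) = (upperProd ε f j : ℂ) • F (f ∘ ⇑(upperCyc j)) := by
  induction j using Fin.reverseInduction generalizing f with
  | last =>
    rw [upperT_last, upperProd_last, upperCyc_last, Units.val_one, map_one, Units.val_one, one_smul]
    rfl
  | cast i ih =>
    have hi := h _ (Fin.castSucc_lt_succ (i := i))
    have hs : ∀ l, i.succ < l →
        (f ∘ ⇑(simpleRefl i)) i.succ ≤ (f ∘ ⇑(simpleRefl i)) l := fun l hl => by
      have hl' : i.castSucc < l := Fin.castSucc_lt_succ.trans hl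
      rw [Function.comp_apply, Function.comp_apply, simpleRefl_succ, simpleRefl,
        Equiv.swap_apply_of_ne_of_ne hl'.ne' hl.ne']
      exact h l hl'
    rw [upperT_castSucc, Units.val_mul, map_mul, Module.End.mul_apply, hF.le f i hi, map_smul,
      ih _ hs, smul_smul, ← Units.val_mul, ← upperProd_castSucc, upperCyc_castSucc]
    rfl

/-- In $f\circ{}$`lowerCyc j` the label of $j$ stands in the first place. The inverse generators
bring it back to $j$ past labels none of which is larger, with a factor $\epsilon^{-1}$ for each
equal one. -/
theorem lowerT_apply (hF : IsLabelFamily ρ ε x F) (j : Fin (n + 1)) (f : Fin (n + 1) → Λ)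
    (h : ∀ l, l < j → f l ≤ f j) :
    ρ (lowerT κ j : Hecke n κ) (F (f ∘ ⇑(lowerCyc j))) =
      (((lowerProd ε f j)⁻¹ : ℂˣ) : ℂ) • F f := by
  induction j using Fin.induction generalizing f with
  | zero =>
    rw [lowerT_zero, lowerProd_zero, lowerCyc_zero, Units.val_one, map_one, inv_one, Units.val_one,
      one_smul]
    rfl
  | succ i ih =>
    have hi := h _ (Fin.castSucc_lt_succ (i := i))
    have hs : ∀ l, l < i.castSucc →
        (f ∘ ⇑(simpleRefl i)) l ≤ (f ∘ ⇑(simpleRefl i)) i.castSucc := fun l hl => by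
      have hl' : l < i.succ := hl.trans Fin.castSucc_lt_succ
      rw [Function.comp_apply, Function.comp_apply, simpleRefl_castSucc, simpleRefl,
        Equiv.swap_apply_of_ne_of_ne hl.ne hl'.ne]
      exact h l hl'
    have hc : f ∘ ⇑(lowerCyc i.succ) = (f ∘ ⇑(simpleRefl i)) ∘ ⇑(lowerCyc i.castSucc) := by
      rw [lowerCyc_succ]; rfl
    rw [lowerT_succ, Units.val_mul, map_mul, Module.End.mul_apply, hc, ih _ hs, map_smul,
      map_inv_apply_of_eq ρ (unitT κ i) (hF.le f i hi), smul_smul, ← Units.val_mul, ← mul_inv_rev,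
      ← lowerProd_succ]

/-- The label of $j$ makes one full turn: to the right end, round by $T_\zeta$ with the scalar $x$,
and from the left end back to its place. Monotonicity ensures that it meets no label in the wrong
order. -/
theorem unitY_apply (hF : IsLabelFamily ρ ε x F) {f : Fin (n + 1) → Λ} (hf : Monotone f)
    (j : Fin (n + 1)) :
    ρ (unitY κ j : Hecke n κ) (F f) = (labelWeight ε x f j : ℂ) • F f := by
  have hz : ρ (unitZ n κ : Hecke n κ) (F (f ∘ ⇑(upperCyc j))) =
      (x (f j) : ℂ) • F (f ∘ ⇑(lowerCyc j)) := by
    have := hF.zeta (f ∘ ⇑(upperCyc j))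
    rw [Function.comp_apply, upperCyc_apply_last, Function.comp_assoc, ← Equiv.Perm.coe_mul,
      upperCyc_mul_cyc_inv] at this
    exact this
  rw [unitY_eq, Units.val_mul, Units.val_mul, map_mul, map_mul, Module.End.mul_apply,
    Module.End.mul_apply, hF.upperT_apply j f (fun l hl => hf hl.le), map_smul, map_smul, hz,
    map_smul, hF.lowerT_apply j f (fun l hl => hf hl.le), smul_smul, smul_smul, labelWeight,
    Units.val_mul, Units.val_mul]

/-- The vectors of a family for the minimal coset representatives are obtained from the first
one by applying the elements `T_w`. -/
theorem heckeTw_apply (hF : IsLabelFamily ρ ε x F) {I : Set (Fin n)} {f₀ : Fin (n + 1) → Λ}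
    (hf : IsBlockLabel I f₀) {w : Equiv.Perm (Fin (n + 1))} (hw : w ∈ minCosetReps I) :
    ρ (heckeTw κ w) (F f₀) = F (f₀ ∘ ⇑w⁻¹) := by
  induction hN : len w generalizing w with
  | zero =>
    have := (reducedWord_spec w).2
    rw [hN, List.length_eq_zero_iff] at this
    have h1 := (reducedWord_spec w).1
    rw [this] at h1
    rw [← h1]
    simp only [List.map_nil, List.prod_nil]
    rw [heckeTw_one, map_one]
    rfl
  | succ N ih =>
    by_cases hd : ∀ i : Fin n, w⁻¹ i.castSucc < w⁻¹ i.succ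
    · have := exists_descent _ hd
      rw [inv_eq_one] at this
      rw [this, len_one] at hN
      omega
    · push Not at hd
      obtain ⟨i, hi⟩ := hd
      have hi' : w⁻¹ i.succ < w⁻¹ i.castSucc :=
        (perm_castSucc_lt_or_lt w⁻¹ i).resolve_left (not_lt.mpr hi)
      have hlen := len_simpleRefl_mul w i hi'
      have hmem := simpleRefl_mul_mem_of_descent hw hi'
      have hT : heckeTw κ w = heckeT κ i * heckeTw κ (simpleRefl i * w) := by
        rw [heckeT_mul_heckeTw, simpleRefl_mul_cancel]
        rwa [inv_simpleRefl_mul, Equiv.Perm.mul_apply, Equiv.Perm.mul_apply, simpleRefl_castSucc,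
          simpleRefl_succ]
      rw [hT, map_mul, Module.End.mul_apply, ih hmem (by omega), comp_mul_simpleRefl, hF.lt,
        comp_simpleRefl_comp_simpleRefl]
      simp only [Function.comp_apply, simpleRefl_castSucc, simpleRefl_succ]
      exact hf.lt_of_inv_lt hw hi'

end IsLabelFamily

end Families

/-! ### The representation on formal combinations of labellings -/

section LabelModule

variable {n : ℕ} {Λ : Type*}

theorem comp_cyc_cyc_inv (f : Fin (n + 1) → Λ) : (f ∘ ⇑(cyc n)) ∘ ⇑(cyc n)⁻¹ = f := by
  rw [Function.comp_assoc, ← Equiv.Perm.coe_mul, mul_inv_cancel]; rfl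

theorem comp_cyc_inv_cyc (f : Fin (n + 1) → Λ) : (f ∘ ⇑(cyc n)⁻¹) ∘ ⇑(cyc n) = f := by
  rw [Function.comp_assoc, ← Equiv.Perm.coe_mul, inv_mul_cancel]; rfl

theorem cyc_inv_zero : (cyc n)⁻¹ 0 = Fin.last n := by rw [Equiv.Perm.inv_eq_iff_eq, cyc_last]

theorem cyc_inv_succ (i : Fin n) : (cyc n)⁻¹ i.succ = i.castSucc := by
  rw [Equiv.Perm.inv_eq_iff_eq, cyc_castSucc]

/-- The operator `T_ζ` on the space spanned by the labellings. -/
noncomputable def labelZ (n : ℕ) (x : Λ → ℂˣ) : Module.End ℂ ((Fin (n + 1) → Λ) →₀ ℂ) :=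
  Finsupp.linearCombination ℂ fun f =>
    (x (f (Fin.last n)) : ℂ) • Finsupp.single (f ∘ ⇑(cyc n)⁻¹) (1 : ℂ)

/-- The inverse of `T_ζ` on the space spanned by the labellings. -/
noncomputable def labelZi (n : ℕ) (x : Λ → ℂˣ) : Module.End ℂ ((Fin (n + 1) → Λ) →₀ ℂ) :=
  Finsupp.linearCombination ℂ fun f =>
    (((x (f 0))⁻¹ : ℂˣ) : ℂ) • Finsupp.single (f ∘ ⇑(cyc n)) (1 : ℂ)

theorem labelZ_single (x : Λ → ℂˣ) (f : Fin (n + 1) → Λ) :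
    labelZ n x (Finsupp.single f 1) =
      (x (f (Fin.last n)) : ℂ) • Finsupp.single (f ∘ ⇑(cyc n)⁻¹) (1 : ℂ) := by
  rw [labelZ, Finsupp.linearCombination_single, one_smul]

theorem labelZi_single (x : Λ → ℂˣ) (f : Fin (n + 1) → Λ) :
    labelZi n x (Finsupp.single f 1) =
      (((x (f 0))⁻¹ : ℂˣ) : ℂ) • Finsupp.single (f ∘ ⇑(cyc n)) (1 : ℂ) := by
  rw [labelZi, Finsupp.linearCombination_single, one_smul]

theorem labelEnd_ext {W : Type*} [AddCommGroup W] [Module ℂ W]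
    {A B : ((Fin (n + 1) → Λ) →₀ ℂ) →ₗ[ℂ] W}
    (h : ∀ f, A (Finsupp.single f 1) = B (Finsupp.single f 1)) : A = B :=
  Finsupp.lhom_ext' fun f => LinearMap.ext_ring (h f)

theorem labelZ_mul_labelZi (x : Λ → ℂˣ) : labelZ n x * labelZi n x = 1 := by
  refine labelEnd_ext fun f => ?_
  rw [Module.End.mul_apply, labelZi_single, map_smul, labelZ_single, comp_cyc_cyc_inv,
    Function.comp_apply, cyc_last, unit_inv_smul]
  rfl

theorem labelZi_mul_labelZ (x : Λ → ℂˣ) : labelZi n x * labelZ n x = 1 := by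
  refine labelEnd_ext fun f => ?_
  rw [Module.End.mul_apply, labelZ_single, map_smul, labelZi_single, comp_cyc_inv_cyc,
    Function.comp_apply, cyc_inv_zero, unit_smul_inv]
  rfl

theorem cyc_inv_pow_last {a : ℕ} (ha : a ≤ n) :
    (((cyc n)⁻¹ ^ a) (Fin.last n) : Fin (n + 1)) = ⟨n - a, by omega⟩ := by
  induction a with
  | zero => rfl
  | succ a ih =>
    rw [pow_succ', Equiv.Perm.mul_apply, ih (by omega)]
    have : (⟨n - a, by omega⟩ : Fin (n + 1)) = (⟨n - (a + 1), by omega⟩ : Fin n).succ := by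
      rw [Fin.ext_iff, Fin.val_succ]; simp only; omega
    rw [this, cyc_inv_succ]
    rfl

/-- After $m$ rotations the labelling is restored and every label has passed the last place once.
The scalar is symmetric in the labels, and this is why $T_\zeta^m$ commutes with the $T_i$. -/
theorem labelZ_pow_single (x : Λ → ℂˣ) (f : Fin (n + 1) → Λ) :
    (labelZ n x ^ (n + 1)) (Finsupp.single f 1) =
      ((∏ j, x (f j) : ℂˣ) : ℂ) • Finsupp.single f 1 := by
  have key : ∀ a, (labelZ n x ^ a) (Finsupp.single f 1) =
      ((∏ b ∈ Finset.range a, x (f (((cyc n)⁻¹ ^ b) (Fin.last n))) : ℂˣ) : ℂ) •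
        Finsupp.single (f ∘ ⇑((cyc n)⁻¹ ^ a)) 1 := by
    intro a
    induction a with
    | zero => simp
    | succ a ih =>
      rw [pow_succ', Module.End.mul_apply, ih, map_smul, labelZ_single, smul_smul,
        ← Units.val_mul, Finset.prod_range_succ, Function.comp_assoc, ← Equiv.Perm.coe_mul,
        ← pow_succ]
      rfl
  -- After $j$ rotations the last place holds the label that began at $n-j$; the product runs
  -- through the labels from right to left.
  have e : ∏ j : Fin (n + 1), x (f (((cyc n)⁻¹ ^ (j : ℕ)) (Fin.last n))) = ∏ j, x (f j) := by
    rw [← Equiv.prod_comp (Fin.revPerm (n := n + 1)) fun j => x (f j)]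
    refine Finset.prod_congr rfl fun j _ => ?_
    rw [cyc_inv_pow_last (by omega)]
    congr 2
    ext
    simp [Fin.val_rev]
  rw [key, inv_pow, cyc_pow, inv_one, Finset.prod_range, e]
  rfl

variable {κ ε : ℂˣ} [LinearOrder Λ] {V : Type*} [AddCommGroup V] [Module ℂ V]

/-- The coefficient of the labelling itself in the action of `T_i`, for labels `a` of `i` and `b`
of `i + 1`. -/
noncomputable def diagCoeff (κ ε : ℂˣ) (a b : Λ) : ℂ :=
  if a < b then 0 else if a = b then (ε : ℂ) else (κ : ℂ) - ((κ⁻¹ : ℂˣ) : ℂ)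

/-- The coefficient of the labelling with the labels `a` and `b` interchanged in the action of
`T_i`. -/
noncomputable def swapCoeff (a b : Λ) : ℂ := if a = b then 0 else 1

/-- For decreasing labels $F(f)$ is itself $T_iF(f\circ s_i)$, so the quadratic relation evaluates
$T_iF(f)$. The definition of a family can therefore omit this case. -/
theorem IsFinLabelFamily.heckeT_apply {ρ : Hecke n κ →ₐ[ℂ] Module.End ℂ V}
    {F : (Fin (n + 1) → Λ) → V} (hF : IsFinLabelFamily ρ ε F) (f : Fin (n + 1) → Λ) (i : Fin n) :
    ρ (heckeT κ i) (F f) = diagCoeff κ ε (f i.castSucc) (f i.succ) • F f +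
      swapCoeff (f i.castSucc) (f i.succ) • F (f ∘ ⇑(simpleRefl i)) := by
  rcases lt_trichotomy (f i.castSucc) (f i.succ) with h | h | h
  · simp [diagCoeff, swapCoeff, h, h.ne, hF.lt f i h]
  · simp [diagCoeff, swapCoeff, h, hF.eq f i h]
  · have h1 := hF.lt (f ∘ ⇑(simpleRefl i)) i (by
      simpa only [Function.comp_apply, simpleRefl_castSucc, simpleRefl_succ] using h)
    rw [comp_simpleRefl_comp_simpleRefl] at h1
    rw [← h1, ← Module.End.mul_apply, ← map_mul, heckeT_mul_self, map_add, map_smul, map_one,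
      LinearMap.add_apply, LinearMap.smul_apply, diagCoeff, swapCoeff, if_neg h.not_gt,
      if_neg h.ne', if_neg h.ne', one_smul]
    rfl

theorem diagCoeff_of_lt {a b : Λ} (h : a < b) : diagCoeff κ ε a b = 0 := if_pos h

theorem diagCoeff_self (a : Λ) : diagCoeff κ ε a a = ε := by simp [diagCoeff]

theorem diagCoeff_of_gt {a b : Λ} (h : b < a) :
    diagCoeff κ ε a b = (κ : ℂ) - ((κ⁻¹ : ℂˣ) : ℂ) := by
  rw [diagCoeff, if_neg h.not_gt, if_neg h.ne']

theorem swapCoeff_self (a : Λ) : swapCoeff a a = 0 := if_pos rfl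

theorem swapCoeff_of_lt {a b : Λ} (h : a < b) : swapCoeff a b = 1 := if_neg h.ne

theorem swapCoeff_of_gt {a b : Λ} (h : b < a) : swapCoeff a b = 1 := if_neg h.ne'

theorem diagCoeff_quad (hε : (ε : ℂ) * ε = ((κ : ℂ) - ((κ⁻¹ : ℂˣ) : ℂ)) * ε + 1) (a b : Λ) :
    diagCoeff κ ε a b * diagCoeff κ ε a b + swapCoeff a b * swapCoeff b a =
      ((κ : ℂ) - ((κ⁻¹ : ℂˣ) : ℂ)) * diagCoeff κ ε a b + 1 := by
  rcases lt_trichotomy a b with h | rfl | h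
  · simp [diagCoeff_of_lt, swapCoeff_of_lt, swapCoeff_of_gt, h]
  · simpa [diagCoeff_self, swapCoeff_self] using hε
  · simp [diagCoeff_of_gt, swapCoeff_of_lt, swapCoeff_of_gt, h]

/-- The factor `swapCoeff` confines the identity to distinct labels, where the two diagonal
coefficients are $0$ and $\kappa-\kappa^{-1}$. For equal labels they add up to $2\epsilon$. -/
theorem diagCoeff_refl (a b : Λ) :
    swapCoeff a b * (diagCoeff κ ε a b + diagCoeff κ ε b a) =
      swapCoeff a b * ((κ : ℂ) - ((κ⁻¹ : ℂˣ) : ℂ)) := by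
  rcases lt_trichotomy a b with h | rfl | h
  · simp [diagCoeff_of_lt, diagCoeff_of_gt, h]
  · simp [swapCoeff_self]
  · simp [diagCoeff_of_lt, diagCoeff_of_gt, h]

/-- These are the coefficients of the labelling itself on both sides of the braid relation, with
labels $a,b,c$ on three consecutive letters. Of the thirteen weak orders of $a,b,c$ only $a=b>c$ and
$a>b=c$ need the quadratic equation for $\epsilon$. -/
theorem diagCoeff_braid_one (hε : (ε : ℂ) * ε = ((κ : ℂ) - ((κ⁻¹ : ℂˣ) : ℂ)) * ε + 1)
    (a b c : Λ) :
    diagCoeff κ ε a b * diagCoeff κ ε b c * diagCoeff κ ε a b +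
      swapCoeff a b * diagCoeff κ ε a c * swapCoeff b a =
    diagCoeff κ ε b c * diagCoeff κ ε a b * diagCoeff κ ε b c +
      swapCoeff b c * diagCoeff κ ε a c * swapCoeff c b := by
  rcases lt_trichotomy a b with h1 | h1 | h1 <;> rcases lt_trichotomy b c with h2 | h2 | h2 <;>
    rcases lt_trichotomy a c with h3 | h3 | h3 <;> try (exfalso; order)
  all_goals
    subst_vars
    simp only [diagCoeff_of_lt, diagCoeff_of_gt, diagCoeff_self, swapCoeff_of_lt, swapCoeff_of_gt,
      swapCoeff_self, *] <;>
    first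
    | ring1
    | linear_combination ((κ : ℂ) - ((κ⁻¹ : ℂˣ) : ℂ)) * hε
    | linear_combination -((κ : ℂ) - ((κ⁻¹ : ℂˣ) : ℂ)) * hε

/-- This is the coefficient of $f\circ s_i$ in the braid relation, and `diagCoeff_braid_right` that
of $f\circ s_j$. The outer factor removes the case where the interchange is trivial. -/
theorem diagCoeff_braid_left (a b c : Λ) :
    swapCoeff a b * (diagCoeff κ ε a b * diagCoeff κ ε b c + diagCoeff κ ε a c * diagCoeff κ ε b a) =
      swapCoeff a b * (diagCoeff κ ε b c * diagCoeff κ ε a c) := by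
  rcases lt_trichotomy a b with h1 | h1 | h1 <;> rcases lt_trichotomy b c with h2 | h2 | h2 <;>
    rcases lt_trichotomy a c with h3 | h3 | h3 <;> try (exfalso; order)
  all_goals
    subst_vars
    simp only [diagCoeff_of_lt, diagCoeff_of_gt, diagCoeff_self, swapCoeff_of_lt, swapCoeff_of_gt,
      swapCoeff_self, *]
    ring1

theorem diagCoeff_braid_right (a b c : Λ) :
    swapCoeff b c * (diagCoeff κ ε b c * diagCoeff κ ε a b + diagCoeff κ ε a c * diagCoeff κ ε c b) =
      swapCoeff b c * (diagCoeff κ ε a b * diagCoeff κ ε a c) := by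
  rcases lt_trichotomy a b with h1 | h1 | h1 <;> rcases lt_trichotomy b c with h2 | h2 | h2 <;>
    rcases lt_trichotomy a c with h3 | h3 | h3 <;> try (exfalso; order)
  all_goals
    subst_vars
    simp only [diagCoeff_of_lt, diagCoeff_of_gt, diagCoeff_self, swapCoeff_of_lt, swapCoeff_of_gt,
      swapCoeff_self, *]
    ring1

/-- The operator `T_i` on the space spanned by the labellings. -/
noncomputable def labelT (κ ε : ℂˣ) (Λ : Type*) [LinearOrder Λ] (i : Fin n) :
    Module.End ℂ ((Fin (n + 1) → Λ) →₀ ℂ) :=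
  Finsupp.linearCombination ℂ fun f =>
    diagCoeff κ ε (f i.castSucc) (f i.succ) • Finsupp.single f (1 : ℂ) +
      swapCoeff (f i.castSucc) (f i.succ) • Finsupp.single (f ∘ ⇑(simpleRefl i)) (1 : ℂ)

theorem labelT_single (f : Fin (n + 1) → Λ) (i : Fin n) :
    labelT κ ε Λ i (Finsupp.single f 1) =
    diagCoeff κ ε (f i.castSucc) (f i.succ) • Finsupp.single f (1 : ℂ) +
      swapCoeff (f i.castSucc) (f i.succ) • Finsupp.single (f ∘ ⇑(simpleRefl i)) (1 : ℂ) := by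
  rw [labelT, Finsupp.linearCombination_single, one_smul]

theorem labelT_quad (hε : (ε : ℂ) * ε = ((κ : ℂ) - ((κ⁻¹ : ℂˣ) : ℂ)) * ε + 1) (i : Fin n) :
    labelT κ ε Λ i * labelT κ ε Λ i =
      ((κ : ℂ) - ((κ⁻¹ : ℂˣ) : ℂ)) • labelT κ ε Λ i + 1 := by
  refine labelEnd_ext fun f => ?_
  have e1 := diagCoeff_quad hε (f i.castSucc) (f i.succ)
  have e2 := diagCoeff_refl (κ := κ) (ε := ε) (f i.castSucc) (f i.succ)
  simp only [Module.End.mul_apply, LinearMap.add_apply, LinearMap.smul_apply, labelT_single,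
    map_add, map_smul, Function.comp_apply, simpleRefl_castSucc, simpleRefl_succ,
    comp_simpleRefl_comp_simpleRefl, Module.End.one_apply]
  linear_combination (norm := module) e1 • Finsupp.single f (1 : ℂ) +
    e2 • Finsupp.single (f ∘ ⇑(simpleRefl i)) (1 : ℂ)

theorem labelT_braid (hε : (ε : ℂ) * ε = ((κ : ℂ) - ((κ⁻¹ : ℂˣ) : ℂ)) * ε + 1) (i j : Fin n)
    (h : (i : ℕ) + 1 = j) :
    labelT κ ε Λ i * labelT κ ε Λ j * labelT κ ε Λ i =
      labelT κ ε Λ j * labelT κ ε Λ i * labelT κ ε Λ j := by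
  have hij : i.succ = j.castSucc := Fin.ext h
  have s1 : simpleRefl i i.castSucc = j.castSucc := by rw [simpleRefl_castSucc, hij]
  have s2 : simpleRefl i j.castSucc = i.castSucc := by rw [← hij, simpleRefl_succ]
  have s3 : simpleRefl i j.succ = j.succ :=
    simpleRefl_of_ne _ _ (by rw [Fin.val_succ]; omega) (by rw [Fin.val_succ]; omega)
  have s4 : simpleRefl j i.castSucc = i.castSucc :=
    simpleRefl_of_ne _ _ (by rw [Fin.val_castSucc]; omega) (by rw [Fin.val_castSucc]; omega)
  have s5 : simpleRefl j j.castSucc = j.succ := simpleRefl_castSucc j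
  have s6 : simpleRefl j j.succ = j.castSucc := simpleRefl_succ j
  refine labelEnd_ext fun f => ?_
  have e1 := diagCoeff_braid_one hε (f i.castSucc) (f j.castSucc) (f j.succ)
  have e2 := diagCoeff_braid_left (κ := κ) (ε := ε) (f i.castSucc) (f j.castSucc) (f j.succ)
  have e3 := diagCoeff_braid_right (κ := κ) (ε := ε) (f i.castSucc) (f j.castSucc) (f j.succ)
  have hb : ((f ∘ ⇑(simpleRefl i)) ∘ ⇑(simpleRefl j)) ∘ ⇑(simpleRefl i) =
      ((f ∘ ⇑(simpleRefl j)) ∘ ⇑(simpleRefl i)) ∘ ⇑(simpleRefl j) := by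
    simp only [Function.comp_assoc, ← Equiv.Perm.coe_mul, simpleRefl_braid i j h]
  simp only [Module.End.mul_apply, labelT_single, hij, map_add, map_smul, Function.comp_apply,
    s1, s2, s3, s4, s5, s6, comp_simpleRefl_comp_simpleRefl, hb]
  linear_combination (norm := module) e1 • Finsupp.single f (1 : ℂ) +
    e2 • Finsupp.single (f ∘ ⇑(simpleRefl i)) (1 : ℂ) -
    e3 • Finsupp.single (f ∘ ⇑(simpleRefl j)) (1 : ℂ)

theorem labelT_comm (i j : Fin n) (h : (i : ℕ) + 1 < j) :
    labelT κ ε Λ i * labelT κ ε Λ j = labelT κ ε Λ j * labelT κ ε Λ i := by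
  have s1 : simpleRefl i j.castSucc = j.castSucc :=
    simpleRefl_of_ne _ _ (by rw [Fin.val_castSucc]; omega) (by rw [Fin.val_castSucc]; omega)
  have s2 : simpleRefl i j.succ = j.succ :=
    simpleRefl_of_ne _ _ (by rw [Fin.val_succ]; omega) (by rw [Fin.val_succ]; omega)
  have s3 : simpleRefl j i.castSucc = i.castSucc :=
    simpleRefl_of_ne _ _ (by rw [Fin.val_castSucc]; omega) (by rw [Fin.val_castSucc]; omega)
  have s4 : simpleRefl j i.succ = i.succ :=
    simpleRefl_of_ne _ _ (by rw [Fin.val_succ]; omega) (by rw [Fin.val_succ]; omega)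
  refine labelEnd_ext fun f => ?_
  have hb : (f ∘ ⇑(simpleRefl i)) ∘ ⇑(simpleRefl j) = (f ∘ ⇑(simpleRefl j)) ∘ ⇑(simpleRefl i) := by
    simp only [Function.comp_assoc, ← Equiv.Perm.coe_mul, simpleRefl_comm i j h]
  simp only [Module.End.mul_apply, labelT_single, map_add, map_smul, Function.comp_apply,
    s1, s2, s3, s4, hb]
  module

theorem labelZ_mul_labelT (x : Λ → ℂˣ) (i j : Fin n) (h : (i : ℕ) + 1 = j) :
    labelZ n x * labelT κ ε Λ i = labelT κ ε Λ j * labelZ n x := by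
  have hij : i.succ = j.castSucc := Fin.ext h
  refine labelEnd_ext fun f => ?_
  have h1 : simpleRefl i (Fin.last n) = Fin.last n :=
    simpleRefl_of_ne _ _ (by rw [Fin.val_last]; omega) (by rw [Fin.val_last]; omega)
  have h2 : (f ∘ ⇑(cyc n)⁻¹) ∘ ⇑(simpleRefl j) = (f ∘ ⇑(simpleRefl i)) ∘ ⇑(cyc n)⁻¹ := by
    simp only [Function.comp_assoc, ← Equiv.Perm.coe_mul]
    congr 2
    rw [inv_mul_eq_iff_eq_mul, ← mul_assoc, cyc_simpleRefl i j h]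
    group
  simp only [Module.End.mul_apply, labelT_single, labelZ_single, map_add, map_smul, h2,
    Function.comp_apply, h1, ← hij, cyc_inv_succ]
  module

/-- The representation of the Hecke algebra on the space spanned by the labellings. -/
theorem exists_labelRep (hε : (ε : ℂ) * ε = ((κ : ℂ) - ((κ⁻¹ : ℂˣ) : ℂ)) * ε + 1)
    (x : Λ → ℂˣ) :
    ∃ ρ : Hecke n κ →ₐ[ℂ] Module.End ℂ ((Fin (n + 1) → Λ) →₀ ℂ),
      IsLabelFamily ρ ε x fun f => Finsupp.single f 1 := by
  obtain ⟨ρ, hT, hZ⟩ := exists_heckeLift (labelT κ ε Λ) (labelZ n x) (labelZi n x)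
    (labelT_quad hε) (labelT_braid hε) labelT_comm (labelZ_mul_labelZi x) (labelZi_mul_labelZ x)
    (labelZ_mul_labelT x) fun i => labelEnd_ext fun f => by
      have : ∏ j, x (f (simpleRefl i j)) = ∏ j, x (f j) :=
        Equiv.prod_comp (simpleRefl i) fun j => x (f j)
      simp only [Module.End.mul_apply, labelZ_pow_single, labelT_single, map_add, map_smul,
        Function.comp_apply, this]
      module
  refine ⟨ρ, ⟨fun f i h => ?_, fun f i h => ?_⟩, fun f => ?_⟩
  · rw [hT, labelT_single, diagCoeff_of_lt h, swapCoeff_of_lt h, zero_smul, zero_add, one_smul]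
  · rw [hT, labelT_single, h, diagCoeff_self, swapCoeff_self, zero_smul, add_zero]
  · rw [hZ, labelZ_single]

end LabelModule

/-! ### The universal property of label families -/

section Universal

variable {n : ℕ} {κ ε : ℂˣ}

theorem val_upperCyc (j a : Fin (n + 1)) : (upperCyc j a : ℕ) =
    if (a : ℕ) < j then (a : ℕ) else if (a : ℕ) = n then (j : ℕ) else a + 1 := by
  induction j using Fin.reverseInduction generalizing a with
  | last =>
    rw [upperCyc_last, Fin.val_last]
    have := a.2
    simp only [Equiv.Perm.coe_one, id_eq]
    split_ifs <;> omega
  | cast i ih =>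
    rw [upperCyc_castSucc, Equiv.Perm.mul_apply, val_simpleRefl, ih, Fin.val_succ,
      Fin.val_castSucc]
    have := i.2
    split_ifs <;> omega

/-- The right-hand factor of $Y_j$ is thereby a basis element $T_w$, and for this $w$ the product
$T_\zeta T_w$ is $Y_j$ up to the invertible factor `lowerT`. -/
theorem heckeTw_upperCyc_inv (j : Fin (n + 1)) :
    heckeTw κ (upperCyc j)⁻¹ = (upperT κ j : Hecke n κ) := by
  induction j using Fin.reverseInduction with
  | last => rw [upperCyc_last, upperT_last, inv_one, heckeTw_one]; rfl
  | cast i ih =>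
    have h1 : (upperCyc i.succ)⁻¹ i.castSucc = i.castSucc := by
      rw [Equiv.Perm.inv_eq_iff_eq, Fin.ext_iff, val_upperCyc, if_pos]
      simp
    have h2 : (upperCyc i.succ)⁻¹ i.succ = Fin.last n := by
      rw [Equiv.Perm.inv_eq_iff_eq, upperCyc_apply_last]
    rw [upperT_castSucc, Units.val_mul, ← ih, upperCyc_castSucc, inv_simpleRefl_mul,
      ← heckeTw_mul_heckeT _ _ (by rw [h1, h2]; exact Fin.castSucc_lt_last _)]
    rfl

/-- A permutation whose inverse is increasing on all letters but the last is a cycle. -/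
theorem eq_upperCyc_inv (w : Equiv.Perm (Fin (n + 1)))
    (h : ∀ i j : Fin n, (i : ℕ) + 1 = j → w⁻¹ i.castSucc < w⁻¹ i.succ) :
    w = (upperCyc (w⁻¹ (Fin.last n)))⁻¹ := by
  set j := w⁻¹ (Fin.last n) with hj
  have hmono : ∀ v : Equiv.Perm (Fin (n + 1)),
      (∀ i j : Fin n, (i : ℕ) + 1 = j → v i.castSucc < v i.succ) →
        StrictMono fun i : Fin n => v i.castSucc := by
    intro v hv
    rcases n with _ | n
    · exact fun a => a.elim0
    · exact Fin.strictMono_iff_lt_succ.mpr fun i => hv i.castSucc i.succ (by simp)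
  have hrange : ∀ v : Equiv.Perm (Fin (n + 1)), v (Fin.last n) = j →
      Set.range (fun i : Fin n => v i.castSucc) = {j}ᶜ := by
    intro v hv
    ext a
    rw [Set.mem_range, Set.mem_compl_singleton_iff, ← hv]
    constructor
    · rintro ⟨i, rfl⟩ e
      exact (Fin.castSucc_lt_last i).ne (v.injective e)
    · intro ha
      obtain ⟨i, hi⟩ := Fin.exists_castSucc_eq.mpr
        (show v⁻¹ a ≠ Fin.last n from fun e => ha (by rw [← e, perm_apply_inv]))
      exact ⟨i, by rw [hi, perm_apply_inv]⟩
  have hc : ∀ i l : Fin n, (i : ℕ) + 1 = l → upperCyc j i.castSucc < upperCyc j i.succ := by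
    intro i l hil
    rw [Fin.lt_def, val_upperCyc, val_upperCyc, Fin.val_succ, Fin.val_castSucc]
    have := l.2
    split_ifs <;> omega
  -- Both $w^{-1}$ and `upperCyc j` send the last letter to $j$ and are increasing on the other
  -- letters. An increasing map is determined by its range, here the complement of $j$.
  have key := (StrictMono.range_inj (hmono _ h) (hmono _ hc)).mp
    ((hrange _ hj.symm).trans (hrange _ (upperCyc_apply_last j)).symm)
  rw [eq_inv_iff_mul_eq_one, ← inv_eq_iff_mul_eq_one]
  ext1 a
  refine Fin.lastCases ?_ (fun i => ?_) a
  · rw [upperCyc_apply_last]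
  · exact congrFun key i

variable {Λ : Type*} [LinearOrder Λ] {V : Type*} [AddCommGroup V] [Module ℂ V]
  {I : Set (Fin n)} {f₀ : Fin (n + 1) → Λ}

/-- Put $F(f_0\circ w^{-1})=T_w\varphi$, and $F=0$ off the orbit. If the labels at $i,i+1$ increase,
$s_iw$ is minimal and longer, so $T_iT_w=T_{s_iw}$. If they agree, $s_iw=ws_j$ with $j\in I$, and
$T_iT_w=T_wT_j$ acts on $\varphi$ with the factor $\epsilon$. -/
theorem exists_finLabelFamily (hf : IsBlockLabel I f₀) (ρ : Hecke n κ →ₐ[ℂ] Module.End ℂ V)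
    (φ : V) (hφ : ∀ i ∈ I, ρ (heckeT κ i) φ = (ε : ℂ) • φ) :
    ∃ F : (Fin (n + 1) → Λ) → V, IsFinLabelFamily ρ ε F ∧
      (∀ w ∈ minCosetReps I, F (f₀ ∘ ⇑w⁻¹) = ρ (heckeTw κ w) φ) ∧
      ∀ f, (¬ ∃ w ∈ minCosetReps I, f₀ ∘ ⇑w⁻¹ = f) → F f = 0 := by
  classical
  let F : (Fin (n + 1) → Λ) → V := fun f =>
    if h : ∃ w ∈ minCosetReps I, f₀ ∘ ⇑w⁻¹ = f then ρ (heckeTw κ h.choose) φ else 0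
  have hF : ∀ w ∈ minCosetReps I, F (f₀ ∘ ⇑w⁻¹) = ρ (heckeTw κ w) φ := by
    intro w hw
    have h : ∃ v ∈ minCosetReps I, f₀ ∘ ⇑v⁻¹ = f₀ ∘ ⇑w⁻¹ := ⟨w, hw, rfl⟩
    have := hf.inj h.choose_spec.1 hw h.choose_spec.2
    simp only [F, dif_pos h, this]
  have hF0 : ∀ f, (¬ ∃ w ∈ minCosetReps I, f₀ ∘ ⇑w⁻¹ = f) → F f = 0 := fun f h => dif_neg h
  have horb : ∀ f i, (∃ w ∈ minCosetReps I, f₀ ∘ ⇑w⁻¹ = f ∘ ⇑(simpleRefl i)) →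
      ∃ w ∈ minCosetReps I, f₀ ∘ ⇑w⁻¹ = f := by
    rintro f i ⟨w, -, hw⟩
    refine ⟨minCosetRep I (simpleRefl i * w), minCosetRep_mem _, ?_⟩
    rw [hf.minCosetRep_comp, comp_mul_simpleRefl, hw, comp_simpleRefl_comp_simpleRefl]
  refine ⟨F, ⟨fun f i h => ?_, fun f i h => ?_⟩, hF, hF0⟩
  · by_cases hex : ∃ w ∈ minCosetReps I, f₀ ∘ ⇑w⁻¹ = f
    · obtain ⟨w, hw, rfl⟩ := hex
      rw [hF w hw, ← Module.End.mul_apply, ← map_mul, heckeT_mul_heckeTw w i (hf.inv_lt_of_lt h),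
        ← comp_mul_simpleRefl, hF _ (hf.simpleRefl_mul_mem_of_lt hw h)]
    · rw [hF0 f hex, hF0 _ fun h => hex (horb f i h), map_zero]
  · by_cases hex : ∃ w ∈ minCosetReps I, f₀ ∘ ⇑w⁻¹ = f
    · obtain ⟨w, hw, rfl⟩ := hex
      obtain ⟨j, hj, h1, h2⟩ := hf.consecutive hw h
      rw [hF w hw, ← Module.End.mul_apply, ← map_mul, heckeT_mul_heckeTw,
        ← conj_simpleRefl w j i h1 h2, ← heckeTw_mul_heckeT, map_mul, Module.End.mul_apply, hφ j hj,
        map_smul]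
      · exact mem_minCosetReps_iff.mp hw j hj
      · rw [← h1, ← h2, perm_inv_apply, perm_inv_apply]; exact Fin.castSucc_lt_succ
    · rw [hF0 f hex, map_zero, smul_zero]

theorem map_inv_comm_of_comm {W : Type*} [AddCommGroup W] [Module ℂ W]
    {ρ : Hecke n κ →ₐ[ℂ] Module.End ℂ V} {ρ' : Hecke n κ →ₐ[ℂ] Module.End ℂ W} (A : W →ₗ[ℂ] V)
    (u : (Hecke n κ)ˣ) (h : ∀ v, A (ρ' u v) = ρ u (A v)) (v : W) :
    A (ρ' ((u⁻¹ : (Hecke n κ)ˣ) : Hecke n κ) v) = ρ ((u⁻¹ : (Hecke n κ)ˣ) : Hecke n κ) (A v) := by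
  have h1 := h (ρ' ((u⁻¹ : (Hecke n κ)ˣ) : Hecke n κ) v)
  rw [← Module.End.mul_apply, ← map_mul, Units.mul_inv, map_one, Module.End.one_apply] at h1
  rw [h1, ← Module.End.mul_apply, ← map_mul, Units.inv_mul, map_one, Module.End.one_apply]

/-- A vector on which `T_i`, `i ∈ I`, and `Y_j` act by the appropriate scalars generates a family
of vectors indexed by the labellings. -/
theorem exists_labelFamily (hε : (ε : ℂ) * ε = ((κ : ℂ) - ((κ⁻¹ : ℂˣ) : ℂ)) * ε + 1)
    (hf : IsBlockLabel I f₀) (x : Λ → ℂˣ) (ρ : Hecke n κ →ₐ[ℂ] Module.End ℂ V) (φ : V)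
    (hφ : ∀ i ∈ I, ρ (heckeT κ i) φ = (ε : ℂ) • φ)
    (hY : ∀ j, ρ (unitY κ j : Hecke n κ) φ = (labelWeight ε x f₀ j : ℂ) • φ) :
    ∃ F : (Fin (n + 1) → Λ) → V, IsLabelFamily ρ ε x F ∧ F f₀ = φ := by
  obtain ⟨F, hF, hw, hF0⟩ := exists_finLabelFamily hf ρ φ hφ
  obtain ⟨ρ', hρ'⟩ := exists_labelRep (n := n) hε x
  set e : (Fin (n + 1) → Λ) → ((Fin (n + 1) → Λ) →₀ ℂ) := fun f => Finsupp.single f 1 with he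
  -- The map $A$ compares the formal representation with $V$. It intertwines the $T_i$, because both
  -- families have the same coefficients. The compatibility with $T_\zeta$ is deduced from the
  -- eigenvalues of the $Y_j$, which agree on the two sides.
  let A : ((Fin (n + 1) → Λ) →₀ ℂ) →ₗ[ℂ] V := Finsupp.linearCombination ℂ F
  have hA : ∀ f, A (e f) = F f := fun f => by
    simp only [A, he, Finsupp.linearCombination_single, one_smul]
  have hφ0 : F f₀ = φ := by
    have := hw 1 one_mem_minCosetReps
    rw [heckeTw_one, map_one] at this
    exact this
  have hT : ∀ i v, A (ρ' (heckeT κ i) v) = ρ (heckeT κ i) (A v) := by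
    intro i v
    have : A ∘ₗ ρ' (heckeT κ i) = ρ (heckeT κ i) ∘ₗ A := by
      refine labelEnd_ext fun f => ?_
      change A (ρ' (heckeT κ i) (e f)) = ρ (heckeT κ i) (A (e f))
      rw [hρ'.heckeT_apply, map_add, map_smul, map_smul, hA, hA, hF.heckeT_apply]
    exact LinearMap.congr_fun this v
  have hTl : ∀ (l : List (Fin n)) v,
      A (ρ' (l.map (heckeT κ)).prod v) = ρ (l.map (heckeT κ)).prod (A v) := by
    intro l
    induction l with
    | nil => intro v; simp
    | cons i l ih =>
      intro v
      simp only [List.map_cons, List.prod_cons, map_mul, Module.End.mul_apply, hT, ih]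
  have hlow : ∀ (j : Fin (n + 1)) v, A (ρ' (lowerT κ j : Hecke n κ) v) = ρ (lowerT κ j : Hecke n κ) (A v) := by
    intro j
    induction j using Fin.induction with
    | zero => intro v; rw [lowerT_zero, Units.val_one, map_one, map_one]; rfl
    | succ i ih =>
      intro v
      simp only [lowerT_succ, Units.val_mul, map_mul, Module.End.mul_apply]
      rw [map_inv_comm_of_comm A (unitT κ i) (hT i), ih]
  -- The definition of $Y_j$ is solved for $T_\zeta T_{m-1}\cdots T_j$: apart from $Y_j$, only
  -- elements of the finite Hecke algebra remain.
  have hup : ∀ j : Fin (n + 1), (heckeZ n κ * upperT κ j : Hecke n κ) =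
      ((lowerT κ j)⁻¹ : (Hecke n κ)ˣ) * (unitY κ j : Hecke n κ) := by
    intro j
    rw [unitY_eq, ← Units.val_mul, ← mul_assoc, ← mul_assoc, inv_mul_cancel, one_mul, Units.val_mul]
    rfl
  -- The induction is on the length of $w$. A left descent $i<m-1$ is pulled out as $T_\zeta
  -- T_i=T_{i+1}T_\zeta$. If there is none, $w^{-1}$ is a cycle $s_j\cdots s_{m-1}$, and `hup`
  -- reduces the claim to $Y_j$, which acts on both vectors by the same scalar.
  have hZ : ∀ w, A (ρ' (heckeZ n κ * heckeTw κ w) (e f₀)) =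
      ρ (heckeZ n κ * heckeTw κ w) φ := by
    intro w
    induction hN : len w using Nat.strong_induction_on generalizing w with
    | _ N ih =>
    by_cases hd : ∀ i j : Fin n, (i : ℕ) + 1 = j → w⁻¹ i.castSucc < w⁻¹ i.succ
    · rw [eq_upperCyc_inv w hd, heckeTw_upperCyc_inv, hup, map_mul, map_mul, Module.End.mul_apply,
        Module.End.mul_apply, hY, hρ'.unitY_apply hf.mono, map_smul, map_smul, map_smul,
        map_inv_comm_of_comm A _ (hlow _), hA, hφ0]
    · push Not at hd
      obtain ⟨i, j, hij, hi⟩ := hd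
      have hi' : w⁻¹ i.succ < w⁻¹ i.castSucc :=
        (perm_castSucc_lt_or_lt w⁻¹ i).resolve_left (not_lt.mpr hi)
      have hlen := len_simpleRefl_mul w i hi'
      have hTw : heckeTw κ w = heckeT κ i * heckeTw κ (simpleRefl i * w) := by
        rw [heckeT_mul_heckeTw, simpleRefl_mul_cancel]
        rwa [inv_simpleRefl_mul, Equiv.Perm.mul_apply, Equiv.Perm.mul_apply, simpleRefl_castSucc,
          simpleRefl_succ]
      have := ih _ (by omega) (simpleRefl i * w) rfl
      rw [hTw, ← mul_assoc, heckeZ_mul_heckeT i j hij, mul_assoc, map_mul ρ', map_mul ρ,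
        Module.End.mul_apply, Module.End.mul_apply, hT, this]
  refine ⟨F, ⟨hF, fun f => ?_⟩, hφ0⟩
  have horb : (∃ w ∈ minCosetReps I, f₀ ∘ ⇑w⁻¹ = f ∘ ⇑(cyc n)⁻¹) →
      ∃ w ∈ minCosetReps I, f₀ ∘ ⇑w⁻¹ = f := by
    rintro ⟨w, -, hw⟩
    refine ⟨minCosetRep I ((cyc n)⁻¹ * w), minCosetRep_mem _, ?_⟩
    rw [hf.minCosetRep_comp, mul_inv_rev, inv_inv, Equiv.Perm.coe_mul, ← Function.comp_assoc, hw,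
      comp_cyc_inv_cyc]
  by_cases hex : ∃ w ∈ minCosetReps I, f₀ ∘ ⇑w⁻¹ = f
  · obtain ⟨w, hwI, rfl⟩ := hex
    rw [hw w hwI, ← Module.End.mul_apply, ← map_mul, ← hZ, map_mul, Module.End.mul_apply,
      hρ'.heckeTw_apply hf hwI, hρ'.zeta, map_smul, hA]
  · rw [hF0 f hex, hF0 _ fun h => hex (horb h), map_zero, smul_zero]

end Universal

/-! ### The scalars $\pm\kappa^{\pm1}$ as units -/

section Signs

/-- The unit `± κ^{± 1}`. -/
noncomputable def signUnit (s : ℤˣ) (κ : ℂˣ) : ℂˣ :=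
  Units.map (Int.castRingHom ℂ).toMonoidHom s * κ ^ (s : ℤ)

theorem coe_signUnit (s : ℤˣ) (κ : ℂˣ) : (signUnit s κ : ℂ) = signPow s κ := rfl

theorem signUnit_inv (s : ℤˣ) (κ : ℂˣ) : signUnit s κ⁻¹ = (signUnit s κ)⁻¹ := by
  rw [signUnit, signUnit, mul_inv, inv_zpow, ← map_inv, Int.units_inv_eq_self]

theorem signUnit_quad (s : ℤˣ) (κ : ℂˣ) : (signUnit s κ : ℂ) * signUnit s κ =
    ((κ : ℂ) - ((κ⁻¹ : ℂˣ) : ℂ)) * signUnit s κ + 1 := signPow_quad s κ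

theorem signUnit_mul_self (s : ℤˣ) (κ : ℂˣ) :
    signUnit s κ * signUnit s κ = κ ^ (2 * (s : ℤ)) := by
  rw [signUnit, mul_mul_mul_comm, ← map_mul, Int.units_mul_self, map_one, one_mul, ← zpow_add,
    two_mul]

end Signs

/-! ### Prescribing the weight, and the action of $f(Y)$ on eigenvectors -/

section Weights

variable {n : ℕ} {κ : ℂˣ} {Λ : Type*} [LinearOrder Λ] {I : Set (Fin n)} {f₀ : Fin (n + 1) → Λ}

/-- Solving for $x$ prescribes a value $c_j$ at the label of each letter $j$, so $c$ has to be
constant on blocks. From $i$ to $i+1$ within a block the upper product loses a factor $\epsilon$ and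
the lower one gains it, which the ratio $\epsilon^2$ in $\gamma$ compensates. -/
theorem exists_labelWeight_eq (ε : ℂˣ) (hf : IsBlockLabel I f₀) (γ : Fin (n + 1) → ℂˣ)
    (hγ : ∀ i ∈ I, γ i.castSucc / γ i.succ = ε * ε) :
    ∃ x : Λ → ℂˣ, labelWeight ε x f₀ = γ := by
  classical
  set c : Fin (n + 1) → ℂˣ := fun j => (upperProd ε f₀ j)⁻¹ * γ j * lowerProd ε f₀ j with hc
  have hstep : ∀ i ∈ I, c i.castSucc = c i.succ := by
    intro i hi
    have he := (hf.eq_iff i).mpr hi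
    have h1 := upperProd_castSucc ε f₀ i
    have h2 := lowerProd_succ ε f₀ i
    rw [if_pos he, comp_simpleRefl_of_eq he] at h1 h2
    simp only [hc, h1, h2, div_eq_iff_eq_mul.mp (hγ i hi), mul_inv]
    calc _ = (ε⁻¹ * ε) * ((upperProd ε f₀ i.succ)⁻¹ * γ i.succ *
          (ε * lowerProd ε f₀ i.castSucc)) := by
          simp only [mul_assoc, mul_comm, mul_left_comm]
      _ = _ := by rw [inv_mul_cancel, one_mul]
  have hle : ∀ a b, a ≤ b → f₀ a = f₀ b → c a = c b := by
    intro a b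
    induction b using Fin.induction with
    | zero => intro h _; rw [Fin.le_zero_iff.mp h]
    | succ i ih =>
      intro hab h
      rcases hab.eq_or_lt with rfl | hlt
      · rfl
      · have hai : a ≤ i.castSucc := Fin.le_castSucc_iff.mpr hlt
        have h3 : f₀ i.castSucc = f₀ i.succ :=
          le_antisymm (hf.mono Fin.castSucc_lt_succ.le) (h ▸ hf.mono hai)
        rw [ih hai (h.trans h3.symm), hstep i ((hf.eq_iff i).mp h3)]
  have heq : ∀ a b, f₀ a = f₀ b → c a = c b := fun a b h =>
    (le_total a b).elim (fun hab => hle a b hab h) fun hab => (hle b a hab h.symm).symm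
  -- Labels that `f₀` does not take may receive any unit.
  refine ⟨fun l => if h : ∃ j, f₀ j = l then c h.choose else 1, funext fun j => ?_⟩
  have h : ∃ a, f₀ a = f₀ j := ⟨j, rfl⟩
  rw [labelWeight, dif_pos h, heq _ _ h.choose_spec]
  simp only [hc]
  group

variable {V : Type*} [AddCommGroup V] [Module ℂ V] {ρ : Hecke n κ →ₐ[ℂ] Module.End ℂ V} {φ : V}
  {t : Fin (n + 1) → ℂˣ}

theorem map_zpow_apply_of_eq {u : (Hecke n κ)ˣ} {a : ℂˣ}
    (h : ρ u φ = (a : ℂ) • φ) (z : ℤ) :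
    ρ ((u ^ z : (Hecke n κ)ˣ) : Hecke n κ) φ = ((a ^ z : ℂˣ) : ℂ) • φ := by
  have hi := map_inv_apply_of_eq ρ u h
  induction z with
  | zero => simp
  | succ z ih =>
    rw [zpow_add_one, zpow_add_one, Units.val_mul, map_mul, Module.End.mul_apply, h, map_smul, ih,
      smul_smul, Units.val_mul, mul_comm]
  | pred z ih =>
    rw [zpow_sub_one, zpow_sub_one, Units.val_mul, map_mul, Module.End.mul_apply, hi, map_smul, ih,
      smul_smul, Units.val_mul, mul_comm]

theorem powY_apply (h : ∀ j, ρ (unitY κ j : Hecke n κ) φ = (t j : ℂ) • φ)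
    (μ : Fin (n + 1) → ℤ) : ρ (powY κ μ) φ = ((∏ j, t j ^ μ j : ℂˣ) : ℂ) • φ := by
  rw [powY, Fin.prod_univ_def]
  induction List.finRange (n + 1) with
  | nil => simp
  | cons j l ih =>
    rw [List.map_cons, List.prod_cons, Units.val_mul, map_mul, Module.End.mul_apply, ih, map_smul,
      map_zpow_apply_of_eq (h j), smul_smul, List.map_cons, List.prod_cons, Units.val_mul, mul_comm]

theorem evalY_apply (h : ∀ j, ρ (unitY κ j : Hecke n κ) φ = (t j : ℂ) • φ) (f : Laurent n) :
    ρ (evalY κ f) φ = evalT t f • φ := by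
  rw [evalY, evalT, Finsupp.sum, Finsupp.sum, map_sum, LinearMap.sum_apply, Finset.sum_smul]
  refine Finset.sum_congr rfl fun μ _ => ?_
  rw [map_smul, LinearMap.smul_apply, powY_apply h, smul_smul]

theorem powY_single (j : Fin (n + 1)) : powY κ (Pi.single j 1) = (unitY κ j : Hecke n κ) := by
  rw [powY]
  congr 1
  have : ∀ l : List (Fin (n + 1)), l.Nodup →
      (l.map fun a => unitY κ a ^ (Pi.single j 1 : Fin (n + 1) → ℤ) a).prod =
        if j ∈ l then unitY κ j else 1 := by
    intro l
    induction l with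
    | nil => intro _; simp
    | cons a l ih =>
      intro hl
      rw [List.nodup_cons] at hl
      rw [List.map_cons, List.prod_cons, ih hl.2]
      by_cases ha : j = a
      · subst ha; simp [hl.1]
      · simp [ha]
  rw [this _ (List.nodup_finRange _), if_pos (List.mem_finRange j)]

theorem evalY_single (j : Fin (n + 1)) :
    evalY κ (AddMonoidAlgebra.single (Pi.single j 1) 1) = (unitY κ j : Hecke n κ) := by
  rw [evalY, AddMonoidAlgebra.coeff_single, Finsupp.sum_single_index (by simp), one_smul,
    powY_single]

theorem evalT_single (t : Fin (n + 1) → ℂˣ) (j : Fin (n + 1)) :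
    evalT t (AddMonoidAlgebra.single (Pi.single j 1) 1) = (t j : ℂ) := by
  rw [evalT, AddMonoidAlgebra.coeff_single, Finsupp.sum_single_index (by simp), one_mul]
  congr 1
  rw [Finset.prod_eq_single j (fun b _ hb => by rw [Pi.single_eq_of_ne hb, zpow_zero])
    (fun h => absurd (Finset.mem_univ j) h), Pi.single_eq_same, zpow_one]

/-- The Hecke algebra is generated by `T_i` and `T_ζ^{± 1}`. -/
theorem hecke_induction (S : Subalgebra ℂ (Hecke n κ)) (hT : ∀ i, heckeT κ i ∈ S)
    (hZ : heckeZ n κ ∈ S) (hZi : heckeZi n κ ∈ S) (h : Hecke n κ) : h ∈ S := by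
  obtain ⟨y, rfl⟩ := RingQuot.mkAlgHom_surjective ℂ (HeckeRel n κ) h
  change heckeMk n κ y ∈ S
  induction y using FreeAlgebra.induction with
  | grade0 c => rw [AlgHom.commutes]; exact S.algebraMap_mem c
  | grade1 g =>
    rcases g with i | _ | _
    · exact hT i
    · exact hZ
    · exact hZi
  | mul a b ha hb => rw [map_mul]; exact S.mul_mem ha hb
  | add a b ha hb => rw [map_add]; exact S.add_mem ha hb

end Weights

/-! ### The character $\chi$ and the basis of the induced module -/

section Principal

variable {n : ℕ} {k : ℂˣ} {s : ℤˣ} {I : Set (Fin n)} {γ : Fin (n + 1) → ℂˣ}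
  {V : Type*} [AddCommGroup V] [Module ℂ V] {ρ : Hecke n k →ₐ[ℂ] Module.End ℂ V} {v : V}

theorem isPrincipalChar_apply {χ : affParabolic k I →ₐ[ℂ] ℂ} (hχ : IsPrincipalChar s k I γ χ)
    (hT : ∀ i ∈ I, ρ (heckeT k i) v = (signUnit s k : ℂ) • v)
    (hY : ∀ j, ρ (unitY k j : Hecke n k) v = (γ j : ℂ) • v) (a : affParabolic k I) :
    ρ a v = χ a • v := by
  obtain ⟨a, ha⟩ := a
  change ρ a v = χ ⟨a, ha⟩ • v
  induction ha using Algebra.adjoin_induction with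
  | mem x hx =>
    rcases hx with ⟨i, hi, rfl⟩ | ⟨f, rfl⟩
    · exact (hT i hi).trans (congrArg (· • v) (hχ.1 i hi).symm)
    · exact (evalY_apply hY f).trans (congrArg (· • v) (hχ.2 f).symm)
  | algebraMap c =>
    have : χ ⟨algebraMap ℂ (Hecke n k) c, Subalgebra.algebraMap_mem _ c⟩ = c := χ.commutes c
    rw [this, AlgHom.commutes]
    rfl
  | add x y hx hy ihx ihy =>
    have : χ ⟨x + y, add_mem hx hy⟩ = χ ⟨x, hx⟩ + χ ⟨y, hy⟩ := map_add χ ⟨x, hx⟩ ⟨y, hy⟩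
    rw [this, map_add, LinearMap.add_apply, ihx, ihy, add_smul]
  | mul x y hx hy ihx ihy =>
    have : χ ⟨x * y, mul_mem hx hy⟩ = χ ⟨x, hx⟩ * χ ⟨y, hy⟩ := map_mul χ ⟨x, hx⟩ ⟨y, hy⟩
    rw [this, map_mul, Module.End.mul_apply, ihy, map_smul, ihx, smul_smul, mul_comm]

/-- A common eigenvector of the generators spans a line stable under $H_I(k)$, and the character is
the action on this line. No presentation of $H_I(k)$ is needed. -/
theorem exists_isPrincipalChar_of_ne_zero (hv : v ≠ 0)
    (hT : ∀ i ∈ I, ρ (heckeT k i) v = (signUnit s k : ℂ) • v)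
    (hY : ∀ j, ρ (unitY k j : Hecke n k) v = (γ j : ℂ) • v) :
    ∃ χ : affParabolic k I →ₐ[ℂ] ℂ, IsPrincipalChar s k I γ χ := by
  have hex : ∀ a : affParabolic k I, ∃ c : ℂ, ρ a v = c • v := by
    rintro ⟨a, ha⟩
    change ∃ c : ℂ, ρ a v = c • v
    induction ha using Algebra.adjoin_induction with
    | mem x hx =>
      rcases hx with ⟨i, hi, rfl⟩ | ⟨f, rfl⟩
      · exact ⟨_, hT i hi⟩
      · exact ⟨_, evalY_apply hY f⟩
    | algebraMap c => exact ⟨c, by rw [AlgHom.commutes]; rfl⟩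
    | add x y _ _ ihx ihy =>
      obtain ⟨c, hc⟩ := ihx
      obtain ⟨d, hd⟩ := ihy
      exact ⟨c + d, by rw [map_add, LinearMap.add_apply, hc, hd, add_smul]⟩
    | mul x y _ _ ihx ihy =>
      obtain ⟨c, hc⟩ := ihx
      obtain ⟨d, hd⟩ := ihy
      exact ⟨c * d, by
        rw [map_mul, Module.End.mul_apply, hd, map_smul, hc, smul_smul, mul_comm]⟩
  choose c hc using hex
  have huniq : ∀ {a b : ℂ}, a • v = b • v → a = b := fun h => smul_left_injective ℂ hv h
  let χ : affParabolic k I →ₐ[ℂ] ℂ :=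
    { toFun := c
      map_one' := huniq (by rw [← hc, OneMemClass.coe_one, map_one, one_smul]; rfl)
      map_mul' := fun a b => huniq (by
        rw [← hc, MulMemClass.coe_mul, map_mul, Module.End.mul_apply, hc b, map_smul, hc a,
          smul_smul, mul_comm])
      map_zero' := huniq (by rw [← hc, ZeroMemClass.coe_zero, map_zero, zero_smul]; rfl)
      map_add' := fun a b => huniq (by
        rw [← hc, AddMemClass.coe_add, map_add, LinearMap.add_apply, hc, hc, add_smul])
      commutes' := fun a => huniq (by
        rw [← hc, Subalgebra.coe_algebraMap, AlgHom.commutes]; rfl) }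
  exact ⟨χ, fun i hi => huniq ((hc _).symm.trans (hT i hi)),
    fun f => huniq ((hc _).symm.trans (evalY_apply hY f))⟩

theorem isPrincipalChar_unique {χ χ' : affParabolic k I →ₐ[ℂ] ℂ}
    (hχ : IsPrincipalChar s k I γ χ) (hχ' : IsPrincipalChar s k I γ χ') : χ = χ' := by
  refine AlgHom.ext fun a => ?_
  obtain ⟨a, ha⟩ := a
  induction ha using Algebra.adjoin_induction with
  | mem x hx =>
    rcases hx with ⟨i, hi, rfl⟩ | ⟨f, rfl⟩
    · exact (hχ.1 i hi).trans (hχ'.1 i hi).symm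
    · exact (hχ.2 f).trans (hχ'.2 f).symm
  | algebraMap c => exact (χ.commutes c).trans (χ'.commutes c).symm
  | add x y hx hy ihx ihy =>
    exact (map_add χ ⟨x, hx⟩ ⟨y, hy⟩).trans
      ((congrArg₂ (· + ·) ihx ihy).trans (map_add χ' ⟨x, hx⟩ ⟨y, hy⟩).symm)
  | mul x y hx hy ihx ihy =>
    exact (map_mul χ ⟨x, hx⟩ ⟨y, hy⟩).trans
      ((congrArg₂ (· * ·) ihx ihy).trans (map_mul χ' ⟨x, hx⟩ ⟨y, hy⟩).symm)

section Basis

variable {Λ : Type*} [LinearOrder Λ] {f₀ : Fin (n + 1) → Λ} {x : Λ → ℂˣ}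

/-- The labelling `f₀`, as a vector of the formal representation, is the required common
eigenvector. -/
theorem exists_isPrincipalChar (hf : IsBlockLabel I f₀)
    (hx : labelWeight (signUnit s k) x f₀ = γ) :
    ∃ χ : affParabolic k I →ₐ[ℂ] ℂ, IsPrincipalChar s k I γ χ := by
  obtain ⟨ρ, hρ⟩ := exists_labelRep (n := n) (signUnit_quad s k) x
  refine exists_isPrincipalChar_of_ne_zero (ρ := ρ) (v := Finsupp.single f₀ 1) (by simp)
    (fun i hi => hρ.eq f₀ i ((hf.eq_iff i).mpr hi)) fun j => ?_
  rw [hρ.unitY_apply hf.mono, hx]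

variable {χ : affParabolic k I →ₐ[ℂ] ℂ}

theorem smul_princVec_one (a : Hecke n k) :
    a • princVec χ 1 = Submodule.Quotient.mk a := by
  rw [princVec, heckeTw_one, ← Submodule.Quotient.mk_smul, smul_eq_mul, mul_one]

theorem affParabolic_smul_princVec_one (a : affParabolic k I) :
    (a : Hecke n k) • princVec χ 1 = χ a • princVec χ 1 := by
  rw [smul_princVec_one, princVec, heckeTw_one, ← Submodule.Quotient.mk_smul,
    ← Algebra.algebraMap_eq_smul_one, Submodule.Quotient.eq]
  exact Submodule.subset_span ⟨a, rfl⟩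

/-- The family of vectors of the induced module that is indexed by the labellings. -/
theorem exists_princFamily (hχ : IsPrincipalChar s k I γ χ) (hf : IsBlockLabel I f₀)
    (hx : labelWeight (signUnit s k) x f₀ = γ) :
    ∃ F : (Fin (n + 1) → Λ) → PrincipalModule χ,
      IsLabelFamily (Algebra.lsmul ℂ ℂ (PrincipalModule χ) :
        Hecke n k →ₐ[ℂ] Module.End ℂ (PrincipalModule χ)) (signUnit s k) x F ∧
      ∀ w ∈ minCosetReps I, F (f₀ ∘ ⇑w⁻¹) = princVec χ w := by
  obtain ⟨F, hF, h1⟩ := exists_labelFamily (signUnit_quad s k) hf x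
    (Algebra.lsmul ℂ ℂ (PrincipalModule χ) : Hecke n k →ₐ[ℂ] Module.End ℂ (PrincipalModule χ))
    (princVec χ 1)
    (fun i hi => (affParabolic_smul_princVec_one ⟨heckeT k i, heckeT_mem k hi⟩).trans
      (congrArg (· • princVec χ 1) (hχ.1 i hi)))
    (fun j => by
      have h := affParabolic_smul_princVec_one (χ := χ)
        ⟨_, evalY_mem k I (AddMonoidAlgebra.single (Pi.single j 1) 1)⟩
      rw [hχ.2, evalT_single] at h
      simp only [evalY_single] at h
      rw [hx]
      exact h)
  refine ⟨F, hF, fun w hw => ?_⟩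
  rw [← hF.heckeTw_apply hf hw, h1]
  exact smul_princVec_one _

/-- The left ideal defining the induced module annihilates the formal vector `f₀`. A relation
between the $v_w$ therefore gives one between the vectors $T_wf_0=f_0\circ w^{-1}$, which are
distinct basis vectors. -/
theorem linearIndependent_princVec (hχ : IsPrincipalChar s k I γ χ) (hf : IsBlockLabel I f₀)
    (hx : labelWeight (signUnit s k) x f₀ = γ) :
    LinearIndependent ℂ fun w : minCosetReps I => princVec χ (w : Equiv.Perm (Fin (n + 1))) := by
  obtain ⟨ρ, hρ⟩ := exists_labelRep (n := n) (signUnit_quad s k) x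
  have hker : ∀ a ∈ Submodule.span (Hecke n k)
      (Set.range fun a : affParabolic k I => (a : Hecke n k) - algebraMap ℂ (Hecke n k) (χ a)),
      ρ a (Finsupp.single f₀ 1) = 0 := by
    intro a ha
    induction ha using Submodule.span_induction with
    | mem a ha =>
      obtain ⟨b, rfl⟩ := ha
      rw [map_sub, LinearMap.sub_apply, AlgHom.commutes, isPrincipalChar_apply hχ
        (fun i hi => hρ.eq f₀ i ((hf.eq_iff i).mpr hi))
        (fun j => by rw [hρ.unitY_apply hf.mono, hx])]
      exact sub_self _
    | zero => rw [map_zero]; rfl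
    | add a b _ _ ha hb => rw [map_add, LinearMap.add_apply, ha, hb, add_zero]
    | smul c a _ ha => rw [smul_eq_mul, map_mul, Module.End.mul_apply, ha, map_zero]
  have hinj : Function.Injective fun w : minCosetReps I =>
      f₀ ∘ ⇑((w : Equiv.Perm (Fin (n + 1)))⁻¹) :=
    fun v w h => Subtype.ext (hf.inj v.2 w.2 h)
  have hli : LinearIndependent ℂ fun w : minCosetReps I =>
      (Finsupp.single (f₀ ∘ ⇑((w : Equiv.Perm (Fin (n + 1)))⁻¹)) 1 : (Fin (n + 1) → Λ) →₀ ℂ) :=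
    (Finsupp.linearIndependent_single_one ℂ _).comp _ hinj
  rw [linearIndependent_iff'] at hli ⊢
  intro t c hc
  refine hli t c ?_
  have hmem : (∑ w ∈ t, c w • heckeTw k (w : Equiv.Perm (Fin (n + 1)))) ∈
      Submodule.span (Hecke n k) (Set.range fun a : affParabolic k I =>
        (a : Hecke n k) - algebraMap ℂ (Hecke n k) (χ a)) := by
    rw [← Submodule.Quotient.mk_eq_zero, ← hc]
    simp only [princVec]
    rw [← Submodule.mkQ_apply, map_sum]
    rfl
  have := hker _ hmem
  rw [map_sum, LinearMap.sum_apply] at this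
  rw [← this]
  refine Finset.sum_congr rfl fun w _ => ?_
  rw [map_smul, LinearMap.smul_apply, hρ.heckeTw_apply hf w.2]

/-- The span contains the generator $v_1$ and is stable under $T_i$ and $T_\zeta^{\pm1}$, since
these send a member of the family to a combination of members of the same orbit. -/
theorem span_princVec (hχ : IsPrincipalChar s k I γ χ) (hf : IsBlockLabel I f₀)
    (hx : labelWeight (signUnit s k) x f₀ = γ) :
    ⊤ ≤ Submodule.span ℂ
      (Set.range fun w : minCosetReps I => princVec χ (w : Equiv.Perm (Fin (n + 1)))) := by
  obtain ⟨F, hF, hw⟩ := exists_princFamily hχ hf hx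
  set U := Submodule.span ℂ
    (Set.range fun w : minCosetReps I => princVec χ (w : Equiv.Perm (Fin (n + 1)))) with hU
  -- Arbitrary permutations are admitted here because $s_iw$ and $\sigma w$ need not be minimal;
  -- only the labelling counts.
  have hFU : ∀ σ : Equiv.Perm (Fin (n + 1)), F (f₀ ∘ ⇑σ⁻¹) ∈ U := fun σ => by
    rw [← hf.minCosetRep_comp, hw _ (minCosetRep_mem σ)]
    exact Submodule.subset_span ⟨⟨_, minCosetRep_mem σ⟩, rfl⟩
  have hstab : ∀ a : Hecke n k, (∀ w : Equiv.Perm (Fin (n + 1)), a • F (f₀ ∘ ⇑w⁻¹) ∈ U) →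
      ∀ u ∈ U, a • u ∈ U := by
    intro a ha u hu
    induction hu using Submodule.span_induction with
    | mem u hu =>
      obtain ⟨w, rfl⟩ := hu
      simp only
      rw [← hw _ w.2]
      exact ha w
    | zero => rw [smul_zero]; exact U.zero_mem
    | add u v _ _ hu hv => rw [smul_add]; exact U.add_mem hu hv
    | smul c u _ hu => rw [smul_comm]; exact U.smul_mem c hu
  let S : Subalgebra ℂ (Hecke n k) :=
    { carrier := {a | ∀ u ∈ U, a • u ∈ U}
      mul_mem' := fun {a b} ha hb u hu => by rw [mul_smul]; exact ha _ (hb u hu)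
      add_mem' := fun {a b} ha hb u hu => by rw [add_smul]; exact U.add_mem (ha u hu) (hb u hu)
      algebraMap_mem' := fun c u hu => by rw [algebraMap_smul]; exact U.smul_mem c hu }
  have htop : ∀ a : Hecke n k, a ∈ S := by
    refine hecke_induction S (fun i => hstab _ fun w => ?_) (hstab _ fun w => ?_)
      (hstab _ fun w => ?_)
    · have := hF.heckeT_apply (f₀ ∘ ⇑w⁻¹) i
      rw [← comp_mul_simpleRefl] at this
      change heckeT k i • F (f₀ ∘ ⇑w⁻¹) = _ at this
      rw [this]
      exact U.add_mem (U.smul_mem _ (hFU w)) (U.smul_mem _ (hFU _))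
    · have := hF.zeta (f₀ ∘ ⇑w⁻¹)
      rw [Function.comp_assoc, ← Equiv.Perm.coe_mul, ← mul_inv_rev] at this
      change heckeZ n k • F (f₀ ∘ ⇑w⁻¹) = _ at this
      rw [this]
      exact U.smul_mem _ (hFU _)
    · have := map_inv_apply_of_eq _ (unitZ n k) (hF.zeta ((f₀ ∘ ⇑w⁻¹) ∘ ⇑(cyc n)))
      rw [comp_cyc_cyc_inv, Function.comp_assoc, ← Equiv.Perm.coe_mul] at this
      change heckeZi n k • F (f₀ ∘ ⇑w⁻¹) = _ at this
      rw [this]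
      have h2 := hFU ((cyc n)⁻¹ * w)
      rw [mul_inv_rev, inv_inv] at h2
      exact U.smul_mem _ h2
  rintro m -
  obtain ⟨a, rfl⟩ := Submodule.Quotient.mk_surjective _ m
  rw [← smul_princVec_one]
  exact htop a _ (Submodule.subset_span ⟨⟨1, one_mem_minCosetReps⟩, rfl⟩)

end Basis

end Principal

/-! ### Reversing the order of the labels -/

section Dual

variable {n : ℕ} {κ ε : ℂˣ} {Λ : Type*} [LinearOrder Λ] {I : Set (Fin n)} {f₀ : Fin (n + 1) → Λ}
  {V : Type*} [AddCommGroup V] [Module ℂ V]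

/-- The labelling in reverse order. -/
def dualLabel (f₀ : Fin (n + 1) → Λ) : Fin (n + 1) → Λᵒᵈ :=
  OrderDual.toDual ∘ f₀ ∘ ⇑(longest n)

/-- The inverse scalars, as a function on the labels in reverse order. -/
def dualScalar (x : Λ → ℂˣ) : Λᵒᵈ → ℂˣ := fun l => (x (OrderDual.ofDual l))⁻¹

/-- The same labelling is reached from `f₀` by $w$ and from its reversal by $w\overline{w_0}^{-1}$,
because $f_0\circ w_0=f_0\circ\overline{w_0}^{-1}$. This is the origin of the shift by
$\overline{w_0}^{-1}$ in $\psi_\phi$. -/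
theorem IsBlockLabel.dualLabel_comp (hf : IsBlockLabel I f₀) (w : Equiv.Perm (Fin (n + 1))) :
    dualLabel f₀ ∘ ⇑(w * (minCosetRep I (longest n))⁻¹)⁻¹ = OrderDual.toDual ∘ f₀ ∘ ⇑w⁻¹ := by
  have h := hf.minCosetRep_comp (longest n)
  funext a
  have := congrFun h (minCosetRep I (longest n) (w⁻¹ a))
  simp only [Function.comp_apply, perm_inv_apply] at this
  rw [mul_inv_rev, inv_inv]
  simp only [dualLabel, Function.comp_apply, Equiv.Perm.mul_apply]
  rw [this]
  rfl

theorem mul_minCosetRep_inv_mem {w : Equiv.Perm (Fin (n + 1))} (hw : w ∈ minCosetReps I) :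
    w * (minCosetRep I (longest n))⁻¹ ∈ minCosetReps (starSet I) := by
  rw [mem_minCosetReps_iff] at hw ⊢
  rintro j ⟨i, hi, h1, h2⟩
  rw [← h1, ← h2, Equiv.Perm.mul_apply, Equiv.Perm.mul_apply, perm_inv_apply, perm_inv_apply]
  exact hw i hi

/-- The permutation $\overline{w_0}$ carries `f₀` to its reversal and is increasing on every block,
so it matches the letters counted in the upper and lower products on the two sides. Inverting
$\epsilon$ and $x$ then inverts the weight. -/
theorem labelWeight_dual (hf : IsBlockLabel I f₀) (x : Λ → ℂˣ) :
    labelWeight ε⁻¹ (dualScalar x) (dualLabel f₀) =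
      permTorus (minCosetRep I (longest n)) (labelWeight ε x f₀)⁻¹ := by
  set u := minCosetRep I (longest n) with hu
  have huI : u ∈ minCosetReps I := minCosetRep_mem _
  have hd : ∀ b, dualLabel f₀ (u b) = OrderDual.toDual (f₀ b) := fun b => by
    have := congrFun (hf.dualLabel_comp 1) b
    rwa [one_mul, inv_inv] at this
  have hlt : ∀ a b, f₀ a = f₀ b → (u a < u b ↔ a < b) := fun a b h => by
    refine ⟨fun hab => ?_, fun hab => hf.lt_of_eq huI hab h⟩
    by_contra hn
    rcases (not_lt.mp hn).eq_or_lt with rfl | hba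
    · exact lt_irrefl _ hab
    · exact absurd (hf.lt_of_eq huI hba h.symm) hab.not_gt
  have hup : ∀ a, upperProd ε⁻¹ (dualLabel f₀) (u a) = (upperProd ε f₀ a)⁻¹ := fun a => by
    rw [upperProd, upperProd, ← Equiv.prod_comp u, ← Finset.prod_inv_distrib]
    refine Finset.prod_congr rfl fun b _ => ?_
    rw [hd, hd]
    by_cases h : f₀ a = f₀ b
    · by_cases hab : a < b <;> simp [h, hlt a b h, hab]
    · simp [h]
  have hlow : ∀ a, lowerProd ε⁻¹ (dualLabel f₀) (u a) = (lowerProd ε f₀ a)⁻¹ := fun a => by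
    rw [lowerProd, lowerProd, ← Equiv.prod_comp u, ← Finset.prod_inv_distrib]
    refine Finset.prod_congr rfl fun b _ => ?_
    rw [hd, hd]
    by_cases h : f₀ b = f₀ a
    · by_cases hab : b < a <;> simp [h, hlt b a h, hab]
    · simp [h]
  funext j
  obtain ⟨a, rfl⟩ := u.surjective j
  rw [labelWeight, hup, hlow, hd, permTorus, perm_inv_apply, Pi.inv_apply, labelWeight, mul_inv,
    mul_inv]
  rfl

theorem isFinLabelFamily_iff {ρ : Hecke n κ →ₐ[ℂ] Module.End ℂ V} {F : (Fin (n + 1) → Λ) → V} :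
    IsFinLabelFamily ρ ε F ↔ ∀ f i, ρ (heckeT κ i) (F f) =
      diagCoeff κ ε (f i.castSucc) (f i.succ) • F f +
        swapCoeff (f i.castSucc) (f i.succ) • F (f ∘ ⇑(simpleRefl i)) := by
  refine ⟨fun h => h.heckeT_apply, fun h => ⟨fun f i hlt => ?_, fun f i he => ?_⟩⟩
  · rw [h, diagCoeff_of_lt hlt, swapCoeff_of_lt hlt, zero_smul, zero_add, one_smul]
  · rw [h, he, diagCoeff_self, swapCoeff_self, zero_smul, add_zero]

/-- On coefficients this is $T_i^{-1}=T_i-(\kappa-\kappa^{-1})$. For equal labels it says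
$\epsilon^{-1}=\epsilon-(\kappa-\kappa^{-1})$, which is the quadratic equation divided by
$\epsilon$. -/
theorem diagCoeff_dual (hε : (ε : ℂ) * ε = ((κ : ℂ) - ((κ⁻¹ : ℂˣ) : ℂ)) * ε + 1) (a b : Λ) :
    diagCoeff κ⁻¹ ε⁻¹ (OrderDual.toDual a) (OrderDual.toDual b) =
      diagCoeff κ ε a b - ((κ : ℂ) - ((κ⁻¹ : ℂˣ) : ℂ)) := by
  rcases lt_trichotomy a b with h | rfl | h
  · have h' : OrderDual.toDual b < OrderDual.toDual a := h
    rw [diagCoeff_of_gt h', diagCoeff_of_lt h, inv_inv]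
    ring
  · rw [diagCoeff_self, diagCoeff_self]
    have h0 : ((ε⁻¹ : ℂˣ) : ℂ) * ε = 1 := by rw [← Units.val_mul, inv_mul_cancel, Units.val_one]
    refine mul_right_cancel₀ ε.ne_zero ?_
    linear_combination h0 - hε
  · have h' : OrderDual.toDual a < OrderDual.toDual b := h
    rw [diagCoeff_of_lt h', diagCoeff_of_gt h, sub_self]

theorem swapCoeff_dual (a b : Λ) :
    swapCoeff (OrderDual.toDual a) (OrderDual.toDual b) = swapCoeff a b := by
  simp [swapCoeff]

theorem swapCoeff_comm (a b : Λ) : swapCoeff a b = swapCoeff b a := by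
  simp only [swapCoeff, eq_comm]

/-- The families of vectors for the labels in reverse order, in terms of the given order. -/
theorem isLabelFamily_dual_iff (hε : (ε : ℂ) * ε = ((κ : ℂ) - ((κ⁻¹ : ℂˣ) : ℂ)) * ε + 1)
    {x : Λ → ℂˣ} {ρ : Hecke n κ⁻¹ →ₐ[ℂ] Module.End ℂ V} {F : (Fin (n + 1) → Λ) → V} :
    IsLabelFamily ρ ε⁻¹ (dualScalar x)
        (fun f : Fin (n + 1) → Λᵒᵈ => F (OrderDual.ofDual ∘ f)) ↔
      (∀ f i, ρ (heckeT κ⁻¹ i) (F f) + ((κ : ℂ) - ((κ⁻¹ : ℂˣ) : ℂ)) • F f -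
        (diagCoeff κ ε (f i.castSucc) (f i.succ) • F f +
          swapCoeff (f i.castSucc) (f i.succ) • F (f ∘ ⇑(simpleRefl i))) = 0) ∧
      ∀ f, (x (f 0) : ℂ) • ρ (heckeZ n κ⁻¹) (F (f ∘ ⇑(cyc n))) - F f = 0 := by
  have h1 : IsLabelFamily ρ ε⁻¹ (dualScalar x)
      (fun f : Fin (n + 1) → Λᵒᵈ => F (OrderDual.ofDual ∘ f)) ↔
      IsFinLabelFamily ρ ε⁻¹ (fun f : Fin (n + 1) → Λᵒᵈ => F (OrderDual.ofDual ∘ f)) ∧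
      ∀ f : Fin (n + 1) → Λ, ρ (heckeZ n κ⁻¹) (F f) =
        (((x (f (Fin.last n)))⁻¹ : ℂˣ) : ℂ) • F (f ∘ ⇑(cyc n)⁻¹) :=
    ⟨fun h => ⟨h.toIsFinLabelFamily, fun f => h.zeta (OrderDual.toDual ∘ f)⟩,
      fun h => ⟨h.1, fun f => h.2 (OrderDual.ofDual ∘ f)⟩⟩
  rw [h1, isFinLabelFamily_iff]
  -- The conditions for $T_i$ differ by the shift in `diagCoeff_dual`; those for $T_\zeta$ by the
  -- substitution of $f\circ\sigma$ for $f$, which turns the label of the last letter into that of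
  -- the first.
  refine and_congr ⟨fun h f i => ?_, fun h f i => ?_⟩ ⟨fun h f => ?_, fun h f => ?_⟩
  · have := h (OrderDual.toDual ∘ f) i
    simp only [Function.comp_apply, diagCoeff_dual hε, swapCoeff_dual] at this
    change ρ (heckeT κ⁻¹ i) (F f) = _ • F f + _ • F (f ∘ ⇑(simpleRefl i)) at this
    rw [this]
    module
  · have := h (OrderDual.ofDual ∘ f) i
    have hd := diagCoeff_dual hε (OrderDual.ofDual (f i.castSucc)) (OrderDual.ofDual (f i.succ))
    have hs := swapCoeff_dual (OrderDual.ofDual (f i.castSucc)) (OrderDual.ofDual (f i.succ))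
    simp only [OrderDual.toDual_ofDual] at hd hs
    rw [hd, hs]
    simp only [Function.comp_apply] at this
    rw [← sub_eq_zero, ← this]
    simp only [Function.comp_assoc]
    module
  · rw [h, Function.comp_apply, cyc_last, comp_cyc_cyc_inv, unit_smul_inv, sub_self]
  · have := h (f ∘ ⇑(cyc n)⁻¹)
    rw [Function.comp_apply, cyc_inv_zero, comp_cyc_inv_cyc, sub_eq_zero] at this
    rw [← this, unit_inv_smul]

end Dual

/-! ### The quantum affine KZ equations in terms of $T_i$ and $\pi(T_i)^{-1}$ -/

section Equations

variable {n : ℕ} (k q : ℂˣ)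

/-- The invertible element `(c_i^k)⁻¹ s_i`. -/
noncomputable def reflUnit (i : Fin n) : (DiffRefl n k q)ˣ where
  val := SkewMonoidAlgebra.single (wRefl i) (uLoc k q i.castSucc i.succ)
  inv := SkewMonoidAlgebra.single (wRefl i) (cLoc k k q i.succ i.castSucc)
  val_inv := by
    rw [SkewMonoidAlgebra.single_mul_single, wRefl_mul_self, smul_cLoc_wRefl, simpleRefl_succ,
      simpleRefl_castSucc]
    have h1 := hecke_coeff_ne_zero k (Fin.castSucc_lt_succ (i := i)).ne
    have h2 := coordFun_sub_ne_zero (Fin.castSucc_lt_succ (i := i)).ne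
    have hκ := constFun_ne_zero (n := n) k
    have : uLoc k q i.castSucc i.succ * cLoc k k q i.castSucc i.succ = 1 := by
      refine LocAlg.ext ?_
      change (uLoc k q i.castSucc i.succ).incl * (cLoc k k q i.castSucc i.succ).incl = 1
      rw [coe_uLoc, coe_cLoc]
      field_simp
    rw [this]
    rfl
  inv_val := by
    rw [SkewMonoidAlgebra.single_mul_single, wRefl_mul_self, smul_uLoc_wRefl, simpleRefl_succ,
      simpleRefl_castSucc]
    have h1 := hecke_coeff_ne_zero k (Fin.castSucc_lt_succ (i := i)).ne'
    have h2 := coordFun_sub_ne_zero (Fin.castSucc_lt_succ (i := i)).ne'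
    have hκ := constFun_ne_zero (n := n) k
    have : cLoc k k q i.succ i.castSucc * uLoc k q i.succ i.castSucc = 1 := by
      refine LocAlg.ext ?_
      change (cLoc k k q i.succ i.castSucc).incl * (uLoc k q i.succ i.castSucc).incl = 1
      rw [coe_uLoc, coe_cLoc]
      field_simp
    rw [this]
    rfl

/-- In $H(k^{-1})$ one has $T_i+k-k^{-1}=T_i^{-1}$. The computation rests on
$c^{k^{-1}}(-\alpha)=c^k(\alpha)$: moving $s_i$ past the coefficients of $\pi(T_i)$ reverses the
root, and then $c_i^k$ cancels. -/
theorem reflUnit_mul_cherednikT (i : Fin n) :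
    (reflUnit k q i : DiffRefl n k q) *
        (cherednikT k⁻¹ k q i + ((k : ℂ) - ((k⁻¹ : ℂˣ) : ℂ)) • 1) =
      1 - SkewMonoidAlgebra.single (wRefl i) (vLoc k q i.castSucc i.succ) := by
  have hne : i.castSucc ≠ i.succ := (Fin.castSucc_lt_succ (i := i)).ne
  have h1 := hecke_coeff_ne_zero k hne
  have h1' := hecke_coeff_ne_zero k⁻¹ hne.symm
  have h2 := coordFun_sub_ne_zero hne
  have h2' := coordFun_sub_ne_zero hne.symm
  have hκ := constFun_ne_zero (n := n) k
  have e1 : uLoc k q i.castSucc i.succ * cLoc k⁻¹ k q i.succ i.castSucc = 1 := by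
    refine LocAlg.ext ?_
    change (uLoc k q i.castSucc i.succ).incl * (cLoc k⁻¹ k q i.succ i.castSucc).incl = 1
    rw [coe_uLoc, coe_cLoc, constFun_inv]
    field_simp
    ring
  have e2 : uLoc k q i.castSucc i.succ * (aLoc k⁻¹ k q i.succ i.castSucc +
      algebraMap ℂ _ ((k : ℂ) - ((k⁻¹ : ℂˣ) : ℂ))) = - vLoc k q i.castSucc i.succ := by
    refine LocAlg.ext ?_
    rw [map_sub]
    change (uLoc k q i.castSucc i.succ).incl * ((aLoc k⁻¹ k q i.succ i.castSucc).incl +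
      (constFun n k - constFun n k⁻¹)) = - (vLoc k q i.castSucc i.succ).incl
    rw [coe_uLoc, coe_aLoc hne.symm, coe_vLoc hne, constFun_inv]
    field_simp
    ring
  have e3 : ((k : ℂ) - ((k⁻¹ : ℂˣ) : ℂ)) • (1 : DiffRefl n k q) =
      SkewMonoidAlgebra.single 1 (algebraMap ℂ _ ((k : ℂ) - ((k⁻¹ : ℂˣ) : ℂ))) := by
    rw [Algebra.algebraMap_eq_smul_one, ← SkewMonoidAlgebra.smul_single]
    rfl
  change SkewMonoidAlgebra.single (wRefl i) (uLoc k q i.castSucc i.succ) * _ = _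
  rw [e3, cherednikT, add_right_comm, ← SkewMonoidAlgebra.single_add, mul_add,
    SkewMonoidAlgebra.single_mul_single, SkewMonoidAlgebra.single_mul_single, wRefl_mul_self,
    mul_one, smul_add, smul_algebraMap, smul_aLoc_wRefl, smul_cLoc_wRefl, simpleRefl_succ,
    simpleRefl_castSucc, e1, e2, SkewMonoidAlgebra.single_neg, SkewMonoidAlgebra.one_def]
  abel

variable {k q} {L : Type*} [AddCommGroup L] [Module ℂ L] [Module (DiffRefl n k q) L]
  [IsScalarTower ℂ (DiffRefl n k q) L]
  {M : Type*} [AddCommGroup M] [Module ℂ M] [Module (Hecke n k) M] [IsScalarTower ℂ (Hecke n k) M]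

theorem sectionAction_tmul (a : DiffRefl n k q) (h : Hecke n k) (l : L) (m : M) :
    sectionAction n k q L M (a ⊗ₜ[ℂ] h) (l ⊗ₜ[ℂ] m) = (a • l) ⊗ₜ[ℂ] (h • m) := rfl

theorem mem_qkzSolutions_iff (ψ : L ⊗[ℂ] M) : ψ ∈ qkzSolutions n k q L M ↔
    (∀ i, sectionAction n k q L M (nablaS k q i) ψ = ψ) ∧
      sectionAction n k q L M (nablaZ n k q) ψ = ψ := by
  have hn : ∀ w : ExtWeyl n, nabla n k q (SkewMonoidAlgebra.single w 1) =
      nablaWeyl n k q w := fun w => by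
    rw [nabla_single, map_one, one_mul]
  constructor
  · intro h
    refine ⟨fun i => ?_, ?_⟩
    · have := h (wRefl i)
      rwa [hn, nablaWeyl_wRefl] at this
    · have := h (zeta n)
      rwa [hn, nablaWeyl_zeta] at this
  · rintro ⟨h1, h2⟩ w
    let K : Subgroup (ExtWeyl n) :=
      { carrier := {w | sectionAction n k q L M (nablaWeyl n k q w) ψ = ψ}
        mul_mem' := fun {v w} hv hw => by
          change sectionAction n k q L M (nablaWeyl n k q (v * w)) ψ = ψ
          rw [map_mul, Units.val_mul, map_mul, Module.End.mul_apply, hw, hv]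
        one_mem' := by
          change sectionAction n k q L M (nablaWeyl n k q 1) ψ = ψ
          rw [map_one, Units.val_one, map_one]; rfl
        inv_mem' := fun {w} hw => by
          change sectionAction n k q L M (nablaWeyl n k q w⁻¹) ψ = ψ
          have hw' : sectionAction n k q L M (nablaWeyl n k q w) ψ = ψ := hw
          nth_rw 1 [← hw']
          rw [← Module.End.mul_apply, ← map_mul, ← Units.val_mul, ← map_mul, inv_mul_cancel,
            map_one, Units.val_one, map_one]
          rfl }
    rw [hn]
    refine weyl_induction K (fun i => ?_) ?_ w
    · change sectionAction n k q L M (nablaWeyl n k q (wRefl i)) ψ = ψ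
      rw [nablaWeyl_wRefl, h1]
    · change sectionAction n k q L M (nablaWeyl n k q (zeta n)) ψ = ψ
      rw [nablaWeyl_zeta, h2]

/-- The qKZ equation for `s_i` in terms of `T_i` and the operator `π(T_i)`. -/
theorem sectionAction_nablaS_iff (i : Fin n) (ψ : L ⊗[ℂ] M) :
    sectionAction n k q L M (nablaS k q i) ψ = ψ ↔
      sectionAction n k q L M
        ((cherednikT k⁻¹ k q i + ((k : ℂ) - ((k⁻¹ : ℂˣ) : ℂ)) • 1) ⊗ₜ[ℂ] 1 -
          1 ⊗ₜ[ℂ] heckeT k i) ψ = 0 := by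
  set B : DiffRefl n k q := cherednikT k⁻¹ k q i + ((k : ℂ) - ((k⁻¹ : ℂˣ) : ℂ)) • 1 with hB
  -- The two operators differ by an invertible factor on the left, hence have the same kernel.
  have h1 : 1 - nablaS k q i = ((reflUnit k q i : DiffRefl n k q) ⊗ₜ[ℂ] (1 : Hecke n k)) *
      (B ⊗ₜ[ℂ] 1 - 1 ⊗ₜ[ℂ] heckeT k i) := by
    rw [mul_sub, Algebra.TensorProduct.tmul_mul_tmul, Algebra.TensorProduct.tmul_mul_tmul, hB,
      reflUnit_mul_cherednikT, nablaS, nablaRefl, TensorProduct.sub_tmul,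
      Algebra.TensorProduct.one_def, mul_one, one_mul, mul_one]
    change _ - (SkewMonoidAlgebra.single (wRefl i) (uLoc k q i.castSucc i.succ) ⊗ₜ[ℂ]
        heckeT k i + _) =
      _ - _ - SkewMonoidAlgebra.single (wRefl i) (uLoc k q i.castSucc i.succ) ⊗ₜ[ℂ] heckeT k i
    abel
  have h2 : B ⊗ₜ[ℂ] 1 - 1 ⊗ₜ[ℂ] heckeT k i =
      (((reflUnit k q i)⁻¹ : (DiffRefl n k q)ˣ) : DiffRefl n k q) ⊗ₜ[ℂ] (1 : Hecke n k) *
        (1 - nablaS k q i) := by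
    rw [h1, ← mul_assoc, Algebra.TensorProduct.tmul_mul_tmul, Units.inv_mul,
      mul_one, ← Algebra.TensorProduct.one_def, one_mul]
  have h3 : sectionAction n k q L M (nablaS k q i) ψ = ψ ↔
      sectionAction n k q L M (1 - nablaS k q i) ψ = 0 := by
    rw [map_sub, map_one, LinearMap.sub_apply, Module.End.one_apply, sub_eq_zero, eq_comm]
  rw [h3]
  constructor
  · intro h
    rw [h2, map_mul, Module.End.mul_apply, h, map_zero]
  · intro h
    rw [h1, map_mul, Module.End.mul_apply, h, map_zero]

end Equations

/-! ### Coefficients with respect to a basis of the second tensor factor -/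

section Bases

variable {L M ι : Type*} [AddCommGroup L] [Module ℂ L] [AddCommGroup M] [Module ℂ M] {S : Set ι}
  {v : ι → M}

theorem eq_zero_of_sum_tmul_eq_zero (hS : S.Finite) (hv : LinearIndependent ℂ fun w : S => v w)
    (hs : ⊤ ≤ Submodule.span ℂ (Set.range fun w : S => v w))
    {a : ι → L} (h : ∑ w ∈ hS.toFinset, a w ⊗ₜ[ℂ] v w = 0)
    {w : ι} (hw : w ∈ S) : a w = 0 := by
  classical
  have := hS.fintype
  rw [Finset.sum_subtype hS.toFinset (fun w => hS.mem_toFinset)] at h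
  set b := Module.Basis.mk hv hs with hb
  have hbv : ∀ w : S, v w = b w := fun w => (Module.Basis.mk_apply hv hs w).symm
  clear_value b
  have h1 := congrArg (fun t => TensorProduct.equivFinsuppOfBasisRight b t ⟨w, hw⟩) h
  simp only [map_sum, Finsupp.finsetSum_apply, hbv, map_zero, Finsupp.coe_zero, Pi.zero_apply,
    TensorProduct.equivFinsuppOfBasisRight_apply_tmul_apply, Module.Basis.repr_self] at h1
  rw [Finset.sum_eq_single ⟨w, hw⟩ (fun c _ hc => by rw [Finsupp.single_eq_of_ne' hc, zero_smul])
    (fun h => absurd (Finset.mem_univ _) h), Finsupp.single_eq_same, one_smul] at h1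
  exact h1

theorem exists_eq_sum_tmul (hS : S.Finite) (hv : LinearIndependent ℂ fun w : S => v w)
    (hs : ⊤ ≤ Submodule.span ℂ (Set.range fun w : S => v w))
    (ψ : L ⊗[ℂ] M) :
    ∃ a : ι → L, ψ = ∑ w ∈ hS.toFinset, a w ⊗ₜ[ℂ] v w := by
  classical
  have := hS.fintype
  have hb : ∀ w : S, v w = Module.Basis.mk hv hs w := fun w => (Module.Basis.mk_apply hv hs w).symm
  set e := TensorProduct.equivFinsuppOfBasisRight (M := L) (Module.Basis.mk hv hs) with he
  refine ⟨fun w => if h : w ∈ S then e ψ ⟨w, h⟩ else 0, ?_⟩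
  rw [Finset.sum_subtype hS.toFinset (fun w => hS.mem_toFinset)]
  conv_lhs => rw [← e.symm_apply_apply ψ, he, TensorProduct.equivFinsuppOfBasisRight_symm_apply]
  rw [Finsupp.sum_fintype _ _ (fun w => TensorProduct.zero_tmul _ (Module.Basis.mk hv hs w))]
  refine Finset.sum_congr rfl fun w _ => ?_
  beta_reduce
  rw [dif_pos w.2, hb]

end Bases

/-! ### Sums over the orbit of a labelling -/

section Orbit

variable {n : ℕ} {Λ : Type*} [LinearOrder Λ] {I : Set (Fin n)} {f₀ f : Fin (n + 1) → Λ}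

/-- The labellings obtained from `f₀` by permuting the letters. -/
def labelOrbit (f₀ : Fin (n + 1) → Λ) : Finset (Fin (n + 1) → Λ) :=
  Finset.univ.image fun σ : Equiv.Perm (Fin (n + 1)) => f₀ ∘ ⇑σ

theorem mem_labelOrbit : f ∈ labelOrbit f₀ ↔ ∃ σ : Equiv.Perm (Fin (n + 1)), f₀ ∘ ⇑σ = f := by
  simp [labelOrbit]

theorem comp_mem_labelOrbit (τ : Equiv.Perm (Fin (n + 1))) (h : f ∈ labelOrbit f₀) :
    f ∘ ⇑τ ∈ labelOrbit f₀ := by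
  obtain ⟨σ, rfl⟩ := mem_labelOrbit.mp h
  exact mem_labelOrbit.mpr ⟨σ * τ, rfl⟩

theorem comp_mem_labelOrbit_iff (τ : Equiv.Perm (Fin (n + 1))) :
    f ∘ ⇑τ ∈ labelOrbit f₀ ↔ f ∈ labelOrbit f₀ := by
  refine ⟨fun h => ?_, comp_mem_labelOrbit τ⟩
  have := comp_mem_labelOrbit τ⁻¹ h
  rwa [Function.comp_assoc, ← Equiv.Perm.coe_mul, mul_inv_cancel, Equiv.Perm.coe_one,
    Function.comp_id] at this

/-- Sums over the orbit can be reindexed by any permutation. Sums over minimal representatives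
cannot, since left multiplication by $s_i$ may leave that set. -/
theorem sum_labelOrbit_comp {A : Type*} [AddCommMonoid A] (τ : Equiv.Perm (Fin (n + 1)))
    (g : (Fin (n + 1) → Λ) → A) :
    ∑ f ∈ labelOrbit f₀, g (f ∘ ⇑τ) = ∑ f ∈ labelOrbit f₀, g f := by
  refine Finset.sum_nbij' (fun f => f ∘ ⇑τ) (fun f => f ∘ ⇑τ⁻¹)
    (fun f h => comp_mem_labelOrbit τ h) (fun f h => comp_mem_labelOrbit τ⁻¹ h) (fun f _ => ?_)
    (fun f _ => ?_) fun f _ => rfl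
  · rw [Function.comp_assoc, ← Equiv.Perm.coe_mul, mul_inv_cancel, Equiv.Perm.coe_one,
      Function.comp_id]
  · rw [Function.comp_assoc, ← Equiv.Perm.coe_mul, inv_mul_cancel, Equiv.Perm.coe_one,
      Function.comp_id]

theorem IsBlockLabel.exists_of_mem_labelOrbit (hf : IsBlockLabel I f₀) (h : f ∈ labelOrbit f₀) :
    ∃ w ∈ minCosetReps I, f₀ ∘ ⇑w⁻¹ = f := by
  obtain ⟨σ, rfl⟩ := mem_labelOrbit.mp h
  exact ⟨minCosetRep I σ⁻¹, minCosetRep_mem _, by rw [hf.minCosetRep_comp, inv_inv]⟩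

theorem IsBlockLabel.sum_labelOrbit (hf : IsBlockLabel I f₀) {A : Type*} [AddCommMonoid A]
    (g : (Fin (n + 1) → Λ) → A) : ∑ f ∈ labelOrbit f₀, g f =
      ∑ w ∈ (Set.toFinite (minCosetReps I)).toFinset, g (f₀ ∘ ⇑w⁻¹) := by
  have h : labelOrbit f₀ = (Set.toFinite (minCosetReps I)).toFinset.image
      fun w : Equiv.Perm (Fin (n + 1)) => f₀ ∘ ⇑w⁻¹ := by
    ext f
    simp only [Finset.mem_image, Set.Finite.mem_toFinset]
    exact ⟨hf.exists_of_mem_labelOrbit, fun ⟨w, _, h⟩ => mem_labelOrbit.mpr ⟨w⁻¹, h⟩⟩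
  rw [h, Finset.sum_image]
  intro v hv w hw h
  simp only [Finset.mem_coe, Set.Finite.mem_toFinset] at hv hw
  exact hf.inj hv hw h

end Orbit

/-! ### Solutions of the qKZ equations as label families -/

section Solutions

variable {n : ℕ} {k q : ℂˣ} {L : Type*} [AddCommGroup L] [Module ℂ L] [Module (DiffRefl n k q) L]
  [IsScalarTower ℂ (DiffRefl n k q) L]

variable (n k q L) in
/-- The representation of `H(k⁻¹)` on `L` through `π^{k⁻¹,q}`. -/
noncomputable def cherednikRep : Hecke n k⁻¹ →ₐ[ℂ] Module.End ℂ L :=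
  (Algebra.lsmul ℂ ℂ L : DiffRefl n k q →ₐ[ℂ] Module.End ℂ L).comp (cherednik n k⁻¹ k q)

theorem cherednikRep_apply (h : Hecke n k⁻¹) (φ : L) :
    cherednikRep n k q L h φ = cherednik n k⁻¹ k q h • φ := rfl

theorem mem_weightSpace_iff {s : ℤˣ} {J : Set (Fin n)} {t : Fin (n + 1) → ℂˣ} {φ : L} :
    φ ∈ weightSpace k q L s k⁻¹ J t ↔
      (∀ i ∈ J, cherednikRep n k q L (heckeT k⁻¹ i) φ = (signUnit s k⁻¹ : ℂ) • φ) ∧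
        ∀ j, cherednikRep n k q L (unitY k⁻¹ j : Hecke n k⁻¹) φ = (t j : ℂ) • φ := by
  constructor
  · rintro ⟨h1, h2⟩
    refine ⟨fun i hi => ?_, fun j => ?_⟩
    · rw [cherednikRep_apply, h1 _ (Algebra.subset_adjoin ⟨i, hi, rfl⟩), heckeSign,
        (exists_heckeSign n s k⁻¹).choose_spec.1, coe_signUnit]
    · rw [cherednikRep_apply, ← evalY_single, h2, evalT_single]
  · rintro ⟨h1, h2⟩
    refine ⟨fun h hh => ?_, fun f => evalY_apply h2 f⟩
    change cherednikRep n k q L h φ = _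
    induction hh using Algebra.adjoin_induction with
    | mem x hx =>
      obtain ⟨i, hi, rfl⟩ := hx
      rw [h1 i hi, heckeSign, (exists_heckeSign n s k⁻¹).choose_spec.1, coe_signUnit]
    | algebraMap c =>
      rw [AlgHom.commutes, AlgHom.commutes]; rfl
    | add x y _ _ hx hy => rw [map_add, LinearMap.add_apply, hx, hy, map_add, add_smul]
    | mul x y _ _ hx hy =>
      rw [map_mul, Module.End.mul_apply, hy, map_smul, hx, smul_smul, map_mul, mul_comm]

section Equation

variable {Λ : Type*} [LinearOrder Λ] {f₀ : Fin (n + 1) → Λ} {ε : ℂˣ} {x : Λ → ℂˣ}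
  {M : Type*} [AddCommGroup M] [Module ℂ M] [Module (Hecke n k) M] [IsScalarTower ℂ (Hecke n k) M]
  {V : (Fin (n + 1) → Λ) → M} (F : (Fin (n + 1) → Λ) → L)

/-- Reindexing the orbit by $s_i$ transfers the interchange of labels from $V$ to $F$, so that every
term has the form of a coefficient times $V(f)$. -/
theorem sectionAction_heckeT_sum
    (hV : IsLabelFamily (Algebra.lsmul ℂ ℂ M : Hecke n k →ₐ[ℂ] Module.End ℂ M) ε x V) (i : Fin n) :
    sectionAction n k q L M
        ((cherednikT k⁻¹ k q i + ((k : ℂ) - ((k⁻¹ : ℂˣ) : ℂ)) • 1) ⊗ₜ[ℂ] 1 - 1 ⊗ₜ[ℂ] heckeT k i)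
        (∑ f ∈ labelOrbit f₀, F f ⊗ₜ[ℂ] V f) =
      ∑ f ∈ labelOrbit f₀, (cherednikRep n k q L (heckeT k⁻¹ i) (F f) +
        ((k : ℂ) - ((k⁻¹ : ℂˣ) : ℂ)) • F f -
        (diagCoeff k ε (f i.castSucc) (f i.succ) • F f +
          swapCoeff (f i.castSucc) (f i.succ) • F (f ∘ ⇑(simpleRefl i)))) ⊗ₜ[ℂ] V f := by
  have h1 : ∀ f, sectionAction n k q L M
        ((cherednikT k⁻¹ k q i + ((k : ℂ) - ((k⁻¹ : ℂˣ) : ℂ)) • 1) ⊗ₜ[ℂ] 1 - 1 ⊗ₜ[ℂ] heckeT k i)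
        (F f ⊗ₜ[ℂ] V f) = (cherednikRep n k q L (heckeT k⁻¹ i) (F f) +
        ((k : ℂ) - ((k⁻¹ : ℂˣ) : ℂ)) • F f -
        diagCoeff k ε (f i.castSucc) (f i.succ) • F f) ⊗ₜ[ℂ] V f -
          (swapCoeff (f i.castSucc) (f i.succ) • F f) ⊗ₜ[ℂ] V (f ∘ ⇑(simpleRefl i)) := fun f => by
    have h2 : heckeT k i • V f = _ := hV.heckeT_apply f i
    rw [map_sub, LinearMap.sub_apply, sectionAction_tmul, sectionAction_tmul, one_smul, one_smul,
      h2, add_smul, smul_assoc, one_smul, ← cherednik_heckeT, ← cherednikRep_apply,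
      TensorProduct.tmul_add, TensorProduct.tmul_smul, TensorProduct.tmul_smul,
      TensorProduct.sub_tmul, TensorProduct.smul_tmul', TensorProduct.smul_tmul']
    abel
  have h3 : ∑ f ∈ labelOrbit f₀,
      (swapCoeff (f i.castSucc) (f i.succ) • F f) ⊗ₜ[ℂ] V (f ∘ ⇑(simpleRefl i)) =
      ∑ f ∈ labelOrbit f₀,
        (swapCoeff (f i.castSucc) (f i.succ) • F (f ∘ ⇑(simpleRefl i))) ⊗ₜ[ℂ] V f := by
    rw [← sum_labelOrbit_comp (simpleRefl i)]
    refine Finset.sum_congr rfl fun f _ => ?_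
    rw [comp_simpleRefl_comp_simpleRefl, Function.comp_apply, Function.comp_apply,
      simpleRefl_castSucc, simpleRefl_succ, swapCoeff_comm]
  rw [map_sum, Finset.sum_congr rfl fun f _ => h1 f, Finset.sum_sub_distrib, h3,
    ← Finset.sum_sub_distrib]
  refine Finset.sum_congr rfl fun f _ => ?_
  rw [← TensorProduct.sub_tmul, sub_sub]

/-- Reindexing by $\sigma$ transfers the rotation from $V$ to $F$; the scalar, taken from the last
label before, is now taken from the first. -/
theorem sectionAction_nablaZ_sum
    (hV : IsLabelFamily (Algebra.lsmul ℂ ℂ M : Hecke n k →ₐ[ℂ] Module.End ℂ M) ε x V) :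
    sectionAction n k q L M (nablaZ n k q) (∑ f ∈ labelOrbit f₀, F f ⊗ₜ[ℂ] V f) -
        ∑ f ∈ labelOrbit f₀, F f ⊗ₜ[ℂ] V f =
      ∑ f ∈ labelOrbit f₀, ((x (f 0) : ℂ) •
        cherednikRep n k q L (heckeZ n k⁻¹) (F (f ∘ ⇑(cyc n))) - F f) ⊗ₜ[ℂ] V f := by
  have h1 : ∀ f, sectionAction n k q L M (nablaZ n k q) (F f ⊗ₜ[ℂ] V f) =
      ((x (f (Fin.last n)) : ℂ) • cherednikRep n k q L (heckeZ n k⁻¹) (F f)) ⊗ₜ[ℂ]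
        V (f ∘ ⇑(cyc n)⁻¹) := fun f => by
    have h2 : heckeZ n k • V f = _ := hV.zeta f
    rw [nablaZ, sectionAction_tmul, h2, ← cherednik_heckeZ (κ := k⁻¹), ← cherednikRep_apply,
      TensorProduct.tmul_smul, TensorProduct.smul_tmul']
  rw [map_sum, Finset.sum_congr rfl fun f _ => h1 f, ← sum_labelOrbit_comp (cyc n),
    ← Finset.sum_sub_distrib]
  refine Finset.sum_congr rfl fun f _ => ?_
  rw [comp_cyc_cyc_inv, Function.comp_apply, cyc_last, TensorProduct.sub_tmul]

end Equation

variable {Λ : Type*} [LinearOrder Λ] {f₀ : Fin (n + 1) → Λ} {x : Λ → ℂˣ} {s : ℤˣ} {I : Set (Fin n)}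
  {γ : Fin (n + 1) → ℂˣ} {χ : affParabolic k I →ₐ[ℂ] ℂ} {V : (Fin (n + 1) → Λ) → PrincipalModule χ}
  {F : (Fin (n + 1) → Λ) → L}

theorem sum_mem_qkzSolutions {ε : ℂˣ} (hε : (ε : ℂ) * ε = ((k : ℂ) - ((k⁻¹ : ℂˣ) : ℂ)) * ε + 1)
    (hV : IsLabelFamily (Algebra.lsmul ℂ ℂ (PrincipalModule χ) :
      Hecke n k →ₐ[ℂ] Module.End ℂ (PrincipalModule χ)) ε x V)
    (hF : IsLabelFamily (cherednikRep n k q L) ε⁻¹ (dualScalar x)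
      (fun f : Fin (n + 1) → Λᵒᵈ => F (OrderDual.ofDual ∘ f))) :
    ∑ f ∈ labelOrbit f₀, F f ⊗ₜ[ℂ] V f ∈ qkzSolutions n k q L (PrincipalModule χ) := by
  obtain ⟨h1, h2⟩ := (isLabelFamily_dual_iff hε).mp hF
  refine (mem_qkzSolutions_iff _).mpr ⟨fun i => ?_, ?_⟩
  · rw [sectionAction_nablaS_iff, sectionAction_heckeT_sum F hV]
    exact Finset.sum_eq_zero fun f _ => by rw [h1, TensorProduct.zero_tmul]
  · rw [← sub_eq_zero, sectionAction_nablaZ_sum F hV]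
    exact Finset.sum_eq_zero fun f _ => by rw [h2, TensorProduct.zero_tmul]

/-- The vectors $V(f)$ of the orbit form a basis, so each equation for the sum holds coefficient by
coefficient. Off the orbit $F$ vanishes, and the orbit is stable under permutations, so the
conditions there are trivial. -/
theorem isLabelFamily_of_sum_mem (hχ : IsPrincipalChar s k I γ χ) (hf : IsBlockLabel I f₀)
    (hx : labelWeight (signUnit s k) x f₀ = γ)
    (hV : IsLabelFamily (Algebra.lsmul ℂ ℂ (PrincipalModule χ) :
      Hecke n k →ₐ[ℂ] Module.End ℂ (PrincipalModule χ)) (signUnit s k) x V)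
    (hw : ∀ w ∈ minCosetReps I, V (f₀ ∘ ⇑w⁻¹) = princVec χ w)
    (h0 : ∀ f, f ∉ labelOrbit f₀ → F f = 0)
    (hmem : ∑ f ∈ labelOrbit f₀, F f ⊗ₜ[ℂ] V f ∈ qkzSolutions n k q L (PrincipalModule χ)) :
    IsLabelFamily (cherednikRep n k q L) (signUnit s k)⁻¹ (dualScalar x)
      (fun f : Fin (n + 1) → Λᵒᵈ => F (OrderDual.ofDual ∘ f)) := by
  have key : ∀ E : (Fin (n + 1) → Λ) → L, ∑ f ∈ labelOrbit f₀, E f ⊗ₜ[ℂ] V f = 0 →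
      ∀ f ∈ labelOrbit f₀, E f = 0 := fun E hE f hfm => by
    obtain ⟨w, hwI, rfl⟩ := hf.exists_of_mem_labelOrbit hfm
    rw [hf.sum_labelOrbit, Finset.sum_congr rfl fun v hv => by
      rw [hw v ((Set.Finite.mem_toFinset _).mp hv)]] at hE
    exact eq_zero_of_sum_tmul_eq_zero (Set.toFinite (minCosetReps I))
      (linearIndependent_princVec hχ hf hx) (span_princVec hχ hf hx)
      (a := fun w : Equiv.Perm (Fin (n + 1)) => E (f₀ ∘ ⇑w⁻¹)) hE hwI
  obtain ⟨h1, h2⟩ := (mem_qkzSolutions_iff _).mp hmem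
  refine (isLabelFamily_dual_iff (signUnit_quad s k)).mpr ⟨fun f i => ?_, fun f => ?_⟩
  · by_cases hfm : f ∈ labelOrbit f₀
    · have h := h1 i
      rw [sectionAction_nablaS_iff, sectionAction_heckeT_sum F hV] at h
      exact key _ h f hfm
    · rw [h0 f hfm, h0 _ (mt (comp_mem_labelOrbit_iff (simpleRefl i)).mp hfm)]
      simp
  · by_cases hfm : f ∈ labelOrbit f₀
    · rw [← sub_eq_zero, sectionAction_nablaZ_sum F hV] at h2
      exact key _ h2 f hfm
    · rw [h0 f hfm, h0 _ (mt (comp_mem_labelOrbit_iff (cyc n)).mp hfm)]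
      simp

/-- A dual family is generated from its value at the reversed labelling by the elements
$T_{w\overline{w_0}^{-1}}$, and by `dualLabel_comp` these reach the labelling of $v_w$. -/
theorem psi_eq_sum {ε : ℂˣ} (hf : IsBlockLabel I f₀)
    (hw : ∀ w ∈ minCosetReps I, V (f₀ ∘ ⇑w⁻¹) = princVec χ w)
    (hF : IsLabelFamily (cherednikRep n k q L) ε⁻¹ (dualScalar x)
      (fun f : Fin (n + 1) → Λᵒᵈ => F (OrderDual.ofDual ∘ f))) :
    psi q χ (F (f₀ ∘ ⇑(longest n))) = ∑ f ∈ labelOrbit f₀, F f ⊗ₜ[ℂ] V f := by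
  rw [psi, hf.sum_labelOrbit]
  refine Finset.sum_congr rfl fun w hwm => ?_
  have hwI := (Set.Finite.mem_toFinset _).mp hwm
  have h := hF.heckeTw_apply hf.dual (mul_minCosetRep_inv_mem hwI)
  change cherednik n k⁻¹ k q _ • F (f₀ ∘ ⇑(longest n)) =
    F (OrderDual.ofDual ∘ (dualLabel f₀ ∘ _)) at h
  rw [hf.dualLabel_comp] at h
  rw [h, hw w hwI]
  rfl

/-- The weight space imposes exactly the eigenvalues that `exists_labelFamily` asks for over
$H(k^{-1})$ at the reversed labelling. -/
theorem exists_dualFamily (hf : IsBlockLabel I f₀) (hx : labelWeight (signUnit s k) x f₀ = γ)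
    {φ : L} (hφ : φ ∈ weightSpace k q L s k⁻¹ (starSet I)
      (permTorus (minCosetRep I (longest n)) γ⁻¹)) :
    ∃ F : (Fin (n + 1) → Λ) → L,
      IsLabelFamily (cherednikRep n k q L) (signUnit s k)⁻¹ (dualScalar x)
        (fun f : Fin (n + 1) → Λᵒᵈ => F (OrderDual.ofDual ∘ f)) ∧ F (f₀ ∘ ⇑(longest n)) = φ := by
  obtain ⟨h1, h2⟩ := mem_weightSpace_iff.mp hφ
  obtain ⟨F, hF, h⟩ := exists_labelFamily (signUnit_quad s k⁻¹) hf.dual (dualScalar x)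
    (cherednikRep n k q L) φ h1 fun j => by
      rw [signUnit_inv]
      change _ = (labelWeight _ _ (dualLabel f₀) j : ℂ) • φ
      rw [labelWeight_dual hf, hx, h2]
  rw [signUnit_inv] at hF
  exact ⟨fun f => F (OrderDual.toDual ∘ f), hF, h⟩

theorem apply_longest_mem_weightSpace (hf : IsBlockLabel I f₀)
    (hx : labelWeight (signUnit s k) x f₀ = γ)
    (hF : IsLabelFamily (cherednikRep n k q L) (signUnit s k)⁻¹ (dualScalar x)
      (fun f : Fin (n + 1) → Λᵒᵈ => F (OrderDual.ofDual ∘ f))) :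
    F (f₀ ∘ ⇑(longest n)) ∈ weightSpace k q L s k⁻¹ (starSet I)
      (permTorus (minCosetRep I (longest n)) γ⁻¹) := by
  refine mem_weightSpace_iff.mpr ⟨fun i hi => ?_, fun j => ?_⟩
  · rw [signUnit_inv]
    exact hF.eq (dualLabel f₀) i ((hf.dual.eq_iff i).mpr hi)
  · have h := hF.unitY_apply (f := dualLabel f₀) hf.dual.mono j
    rw [labelWeight_dual hf, hx] at h
    exact h

variable (q L) in
/-- The map `φ ↦ ψ_φ` is linear. -/
noncomputable def psiHom (χ : affParabolic k I →ₐ[ℂ] ℂ) : L →ₗ[ℂ] L ⊗[ℂ] PrincipalModule χ where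
  toFun := psi q χ
  map_add' φ φ' := by
    simp only [psi, smul_add, TensorProduct.add_tmul, Finset.sum_add_distrib]
  map_smul' c φ := by
    rw [RingHom.id_apply, psi, psi, Finset.smul_sum]
    refine Finset.sum_congr rfl fun w _ => ?_
    rw [← cherednikRep_apply, map_smul, TensorProduct.smul_tmul', cherednikRep_apply]

theorem psi_mem_qkzSolutions (hχ : IsPrincipalChar s k I γ χ) (hf : IsBlockLabel I f₀)
    (hx : labelWeight (signUnit s k) x f₀ = γ) {φ : L}
    (hφ : φ ∈ weightSpace k q L s k⁻¹ (starSet I) (permTorus (minCosetRep I (longest n)) γ⁻¹)) :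
    psi q χ φ ∈ qkzSolutions n k q L (PrincipalModule χ) := by
  obtain ⟨V, hV, hw⟩ := exists_princFamily hχ hf hx
  obtain ⟨F, hF, rfl⟩ := exists_dualFamily hf hx hφ
  rw [psi_eq_sum hf hw hF]
  exact sum_mem_qkzSolutions (signUnit_quad s k) hV hF

theorem exists_psi_eq (hχ : IsPrincipalChar s k I γ χ) (hf : IsBlockLabel I f₀)
    (hx : labelWeight (signUnit s k) x f₀ = γ) {ψ : L ⊗[ℂ] PrincipalModule χ}
    (hψ : ψ ∈ qkzSolutions n k q L (PrincipalModule χ)) :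
    ∃ φ ∈ weightSpace k q L s k⁻¹ (starSet I) (permTorus (minCosetRep I (longest n)) γ⁻¹),
      psi q χ φ = ψ := by
  classical
  obtain ⟨V, hV, hw⟩ := exists_princFamily hχ hf hx
  obtain ⟨a, rfl⟩ := exists_eq_sum_tmul (Set.toFinite (minCosetReps I))
    (linearIndependent_princVec hχ hf hx) (span_princVec hχ hf hx) ψ
  -- The coefficient of $v_w$ becomes the value at $f_0\circ w^{-1}$, extended by zero off the
  -- orbit.
  let F : (Fin (n + 1) → Λ) → L := fun f =>
    if h : ∃ w ∈ minCosetReps I, f₀ ∘ ⇑w⁻¹ = f then a h.choose else 0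
  have hFa : ∀ w ∈ minCosetReps I, F (f₀ ∘ ⇑w⁻¹) = a w := fun w hwI => by
    have h : ∃ v ∈ minCosetReps I, f₀ ∘ ⇑v⁻¹ = f₀ ∘ ⇑w⁻¹ := ⟨w, hwI, rfl⟩
    simp only [F]
    rw [dif_pos h, hf.inj h.choose_spec.1 hwI h.choose_spec.2]
  have hsum : ∑ w ∈ (Set.toFinite (minCosetReps I)).toFinset, a w ⊗ₜ[ℂ] princVec χ w =
      ∑ f ∈ labelOrbit f₀, F f ⊗ₜ[ℂ] V f := by
    rw [hf.sum_labelOrbit]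
    refine Finset.sum_congr rfl fun w hwm => ?_
    have hwI := (Set.Finite.mem_toFinset _).mp hwm
    rw [hFa w hwI, hw w hwI]
  rw [hsum] at hψ ⊢
  have hF := isLabelFamily_of_sum_mem hχ hf hx hV hw
    (fun f h => dif_neg fun ⟨w, _, h'⟩ => h (mem_labelOrbit.mpr ⟨w⁻¹, h'⟩)) hψ
  exact ⟨_, apply_longest_mem_weightSpace hf hx hF, psi_eq_sum hf hw hF⟩

/-- The coefficient of $\psi_\phi$ at $w=\overline{w_0}$ is $\phi$ itself. -/
theorem eq_zero_of_psi_eq_zero (hχ : IsPrincipalChar s k I γ χ) (hf : IsBlockLabel I f₀)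
    (hx : labelWeight (signUnit s k) x f₀ = γ) {φ : L} (h : psi q χ φ = 0) : φ = 0 := by
  have := eq_zero_of_sum_tmul_eq_zero (Set.toFinite (minCosetReps I))
    (linearIndependent_princVec hχ hf hx) (span_princVec hχ hf hx)
    (a := fun w : Equiv.Perm (Fin (n + 1)) =>
      cherednik n k⁻¹ k q (heckeTw k⁻¹ (w * (minCosetRep I (longest n))⁻¹)) • φ) h
    (minCosetRep_mem (longest n))
  simpa only [mul_inv_cancel, heckeTw_one, map_one, one_smul] using this

end Solutions

end AffineKZ

/-! ### The correspondence between the weight space and the solutions -/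

theorem mainTheorem7 (n : ℕ) (hn : 1 ≤ n) (k q : ℂˣ) (s : ℤˣ) (I : Set (Fin n))
    (γ : Fin (n + 1) → ℂˣ) (hγ : γ ∈ AffineKZ.torusSet s k I)
    (L : Type*) [AddCommGroup L] [Module ℂ L] [Module (AffineKZ.DiffRefl n k q) L]
    [IsScalarTower ℂ (AffineKZ.DiffRefl n k q) L] :
    (∃! χ : AffineKZ.affParabolic k I →ₐ[ℂ] ℂ, AffineKZ.IsPrincipalChar s k I γ χ) ∧
    ∀ χ : AffineKZ.affParabolic k I →ₐ[ℂ] ℂ, AffineKZ.IsPrincipalChar s k I γ χ →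
      ∃ e : AffineKZ.weightSpace k q L s k⁻¹ (AffineKZ.starSet I)
            (AffineKZ.permTorus (AffineKZ.minCosetRep I (AffineKZ.longest n)) γ⁻¹) ≃ₗ[ℂ]
          AffineKZ.qkzSolutions n k q L (AffineKZ.PrincipalModule χ),
        ∀ φ, (e φ : L ⊗[ℂ] AffineKZ.PrincipalModule χ) = AffineKZ.psi q χ (φ : L) := by
  have hf := AffineKZ.isBlockLabel_blockLabel I
  -- The torus condition enters only here: $k^{\pm2}$ is the square of $\epsilon=\pm k^{\pm1}$.
  obtain ⟨x, hx⟩ := AffineKZ.exists_labelWeight_eq (AffineKZ.signUnit s k) hf γ fun i hi => by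
    rw [AffineKZ.signUnit_mul_self]
    exact hγ i hi
  refine ⟨?_, fun χ hχ => ?_⟩
  · obtain ⟨χ, hχ⟩ := AffineKZ.exists_isPrincipalChar hf hx
    exact ⟨χ, hχ, fun χ' hχ' => AffineKZ.isPrincipalChar_unique hχ' hχ⟩
  · let e₀ := (AffineKZ.psiHom q L χ).restrict
      fun φ (hφ : φ ∈ AffineKZ.weightSpace k q L s k⁻¹ (AffineKZ.starSet I)
        (AffineKZ.permTorus (AffineKZ.minCosetRep I (AffineKZ.longest n)) γ⁻¹)) =>
          AffineKZ.psi_mem_qkzSolutions hχ hf hx hφ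
    refine ⟨LinearEquiv.ofBijective e₀ ⟨?_, fun ψ => ?_⟩, fun φ => rfl⟩
    · rw [← LinearMap.ker_eq_bot, LinearMap.ker_eq_bot']
      intro φ h
      exact Subtype.ext (AffineKZ.eq_zero_of_psi_eq_zero hχ hf hx (congrArg Subtype.val h))
    · obtain ⟨φ, hφ, h⟩ := AffineKZ.exists_psi_eq hχ hf hx ψ.2
      exact ⟨⟨φ, hφ⟩, Subtype.ext h⟩
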